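/- **Setting.** Let $\mathcal A$ be a finite alphabet with $|\mathcal A|\ge 2$ and let $(p_\alpha)_{\alpha\in\mathcal A}$ be a probability distribution on $\mathcal A$ with every $p_\alpha>0$. Let $H:=-\sum_{\alpha}p_\alpha\ln p_\alpha$, and let $d_{\mathcal A}$ be the largest $d>0$ such that $\ln p_\alpha\in d\mathbb Z$ for all $\alpha$, with $d_{\mathcal A}:=0$ if no such $d$ exists. The trie of $n$ distinct infinite strings over $\mathcal A$ is the finite set $T$ of those finite strings $\boldsymbol\alpha$ that either are a prefix of at least two of the strings, or are a prefix of exactly one of them and are empty or have a parent ($\boldsymbol\alpha$ with its last letter removed) that is a prefix of at least two. Let $\emptyset$ be the empty trie ($n=0$) and $\bullet$ the trie consisting of the root only ($n=1$). For a trie $T$ and $v\in T$, the fringe tree is $T^v:=\{\beta: v\beta\in T\}$. For $\lambda>0$ let $N_\lambda\sim\mathrm{Po}(\lambda)$ be independent of a sequence of i.i.d. random infinite strings with i.i.d. letters of distribution $(p_\alpha)$, and let $\mathcal T_\lambda$ be the trie of the first $N_\lambda$ strings. For $f:(0,\infty)\to\mathbb R$ let $\mathcal M f(s):=\int_0^\infty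 f(x)x^{s-1}\,dx$. **Theorem.** Let $\varphi$ be a real-valued function on the set of tries with $\varphi(\emptyset)=0$, and let $\Phi(T):=\sum_{v\in T}\varphi(T^v)$. Suppose that for some $\varepsilon>0$, as $\lambda\to\infty$, $\mathbb E\,\varphi(\mathcal T_\lambda)=O(\lambda^{1-\varepsilon})$ and $\operatorname{Var}\varphi(\mathcal T_\lambda)=O(\lambda^{1-\varepsilon})$ (in particular these are finite for large $\lambda$). Then $\varphi(\mathcal T_\lambda)$ and $\Phi(\mathcal T_\lambda)$ have finite second moments for every $\lambda>0$. Let $\chi:=\varphi(\bullet)$ and $$f_E(\lambda):=\mathbb E\varphi(\mathcal T_\lambda)-\chi\lambda e^{-\lambda},$$ $$f_V(\lambda):=2\operatorname{Cov}(\varphi(\mathcal T_\lambda),\Phi(\mathcal T_\lambda))-\operatorname{Var}\varphi(\mathcal T_\lambda)+2\chi\lambda e^{-\lambda}\bigl(\mathbb E\Phi(\mathcal T_\lambda)-\mathbb E\varphi(\mathcal T_\lambda)\bigr)-\chi^2\lambda e^{-\lambda}(1-\lambda e^{-\lambda}),$$ $$f_C(\lambda):=\operatorname{Cov}(\varphi(\mathcal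 T_\lambda),N_\lambda)+\chi\lambda(\lambda-1)e^{-\lambda}.$$ (i) If $d_{\mathcal A}=0$, then, as $\lambda\to\infty$, $$\frac{\mathbb E\Phi(\mathcal T_\lambda)}\lambda\to\chi+\frac1H\mathcal M f_E(-1),\quad \frac{\operatorname{Var}\Phi(\mathcal T_\lambda)}\lambda\to\chi^2+\frac1H\mathcal M f_V(-1),\quad \frac{\operatorname{Cov}(\Phi(\mathcal T_\lambda),N_\lambda)}\lambda\to\chi+\frac1H\mathcal M f_C(-1),$$ where $\mathcal M f_X(-1)=\int_0^\infty f_X(x)x^{-2}\,dx$. (ii) For any $d_{\mathcal A}$, as $\lambda\to\infty$, $$\frac{\mathbb E\Phi(\mathcal T_\lambda)}\lambda=\chi+\frac1H\psi_E(\ln\lambda)+o(1),\quad \frac{\operatorname{Var}\Phi(\mathcal T_\lambda)}\lambda=\chi^2+\frac1H\psi_V(\ln\lambda)+o(1),\quad \frac{\operatorname{Cov}(\Phi(\mathcal T_\lambda),N_\lambda)}\lambda=\chi+\frac1H\psi_C(\ln\lambda)+o(1),$$ where, for $X\in\{E,V,C\}$, $\psi_X:\mathbb R\to\mathbb R$ is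 the bounded continuous function determined as follows (all Mellin integrals below converge absolutely). (a) If $d_{\mathcal A}=0$, then $\psi_X(t)=\mathcal M f_X(-1)$ for all $t$. (b) If $d:=d_{\mathcal A}>0$, then $\psi_X$ is $d$-periodic with Fourier series $$\psi_X(t)\sim\sum_{m=-\infty}^\infty \mathcal M f_X\Bigl(-1-\frac{2\pi m}{d}\mathrm i\Bigr)e^{2\pi \mathrm i mt/d},$$ and $\psi_X(t)=d\sum_{k=-\infty}^\infty e^{kd-t}f_X(e^{t-kd})$ for all $t$. Moreover, if $X=E$, or if $f_X'(\lambda)=O(\lambda^{-\varepsilon_1})$ as $\lambda\to\infty$ for some $\varepsilon_1>0$, then the Fourier series converges absolutely, with sum $\psi_X(t)$ for every $t$. (iii) If $\varphi(T)\ge0$ for every trie $T$ and $\varphi(T')>0$ for some trie $T'$, then $\inf_t\bigl(H^{-1}\psi_E(t)+\chi\bigr)>0$, and $\mathbb E\Phi(\mathcal T_\lambda)=\Theta(\lambda)$ as $\lambda\to\infty$. -/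

import Mathlib

namespace RandomTrie

open MeasureTheory ProbabilityTheory

noncomputable section

/-! Finite strings over the alphabet `A` are lists (first letter = head), infinite strings are
functions `ℕ → A`, and a finite `A`-ary tree is the finite set of its nodes, a
`Finset (List A)`. -/

/-- The finite string `α` is a prefix of the infinite string `x`. -/
def IsPrefixOf {A : Type*} (α : List A) (x : ℕ → A) : Prop :=
  ∀ (i : ℕ) (h : i < α.length), x i = α[i]

open scoped Classical in
/-- The number of strings among the first `n` strings `Ξ 0, …, Ξ (n - 1)` with prefix `α`. -/
def prefixCount {A : Type*} (Ξ : ℕ → ℕ → A) (n : ℕ) (α : List A) : ℕ :=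
  ((Finset.range n).filter fun k => IsPrefixOf α (Ξ k)).card

/-- The node set of the trie built from the first `n` of the strings `Ξ`: internal nodes are the
`α` that are a prefix of at least two strings; external nodes are the `α` that are a prefix of
exactly one string and are the root or have an internal parent. -/
def trieNodes {A : Type*} (Ξ : ℕ → ℕ → A) (n : ℕ) : Set (List A) :=
  {α | 2 ≤ prefixCount Ξ n α ∨
    (prefixCount Ξ n α = 1 ∧ (α = [] ∨ 2 ≤ prefixCount Ξ n α.dropLast))}

open scoped Classical in
/-- The trie built from the first `n` of the strings `Ξ`. If these are distinct, the node set is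
finite; if two of them coincide (an event of probability 0 for random strings), the node set is
infinite and the value is by convention the empty tree. -/
def trie {A : Type*} (Ξ : ℕ → ℕ → A) (n : ℕ) : Finset (List A) :=
  if h : (trieNodes Ξ n).Finite then h.toFinset else ∅

/-- A finite tree is a trie if it is generated by some finite set of distinct strings. -/
def IsTrie {A : Type*} (T : Finset (List A)) : Prop :=
  ∃ (n : ℕ) (Ξ : ℕ → ℕ → A), Set.InjOn Ξ (Set.Iio n) ∧ T = trie Ξ n

/-- The tree `•` consisting of the root only. -/
def bullet (A : Type*) : Finset (List A) := {[]}

/-- The fringe tree `T^v = {β | vβ ∈ T}` (empty if `v ∉ T`). -/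
def fringe {A : Type*} (T : Finset (List A)) (v : List A) : Finset (List A) :=
  T.preimage (fun β => v ++ β) (List.append_right_injective v).injOn

/-- The additive functional `Φ(T) = ∑_{v ∈ T} φ(T^v)` with toll function `φ`. -/
def additive {A : Type*} (φ : Finset (List A) → ℝ) (T : Finset (List A)) : ℝ :=
  ∑ v ∈ T, φ (fringe T v)

/-- The entropy `H = -∑ p_a ln p_a` of a letter distribution. -/
def entropy {A : Type*} [Fintype A] (p : PMF A) : ℝ :=
  -∑ a, (p a).toReal * Real.log (p a).toReal

/-- The greatest common divisor of a set of reals: the largest `d > 0` with `S ⊆ dℤ`, and `0` if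
there is no such `d` (note `sSup ∅ = 0`; if `S` contains a non-zero element, then the set of
these `d` is bounded, and its supremum is attained if it is non-empty). -/
def realGcd (S : Set ℝ) : ℝ :=
  sSup {d : ℝ | 0 < d ∧ ∀ x ∈ S, ∃ k : ℤ, x = k * d}

/-- `d_A = gcd {-ln p_a : a ∈ A}`. -/
def period {A : Type*} (p : PMF A) : ℝ :=
  realGcd (Set.range fun a => -Real.log (p a).toReal)

/-- The Poisson model with parameter `l` (used for `l > 0`): a point is a pair `(N, Ξ)` of the
number `N ∼ Po(l)` of strings and an independent sequence `Ξ` of strings, all of whose letters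
are i.i.d. with law `p`. -/
def model {A : Type*} [MeasurableSpace A] (p : PMF A) (l : ℝ) :
    Measure (ℕ × (ℕ → ℕ → A)) :=
  (poissonMeasure l.toNNReal).prod
    (Measure.infinitePi fun _ : ℕ => Measure.infinitePi fun _ : ℕ => p.toMeasure)

/-- The random trie `T_l`, as a function on the Poisson model. -/
def randomTrie {A : Type*} (ω : ℕ × (ℕ → ℕ → A)) : Finset (List A) :=
  trie ω.2 ω.1

/-- The number of strings `N_l`, as a real function on the Poisson model. -/
def numStrings {A : Type*} (ω : ℕ × (ℕ → ℕ → A)) : ℝ :=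
  (ω.1 : ℝ)

section Moments

variable {A : Type*} [MeasurableSpace A]

/-- `E φ(T_l)`. -/
def meanOf (p : PMF A) (φ : Finset (List A) → ℝ) (l : ℝ) : ℝ :=
  ∫ ω, φ (randomTrie ω) ∂(model p l)

/-- `Var φ(T_l)`. -/
def varOf (p : PMF A) (φ : Finset (List A) → ℝ) (l : ℝ) : ℝ :=
  variance (fun ω => φ (randomTrie ω)) (model p l)

/-- `Cov(φ(T_l), φ'(T_l))`. -/
def covOf (p : PMF A) (φ φ' : Finset (List A) → ℝ) (l : ℝ) : ℝ :=
  covariance (fun ω => φ (randomTrie ω)) (fun ω => φ' (randomTrie ω)) (model p l)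

/-- `Cov(φ(T_l), N_l)`. -/
def covNumOf (p : PMF A) (φ : Finset (List A) → ℝ) (l : ℝ) : ℝ :=
  covariance (fun ω => φ (randomTrie ω)) numStrings (model p l)

/-- `φ(T_l)` has a finite second moment. -/
def HasSecondMoment (p : PMF A) (φ : Finset (List A) → ℝ) (l : ℝ) : Prop :=
  MemLp (fun ω => φ (randomTrie ω)) 2 (model p l)

/-- `f_E(l) = E φ(T_l) - χ l e^{-l}`. -/
def fE (p : PMF A) (φ : Finset (List A) → ℝ) (l : ℝ) : ℝ :=
  meanOf p φ l - φ (bullet A) * l * Real.exp (-l)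

/-- `f_V(l) = 2 Cov(φ(T_l), Φ(T_l)) - Var φ(T_l) + 2 χ l e^{-l} (E Φ(T_l) - E φ(T_l))
- χ² l e^{-l} (1 - l e^{-l})`. -/
def fV (p : PMF A) (φ : Finset (List A) → ℝ) (l : ℝ) : ℝ :=
  2 * covOf p φ (additive φ) l - varOf p φ l
    + 2 * φ (bullet A) * l * Real.exp (-l) * (meanOf p (additive φ) l - meanOf p φ l)
    - φ (bullet A) ^ 2 * l * Real.exp (-l) * (1 - l * Real.exp (-l))

/-- `f_C(l) = Cov(φ(T_l), N_l) + χ l (l - 1) e^{-l}`. -/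
def fC (p : PMF A) (φ : Finset (List A) → ℝ) (l : ℝ) : ℝ :=
  covNumOf p φ l + φ (bullet A) * l * (l - 1) * Real.exp (-l)

end Moments

/-- The Mellin transform of a real function. -/
def mellinR (f : ℝ → ℝ) (s : ℂ) : ℂ :=
  mellin (fun x => (f x : ℂ)) s

/-- The point `-1 - (2πm/d) i`. -/
def mellinPoint (d : ℝ) (m : ℤ) : ℂ :=
  -1 - (2 * Real.pi * m / d : ℝ) * Complex.I

/-- `ψ` is the bounded continuous function attached to `f` and `d ≥ 0`. For `d = 0` it is the
constant `Mf(-1)`; for `d > 0` it is `d`-periodic, has the Fourier coefficients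
`Mf(-1 - 2πmi/d)`, and is given by the (absolutely convergent) lattice sum
`ψ(t) = d ∑_k e^{kd-t} f(e^{t-kd})`. The Mellin integrals involved converge absolutely.
The conditions determine `ψ` uniquely. -/
structure IsPsi (d : ℝ) (f ψ : ℝ → ℝ) : Prop where
  continuous : Continuous ψ
  bounded : ∃ C : ℝ, ∀ t, |ψ t| ≤ C
  mellinConvergent : MellinConvergent (fun x => (f x : ℂ)) (-1)
  const : d = 0 → ∀ t, (ψ t : ℂ) = mellinR f (-1)
  periodic : 0 < d → Function.Periodic ψ d
  mellinConvergent' : 0 < d → ∀ m : ℤ,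
    MellinConvergent (fun x => (f x : ℂ)) (mellinPoint d m)
  fourier : ∀ hd : 0 < d, ∀ m : ℤ,
    fourierCoeffOn hd (fun t => (ψ t : ℂ)) m = mellinR f (mellinPoint d m)
  latticeSum : 0 < d → ∀ t : ℝ,
    HasSum (fun k : ℤ => d * (Real.exp (k * d - t) * f (Real.exp (t - k * d)))) (ψ t)

/-- The Fourier series of `ψ` with coefficients `Mf(-1 - 2πmi/d)` converges absolutely, with
sum `ψ`. -/
def FourierSeriesConverges (d : ℝ) (f ψ : ℝ → ℝ) : Prop :=
  (Summable fun m : ℤ => ‖mellinR f (mellinPoint d m)‖) ∧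
    ∀ t : ℝ, HasSum (fun m : ℤ => mellinR f (mellinPoint d m) *
      Complex.exp (2 * Real.pi * Complex.I * m * t / d)) (ψ t : ℂ)

end

end RandomTrie

namespace RandomTrie
open Filter Topology MeasureTheory

/-! ### A renewal theorem for finitely supported step distributions -/

/-- Induction along the real line in steps of length `x₀`, starting from a neighbourhood of `-∞`. -/
lemma le_of_step {R S : ℝ → ℝ} {x₀ t₀ : ℝ} (hx : 0 < x₀) (h0 : ∀ t ≤ t₀, R t ≤ S t)
    (hs : ∀ t, (∀ s ≤ t - x₀, R s ≤ S s) → R t ≤ S t) (t : ℝ) : R t ≤ S t := by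
  have key : ∀ n : ℕ, ∀ t ≤ t₀ + n * x₀, R t ≤ S t := by
    intro n
    induction n with
    | zero => simpa using h0
    | succ n ih =>
      intro t ht
      refine hs t fun s hs' => ih s ?_
      push_cast at ht
      linarith
  obtain ⟨n, hn⟩ := exists_nat_ge ((t - t₀) / x₀)
  exact key n t (by rw [div_le_iff₀ hx] at hn; linarith)

/-- A bounded increasing function whose increments over a fixed distance dominate a multiple of
`exp (-δ |t|)`. -/
noncomputable def barrier (δ t : ℝ) : ℝ :=
  if t ≤ 0 then Real.exp (δ * t) else 2 - Real.exp (-(δ * t))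

lemma barrier_nonneg {δ : ℝ} (hδ : 0 < δ) (t : ℝ) : 0 ≤ barrier δ t := by
  unfold barrier
  split_ifs with h
  · positivity
  · have : Real.exp (-(δ * t)) ≤ 1 := Real.exp_le_one_iff.2 (by nlinarith)
    linarith

lemma barrier_le_two {δ : ℝ} (hδ : 0 < δ) (t : ℝ) : barrier δ t ≤ 2 := by
  unfold barrier
  split_ifs with h
  · have : Real.exp (δ * t) ≤ 1 := Real.exp_le_one_iff.2 (by nlinarith)
    linarith
  · have := Real.exp_pos (-(δ * t))
    linarith

lemma barrier_mono {δ : ℝ} (hδ : 0 < δ) : Monotone (barrier δ) := by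
  intro s t hst
  unfold barrier
  split_ifs with h1 h2 h2
  · exact Real.exp_le_exp.2 (by nlinarith)
  · have h3 : Real.exp (δ * s) ≤ 1 := Real.exp_le_one_iff.2 (by nlinarith)
    have h4 : Real.exp (-(δ * t)) ≤ 1 := Real.exp_le_one_iff.2 (by nlinarith)
    linarith
  · linarith
  · have : Real.exp (-(δ * t)) ≤ Real.exp (-(δ * s)) := Real.exp_le_exp.2 (by nlinarith)
    linarith

lemma exists_barrier_sub {δ x₀ : ℝ} (hδ : 0 < δ) (hx₀ : 0 < x₀) :
    ∃ c : ℝ, 0 < c ∧ ∀ t x, x₀ ≤ x →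
      c * Real.exp (-(δ * |t|)) ≤ barrier δ t - barrier δ (t - x) := by
  have hlt : Real.exp (-(δ * x₀ / 2)) < 1 := Real.exp_lt_one_iff.2 (by have := mul_pos hδ hx₀; linarith)
  refine ⟨1 - Real.exp (-(δ * x₀ / 2)), by linarith, fun t x hx => ?_⟩
  have hm := barrier_mono hδ (show t - x ≤ t - x₀ by linarith)
  suffices h : (1 - Real.exp (-(δ * x₀ / 2))) * Real.exp (-(δ * |t|))
      ≤ barrier δ t - barrier δ (t - x₀) by linarith
  have hδx := mul_pos hδ hx₀
  have h1 : Real.exp (-(δ * x₀)) ≤ Real.exp (-(δ * x₀ / 2)) := Real.exp_le_exp.2 (by linarith)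
  unfold barrier
  rcases le_or_gt t 0 with ht | ht
  · rw [if_pos ht, if_pos (by linarith), abs_of_nonpos ht]
    have : Real.exp (δ * (t - x₀)) = Real.exp (δ * t) * Real.exp (-(δ * x₀)) := by
      rw [← Real.exp_add]; ring_nf
    rw [this, show -(δ * -t) = δ * t by ring]
    nlinarith [Real.exp_pos (δ * t)]
  · rw [if_neg (by linarith), abs_of_pos ht]
    have hle1 : Real.exp (-(δ * t)) ≤ 1 := Real.exp_le_one_iff.2 (by nlinarith)
    split_ifs with h
    · have h2 : Real.exp (δ * (t - x₀)) ≤ 1 := Real.exp_le_one_iff.2 (by nlinarith)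
      have h4 : Real.exp (-(δ * t)) ≤ Real.exp (-(δ * x₀ / 2)) ∨
          Real.exp (δ * (t - x₀)) ≤ Real.exp (-(δ * x₀ / 2)) := by
        rcases le_or_gt (x₀ / 2) t with h5 | h5
        · left; exact Real.exp_le_exp.2 (by nlinarith)
        · right; exact Real.exp_le_exp.2 (by nlinarith)
      have h6 := Real.exp_pos (-(δ * t))
      rcases h4 with h4 | h4 <;> nlinarith
    · have : Real.exp (-(δ * (t - x₀))) = Real.exp (-(δ * t)) * Real.exp (δ * x₀) := by
        rw [← Real.exp_add]; ring_nf
      rw [this]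
      have h2 : Real.exp (-(δ * x₀ / 2)) + Real.exp (δ * x₀) ≥ 2 := by
        have e1 := Real.add_one_le_exp (-(δ * x₀ / 2))
        have e2 := Real.add_one_le_exp (δ * x₀)
        linarith
      nlinarith [Real.exp_pos (-(δ * t))]

section Renewal

variable {A : Type*} [Fintype A] {p x : A → ℝ} {x₀ : ℝ}

/-- The averaging operator of the step distribution `∑ p a • δ_{x a}`. -/
def stepAverage {A : Type*} [Fintype A] (p x : A → ℝ) (G : ℝ → ℝ) (t : ℝ) : ℝ :=
  ∑ a, p a * G (t - x a)

lemma stepAverage_sub (G D : ℝ → ℝ) (t : ℝ) :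
    stepAverage p x (fun s => G s - D s) t = stepAverage p x G t - stepAverage p x D t := by
  simp [stepAverage, mul_sub, Finset.sum_sub_distrib]

lemma renewal_le_barrier (hp : ∀ a, 0 ≤ p a) (hsum : ∑ a, p a = 1) (hx₀ : 0 < x₀)
    (hx : ∀ a, x₀ ≤ x a) {δ c : ℝ} (hc : 0 < c)
    (hb : ∀ t y, x₀ ≤ y → c * Real.exp (-(δ * |t|)) ≤ barrier δ t - barrier δ (t - y))
    {G g : ℝ → ℝ} {C : ℝ} (hδ : 0 < δ) (hC : 0 ≤ C)
    (hg : ∀ t, g t ≤ C * Real.exp (-(δ * |t|)))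
    (hG : ∀ t, G t = g t + stepAverage p x G t) (h0 : Tendsto G atBot (𝓝 0)) (t : ℝ) :
    G t ≤ C / c * barrier δ t := by
  refine le_of_forall_pos_le_add fun η hη => ?_
  have hev := (h0.eventually (gt_mem_nhds hη)).exists_forall_of_atBot
  obtain ⟨t₀, ht₀⟩ := hev
  refine le_of_step (R := G) (S := fun t => C / c * barrier δ t + η) (t₀ := t₀) hx₀ ?_ ?_ t
  · intro s hs
    have := barrier_nonneg hδ s
    have : 0 ≤ C / c * barrier δ s := by positivity
    linarith [ht₀ s hs]
  · intro s hs
    rw [hG]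
    have h1 : stepAverage p x G s ≤ ∑ a, p a * (C / c * barrier δ s + η
        - C * Real.exp (-(δ * |s|))) := by
      refine Finset.sum_le_sum fun a _ => mul_le_mul_of_nonneg_left ?_ (hp a)
      refine (hs _ (by linarith [hx a])).trans ?_
      have h2 := hb s (x a) (hx a)
      have h3 := mul_le_mul_of_nonneg_left h2 (show 0 ≤ C / c by positivity)
      have h4 : C / c * (c * Real.exp (-(δ * |s|))) = C * Real.exp (-(δ * |s|)) := by
        field_simp
      rw [h4] at h3
      linarith
    rw [← Finset.sum_mul, hsum, one_mul] at h1
    linarith [hg s]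

/-- A priori bound for solutions of the renewal equation. -/
lemma exists_renewal_bound (hp : ∀ a, 0 ≤ p a) (hsum : ∑ a, p a = 1) (hx₀ : 0 < x₀)
    (hx : ∀ a, x₀ ≤ x a) {δ : ℝ} (hδ : 0 < δ) :
    ∃ K : ℝ, 0 < K ∧ ∀ (G g : ℝ → ℝ) (C : ℝ), 0 ≤ C → (∀ t, |g t| ≤ C * Real.exp (-(δ * |t|))) →
      (∀ t, G t = g t + stepAverage p x G t) → Tendsto G atBot (𝓝 0) → ∀ t, |G t| ≤ K * C := by
  obtain ⟨c, hc, hb⟩ := exists_barrier_sub hδ hx₀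
  refine ⟨2 / c, by positivity, fun G g C hC hg hG h0 t => ?_⟩
  have h2 : C / c * barrier δ t ≤ 2 / c * C := by
    have := mul_le_mul_of_nonneg_left (barrier_le_two hδ t) (show 0 ≤ C / c by positivity)
    calc _ ≤ C / c * 2 := this
      _ = _ := by ring
  rw [abs_le]
  constructor
  · have := renewal_le_barrier (G := fun t => -G t) (g := fun t => -g t) hp hsum hx₀ hx hc hb hδ hC
      (fun t => (neg_le_abs _).trans (hg t))
      (fun t => by simp only [stepAverage, mul_neg, Finset.sum_neg_distrib]; rw [hG t, stepAverage]
                   ring)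
      (by simpa using h0.neg) t
    linarith
  · exact (renewal_le_barrier hp hsum hx₀ hx hc hb hδ hC
      (fun t => (le_abs_self _).trans (hg t)) hG h0 t).trans h2

/-- Exponentially decaying continuous functions have uniformly small, exponentially decaying
increments. -/
lemma increment_bound {g : ℝ → ℝ} (hgc : Continuous g) {C δ : ℝ} (hδ : 0 < δ)
    (hg : ∀ t, |g t| ≤ C * Real.exp (-(δ * |t|))) {η : ℝ} (hη : 0 < η) :
    ∃ ρ > 0, ∀ u, |u| < ρ → ∀ t, |g (t + u) - g t| ≤ η * Real.exp (-(δ / 2 * |t|)) := by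
  have hC : 0 ≤ C := by
    have := (abs_nonneg _).trans (hg 0)
    simpa using this
  set m : ℝ → ℝ := fun t => g t * Real.exp (δ / 2 * |t|) with hm
  have hmb : ∀ t, |m t| ≤ C * Real.exp (-(δ / 2 * |t|)) := by
    intro t
    rw [hm]
    simp only [abs_mul, Real.abs_exp]
    calc |g t| * Real.exp (δ / 2 * |t|) ≤ C * Real.exp (-(δ * |t|)) * Real.exp (δ / 2 * |t|) := by
          gcongr; exact hg t
      _ = _ := by rw [mul_assoc, ← Real.exp_add]; ring_nf
  have hmC : ∀ t, |m t| ≤ C := fun t => (hmb t).trans (by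
    have : Real.exp (-(δ / 2 * |t|)) ≤ 1 := Real.exp_le_one_iff.2 (by
      have := abs_nonneg t
      have : 0 ≤ δ / 2 * |t| := by positivity
      linarith)
    nlinarith)
  have hmc : Continuous m := by fun_prop
  have hmt : Tendsto m (cocompact ℝ) (𝓝 0) := by
    refine squeeze_zero_norm hmb ?_
    have h1 : Tendsto (fun t : ℝ => |t|) (cocompact ℝ) atTop := tendsto_norm_cocompact_atTop
    have h2 := (Real.tendsto_exp_neg_atTop_nhds_zero.comp
      (h1.const_mul_atTop (show 0 < δ / 2 by linarith))).const_mul C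
    simpa using h2
  have hu := hmc.uniformContinuous_of_tendsto_cocompact hmt
  rw [Metric.uniformContinuous_iff] at hu
  obtain ⟨ρ₁, hρ₁, h₁⟩ := hu (η / 2) (by linarith)
  have hcont : Tendsto (fun u : ℝ => C * (Real.exp (δ / 2 * |u|) - 1)) (𝓝 0) (𝓝 0) := by
    have : Continuous (fun u : ℝ => C * (Real.exp (δ / 2 * |u|) - 1)) := by fun_prop
    simpa using this.tendsto 0
  obtain ⟨ρ₂, hρ₂, h₂⟩ := Metric.eventually_nhds_iff.1
    (hcont.eventually (gt_mem_nhds (show 0 < η / 2 by linarith)))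
  refine ⟨min ρ₁ ρ₂, lt_min hρ₁ hρ₂, fun u hu t => ?_⟩
  have hA := h₁ (a := t + u) (b := t) (by
    rw [Real.dist_eq, add_sub_cancel_left]; exact hu.trans_le (min_le_left _ _))
  have hB := h₂ (y := u) (by rw [Real.dist_eq, sub_zero]; exact hu.trans_le (min_le_right _ _))
  rw [Real.dist_eq] at hA
  have hexp : |Real.exp (δ / 2 * (|t| - |t + u|)) - 1| ≤ Real.exp (δ / 2 * |u|) - 1 := by
    have h3 : |(|t| - |t + u|)| ≤ |u| := by
      have := abs_abs_sub_abs_le t (t + u)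
      simpa using this
    obtain ⟨h4, h5⟩ := abs_le.1 h3
    have h6 : Real.exp (δ / 2 * (|t| - |t + u|)) ≤ Real.exp (δ / 2 * |u|) :=
      Real.exp_le_exp.2 (by nlinarith)
    have h7 : Real.exp (-(δ / 2 * |u|)) ≤ Real.exp (δ / 2 * (|t| - |t + u|)) :=
      Real.exp_le_exp.2 (by nlinarith)
    have h8 : 2 ≤ Real.exp (-(δ / 2 * |u|)) + Real.exp (δ / 2 * |u|) := by
      have := Real.one_le_cosh (δ / 2 * |u|)
      rw [Real.cosh_eq] at this
      linarith
    rw [abs_le]; constructor <;> linarith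
  have hid : g (t + u) - g t = Real.exp (-(δ / 2 * |t|)) *
      ((m (t + u) - m t) + m (t + u) * (Real.exp (δ / 2 * (|t| - |t + u|)) - 1)) := by
    have e1 : Real.exp (-(δ / 2 * |t|)) * Real.exp (δ / 2 * |t|) = 1 := by
      rw [← Real.exp_add]; simp
    have e2 : Real.exp (-(δ / 2 * |t|)) * (Real.exp (δ / 2 * |t + u|) *
        Real.exp (δ / 2 * (|t| - |t + u|))) = 1 := by
      rw [← Real.exp_add, ← Real.exp_add]; ring_nf; simp
    rw [hm]
    linear_combination -g (t + u) * e2 + g t * e1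
  rw [hid, abs_mul, Real.abs_exp, mul_comm]
  gcongr
  calc _ ≤ |m (t + u) - m t| + |m (t + u)| * |Real.exp (δ / 2 * (|t| - |t + u|)) - 1| := by
        rw [← abs_mul]; exact abs_add_le _ _
    _ ≤ η / 2 + C * (Real.exp (δ / 2 * |u|) - 1) := by
        gcongr
        exact hmC _
    _ ≤ η := by linarith

/-- Solutions of the renewal equation inherit uniform continuity. -/
lemma renewal_uniform (hp : ∀ a, 0 ≤ p a) (hsum : ∑ a, p a = 1) (hx₀ : 0 < x₀)
    (hx : ∀ a, x₀ ≤ x a) {δ : ℝ} (hδ : 0 < δ) {G g : ℝ → ℝ} {C : ℝ} (hgc : Continuous g)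
    (hg : ∀ t, |g t| ≤ C * Real.exp (-(δ * |t|)))
    (hG : ∀ t, G t = g t + stepAverage p x G t) (h0 : Tendsto G atBot (𝓝 0)) {η : ℝ} (hη : 0 < η) :
    ∃ ρ > 0, ∀ u, |u| < ρ → ∀ t, |G (t + u) - G t| ≤ η := by
  obtain ⟨K, hK, hb⟩ := exists_renewal_bound hp hsum hx₀ hx (show 0 < δ / 2 by linarith)
  obtain ⟨ρ, hρ, h⟩ := increment_bound hgc hδ hg (show 0 < η / K by positivity)
  refine ⟨ρ, hρ, fun u hu t => ?_⟩
  have := hb (fun t => G (t + u) - G t) (fun t => g (t + u) - g t) (η / K) (by positivity) (h u hu)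
    (fun t => by
      have e : ∀ a, t + u - x a = t - x a + u := fun a => by ring
      rw [stepAverage_sub, hG (t + u), hG t]
      simp only [stepAverage, e]
      ring) (by
        have h1 := (h0.comp (tendsto_atBot_add_const_right _ u tendsto_id)).sub h0
        simpa using h1) t
  rwa [mul_div_cancel₀ _ hK.ne'] at this

end Renewal
end RandomTrie

namespace RandomTrie
open Filter Topology MeasureTheory

section Renewal

variable {A : Type*} [Fintype A] {p x : A → ℝ} {x₀ : ℝ}

/-- One half of the Choquet–Deny argument. -/
lemma eventually_sub_shift_lt (hp : ∀ a, 0 < p a) (hsum : ∑ a, p a = 1) {D : ℝ → ℝ} {B : ℝ}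
    (hB : ∀ t, |D t| ≤ B) (hD : Tendsto (fun t => D t - stepAverage p x D t) atTop (𝓝 0))
    (a : A) {η : ℝ} (hη : 0 < η) : ∀ᶠ t in atTop, D t - D (t - x a) < η := by
  set h : ℝ → ℝ := fun t => D t - D (t - x a) with hh
  have hshift : ∀ y : ℝ, Tendsto (fun t : ℝ => t - y) atTop atTop := fun y =>
    tendsto_atTop_add_const_right _ (-y) tendsto_id
  have hhb : ∀ t, |h t| ≤ 2 * B := fun t => by
    have h1 := hB t
    have h2 := hB (t - x a)
    have := abs_sub (D t) (D (t - x a))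
    rw [hh]
    linarith
  have hbd : IsBoundedUnder (· ≤ ·) atTop h := isBoundedUnder_of ⟨2 * B, fun t => (abs_le.1 (hhb t)).2⟩
  have hcb : IsCoboundedUnder (· ≤ ·) atTop h :=
    (isBoundedUnder_of ⟨-(2 * B), fun t => (abs_le.1 (hhb t)).1⟩ :
      IsBoundedUnder (· ≥ ·) atTop h).isCoboundedUnder_flip
  set M := limsup h atTop with hM
  have hup : ∀ ε > 0, ∀ᶠ t in atTop, h t < M + ε := fun ε hε =>
    eventually_lt_of_limsup_lt (by rw [← hM]; linarith) hbd
  have hfr : ∀ ε > 0, ∃ᶠ t in atTop, M - ε < h t := fun ε hε =>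
    frequently_lt_of_lt_limsup hcb (by rw [← hM]; linarith)
  suffices hM0 : M ≤ 0 by
    filter_upwards [hup η hη] with t ht
    linarith
  have hheq : Tendsto (fun t => h t - stepAverage p x h t) atTop (𝓝 0) := by
    have := hD.sub (hD.comp (hshift (x a)))
    rw [sub_zero] at this
    refine this.congr fun t => ?_
    have e : ∀ b, t - x a - x b = t - x b - x a := fun b => by ring
    simp only [Function.comp, hh, stepAverage_sub]
    simp only [stepAverage, e]
    ring
  have hprop : ∀ n : ℕ, ∀ ε > 0, ∃ᶠ t in atTop, ∀ i ≤ n, M - ε < h (t - i * x a) := by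
    intro n
    induction n with
    | zero =>
      intro ε hε
      refine (hfr ε hε).mono fun t ht i hi => ?_
      obtain rfl := Nat.le_zero.1 hi
      simpa using ht
    | succ n ih =>
      intro ε hε
      set κ := min (ε / 2) (p a * ε / 4) with hκ
      have hpa := hp a
      have hκ0 : 0 < κ := lt_min (by linarith) (by positivity)
      have hall : ∀ᶠ t in atTop, ∀ b, h (t - x b) < M + κ := by
        rw [eventually_all]
        exact fun b => (hshift (x b)).eventually (hup κ hκ0)
      have hsm : ∀ᶠ t in atTop, h t - stepAverage p x h t < κ := hheq.eventually (gt_mem_nhds hκ0)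
      have hev := (hshift (n * x a)).eventually (hall.and hsm)
      refine ((ih κ hκ0).and_eventually hev).mono fun t ⟨h1, h2, h3⟩ i hi => ?_
      rcases Nat.lt_or_ge i (n + 1) with hi' | hi'
      · have := h1 i (by omega)
        have := min_le_left (ε / 2) (p a * ε / 4)
        linarith
      · obtain rfl : i = n + 1 := by omega
        set s := t - n * x a with hs
        have e : t - ((n + 1 : ℕ) : ℝ) * x a = s - x a := by rw [hs]; push_cast; ring
        rw [e]
        have h4 := h1 n le_rfl
        have h5 : stepAverage p x h s ≤ p a * h (s - x a) + (1 - p a) * (M + κ) := by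
          classical
          rw [stepAverage, ← Finset.add_sum_erase _ _ (Finset.mem_univ a)]
          gcongr
          calc _ ≤ ∑ b ∈ Finset.univ.erase a, p b * (M + κ) :=
                Finset.sum_le_sum fun b _ => mul_le_mul_of_nonneg_left (h2 b).le (hp b).le
            _ = _ := by
                rw [← Finset.sum_mul, ← hsum, ← Finset.add_sum_erase _ _ (Finset.mem_univ a)]
                ring
        have h6 : κ ≤ p a * ε / 4 := min_le_right _ _
        have h7 : p a * (M - ε) < p a * h (s - x a) := by nlinarith
        exact lt_of_mul_lt_mul_left h7 hpa.le
  by_contra hpos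
  push Not at hpos
  obtain ⟨n, hn⟩ := exists_nat_gt (2 * B / (M / 2))
  obtain ⟨t, ht⟩ := (hprop n (M / 2) (by linarith)).exists
  have htel : ∀ k : ℕ, k ≤ n → k * (M / 2) ≤ D t - D (t - k * x a) := by
    intro k
    induction k with
    | zero => simp
    | succ k ih =>
      intro hk
      have h1 := ih (by omega)
      have h2 := ht k (by omega)
      simp only [hh] at h2
      have e : t - ((k + 1 : ℕ) : ℝ) * x a = t - k * x a - x a := by push_cast; ring
      rw [e]
      push_cast
      linarith
  have h1 := htel n le_rfl
  rw [div_lt_iff₀ (by linarith)] at hn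
  have h2 := abs_le.1 (hB t)
  have h3 := abs_le.1 (hB (t - n * x a))
  linarith

/-- Asymptotic version of the Choquet–Deny theorem: a bounded function that is asymptotically
harmonic is asymptotically invariant under each step. -/
lemma tendsto_sub_shift (hp : ∀ a, 0 < p a) (hsum : ∑ a, p a = 1) {D : ℝ → ℝ} {B : ℝ}
    (hB : ∀ t, |D t| ≤ B) (hD : Tendsto (fun t => D t - stepAverage p x D t) atTop (𝓝 0))
    (a : A) : Tendsto (fun t => D t - D (t - x a)) atTop (𝓝 0) := by
  rw [tendsto_order]
  constructor
  · intro η hη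
    have h := eventually_sub_shift_lt (x := x) (D := fun t => -D t) hp hsum
      (fun t => by rw [abs_neg]; exact hB t) (by
        have := hD.neg
        rw [neg_zero] at this
        refine this.congr fun t => ?_
        simp only [stepAverage, mul_neg, Finset.sum_neg_distrib]
        ring) a (show 0 < -η by linarith)
    filter_upwards [h] with t ht
    linarith
  · intro η hη
    exact eventually_sub_shift_lt hp hsum hB hD a hη

lemma tendsto_sub_shift_closure (hp : ∀ a, 0 < p a) (hsum : ∑ a, p a = 1) {D : ℝ → ℝ} {B : ℝ}
    (hB : ∀ t, |D t| ≤ B) (hD : Tendsto (fun t => D t - stepAverage p x D t) atTop (𝓝 0))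
    {y : ℝ} (hy : y ∈ AddSubgroup.closure (Set.range x)) :
    Tendsto (fun t => D t - D (t - y)) atTop (𝓝 0) := by
  have hshift : ∀ y : ℝ, Tendsto (fun t : ℝ => t - y) atTop atTop := fun y =>
    tendsto_atTop_add_const_right _ (-y) tendsto_id
  induction hy using AddSubgroup.closure_induction with
  | mem y hy =>
    obtain ⟨a, rfl⟩ := hy
    exact tendsto_sub_shift hp hsum hB hD a
  | zero => simp
  | add y z _ _ h1 h2 =>
    have := h1.add (h2.comp (hshift y))
    rw [zero_add] at this
    refine this.congr fun t => ?_
    simp only [Function.comp]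
    rw [show t - (y + z) = t - y - z by ring]
    ring
  | neg y _ h =>
    have := (h.comp (hshift (-y))).neg
    rw [neg_zero] at this
    refine this.congr fun t => ?_
    simp only [Function.comp]
    rw [show t - -y - y = t by ring]
    ring

lemma summable_exp_lattice {δ d : ℝ} (hδ : 0 < δ) (hd : 0 < d) (t : ℝ) :
    Summable fun n : ℕ => Real.exp (-(δ * (t + n * d))) := by
  have h := (Real.summable_exp_nat_mul_iff.2 (show -(δ * d) < 0 by nlinarith)).mul_left
    (Real.exp (-(δ * t)))
  refine h.congr fun n => ?_
  rw [← Real.exp_add]; ring_nf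

lemma exp_abs_le {δ : ℝ} (hδ : 0 < δ) (t : ℝ) : Real.exp (-(δ * |t|)) ≤ Real.exp (-(δ * t)) :=
  Real.exp_le_exp.2 (by have := le_abs_self t; nlinarith)

lemma exp_abs_le' {δ : ℝ} (hδ : 0 < δ) (t : ℝ) : Real.exp (-(δ * |t|)) ≤ Real.exp (δ * t) :=
  Real.exp_le_exp.2 (by have := neg_abs_le t; nlinarith)

/-- The renewal theorem in the arithmetic case. -/
theorem renewal_arithmetic (hp : ∀ a, 0 < p a) (hsum : ∑ a, p a = 1) (hx₀ : 0 < x₀)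
    (hx : ∀ a, x₀ ≤ x a) {δ : ℝ} (hδ : 0 < δ) {G g ψ : ℝ → ℝ} {C : ℝ}
    (hg : ∀ t, |g t| ≤ C * Real.exp (-(δ * |t|)))
    (hG : ∀ t, G t = g t + stepAverage p x G t) (h0 : Tendsto G atBot (𝓝 0))
    {d : ℝ} (hd : 0 < d) (k : A → ℕ) (hk : ∀ a, x a = k a * d)
    (hcl : d ∈ AddSubgroup.closure (Set.range x))
    {Bψ : ℝ} (hψb : ∀ t, |ψ t| ≤ Bψ) (hψp : Function.Periodic ψ d)
    (hψ : ∀ t, HasSum (fun k : ℤ => d * g (t - k * d)) (ψ t)) :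
    Tendsto (fun t => G t - ψ t / ∑ a, p a * x a) atTop (𝓝 0) := by
  have hC : 0 ≤ C := by
    have := (abs_nonneg _).trans (hg 0)
    simpa using this
  have hne : Nonempty A := by
    by_contra h
    rw [not_nonempty_iff] at h
    simp at hsum
  set H := ∑ a, p a * x a with hH
  have hHpos : 0 < H := Finset.sum_pos (fun a _ => mul_pos (hp a) (hx₀.trans_le (hx a)))
    Finset.univ_nonempty
  obtain ⟨K, -, hKb⟩ := exists_renewal_bound (fun a => (hp a).le) hsum hx₀ hx hδ
  have hGb := hKb G g C hC hg hG h0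
  have hg0 : Tendsto g atTop (𝓝 0) := by
    refine squeeze_zero_norm (fun t => (hg t).trans
      (mul_le_mul_of_nonneg_left (exp_abs_le hδ t) hC)) ?_
    have := (Real.tendsto_exp_neg_atTop_nhds_zero.comp
      (tendsto_id.const_mul_atTop hδ)).const_mul C
    simpa using this
  set D : ℝ → ℝ := fun t => G t - ψ t / H with hDdef
  have hψn : ∀ (n : ℕ) t, ψ (t - n * d) = ψ t := fun n t => by
    simpa using hψp.sub_nsmul_eq n (x := t)
  have hDb : ∀ t, |D t| ≤ K * C + Bψ / H := fun t => by
    have h1 := abs_sub (G t) (ψ t / H)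
    have h2 : |ψ t / H| ≤ Bψ / H := by
      rw [abs_div, abs_of_pos hHpos]
      gcongr
      exact hψb t
    linarith [hGb t]
  have hDeq : ∀ t, D t - stepAverage p x D t = g t := fun t => by
    rw [hDdef, stepAverage_sub]
    have : stepAverage p x (fun s => ψ s / H) t = ψ t / H := by
      simp only [stepAverage, hk, hψn]
      rw [← Finset.sum_mul, hsum, one_mul]
    rw [this]
    have := hG t
    simp only
    linarith
  have hshift := tendsto_sub_shift_closure hp hsum hDb (hg0.congr fun t => (hDeq t).symm) hcl
  have hshiftn : ∀ n : ℕ, Tendsto (fun t => D (t - n * d) - D t) atTop (𝓝 0) := by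
    intro n
    have hmem : (n : ℝ) * d ∈ AddSubgroup.closure (Set.range x) := by
      rw [← nsmul_eq_mul]; exact AddSubgroup.nsmul_mem _ hcl n
    have := (tendsto_sub_shift_closure hp hsum hDb (hg0.congr fun t => (hDeq t).symm) hmem).neg
    rw [neg_zero] at this
    exact this.congr fun t => by ring
  -- the lattice potential of a function
  set P : (ℝ → ℝ) → ℝ → ℝ := fun F t => ∑ a, p a * ∑ j ∈ Finset.range (k a), F (t - j * d) with hP
  have hPD : Tendsto (fun t => P D t - H / d * D t) atTop (𝓝 0) := by
    have h1 : Tendsto (fun t => ∑ a, p a * ∑ j ∈ Finset.range (k a), (D (t - j * d) - D t))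
        atTop (𝓝 (∑ a, p a * ∑ j ∈ Finset.range (k a), 0)) :=
      tendsto_finsetSum _ fun a _ => (tendsto_finsetSum _ fun j _ => hshiftn j).const_mul _
    simp only [Finset.sum_const_zero, mul_zero] at h1
    refine h1.congr fun t => ?_
    simp only [hP, Finset.sum_sub_distrib, mul_sub, Finset.sum_const, Finset.card_range,
      nsmul_eq_mul]
    congr 1
    rw [hH, Finset.sum_div, Finset.sum_mul]
    refine Finset.sum_congr rfl fun a _ => ?_
    rw [hk]
    field_simp
  have hPG : ∀ t, P G t - P G (t - d) = g t := by
    intro t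
    have h1 : ∀ a, ∑ j ∈ Finset.range (k a), G (t - j * d) -
        ∑ j ∈ Finset.range (k a), G (t - d - j * d) = G t - G (t - x a) := by
      intro a
      rw [← Finset.sum_sub_distrib, hk]
      have := Finset.sum_range_sub' (fun j : ℕ => G (t - j * d)) (k a)
      simp only [Nat.cast_zero, zero_mul, sub_zero] at this
      rw [← this]
      refine Finset.sum_congr rfl fun j _ => ?_
      congr 2
      push_cast
      ring
    simp only [hP]
    rw [← Finset.sum_sub_distrib]
    simp only [← mul_sub, h1]
    simp only [mul_sub, Finset.sum_sub_distrib]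
    rw [← Finset.sum_mul, hsum, one_mul]
    have := hG t
    rw [stepAverage] at this
    linarith
  have hsub : ∀ y : ℝ, Tendsto (fun t : ℝ => t - y) atBot atBot := fun y =>
    tendsto_atBot_add_const_right _ (-y) tendsto_id
  have hPG0 : Tendsto (P G) atBot (𝓝 0) := by
    have h1 : Tendsto (P G) atBot (𝓝 (∑ a, p a * ∑ j ∈ Finset.range (k a), 0)) :=
      tendsto_finsetSum _ fun a _ => (tendsto_finsetSum _ fun j _ => h0.comp (hsub _)).const_mul _
    simpa using h1
  have hsumg : ∀ t, HasSum (fun n : ℕ => g (t - n * d)) (P G t) := by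
    intro t
    have hs : Summable (fun n : ℕ => g (t - n * d)) := by
      refine Summable.of_norm_bounded ((summable_exp_lattice hδ hd (-t)).mul_left C) fun n => ?_
      refine (hg _).trans (mul_le_mul_of_nonneg_left ((exp_abs_le' hδ _).trans_eq ?_) hC)
      congr 1; ring
    have hpart : ∀ n : ℕ, ∑ j ∈ Finset.range n, g (t - j * d) = P G t - P G (t - n * d) := by
      intro n
      induction n with
      | zero => simp
      | succ n ih =>
        rw [Finset.sum_range_succ, ih, ← hPG (t - n * d)]
        rw [show t - ((n + 1 : ℕ) : ℝ) * d = t - n * d - d by push_cast; ring]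
        ring
    have hlim : Tendsto (fun n : ℕ => ∑ j ∈ Finset.range n, g (t - j * d)) atTop (𝓝 (P G t)) := by
      simp only [hpart]
      have h1 : Tendsto (fun n : ℕ => t - n * d) atTop atBot :=
        tendsto_atBot_add_const_left _ t
          (tendsto_neg_atTop_atBot.comp (tendsto_natCast_atTop_atTop.atTop_mul_const hd))
      simpa using tendsto_const_nhds.sub (hPG0.comp h1)
    rw [← tendsto_nhds_unique hs.hasSum.tendsto_sum_nat hlim]
    exact hs.hasSum
  have hPDval : ∀ t, 0 ≤ t → |P D t| ≤ C * Real.exp (-(δ * t)) * ∑' n : ℕ, Real.exp (-(δ * (d + n * d))) := by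
    intro t ht
    have e1 : P D t = P G t - ψ t / d := by
      have : P D t = P G t - ∑ a, p a * ∑ j ∈ Finset.range (k a), ψ t / H := by
        simp only [hP, hDdef, Finset.sum_sub_distrib, mul_sub, hψn]
      rw [this]
      congr 1
      simp only [Finset.sum_const, Finset.card_range, nsmul_eq_mul, ← mul_assoc]
      rw [← Finset.sum_mul]
      have : ∑ a, p a * k a = H / d := by
        rw [hH, Finset.sum_div]
        refine Finset.sum_congr rfl fun a _ => ?_
        rw [hk]; field_simp
      rw [this]; field_simp
    have hs2 : Summable (fun n : ℕ => g (t + (d + n * d))) := by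
      refine Summable.of_norm_bounded ((summable_exp_lattice hδ hd (t + d)).mul_left C) fun n => ?_
      refine (hg _).trans (mul_le_mul_of_nonneg_left ((exp_abs_le hδ _).trans_eq ?_) hC)
      congr 1; ring
    have e2 : HasSum (fun k : ℤ => g (t - k * d)) (P G t + ∑' n : ℕ, g (t + (d + n * d))) := by
      refine HasSum.of_nat_of_neg_add_one (by simpa using hsumg t) ?_
      convert hs2.hasSum using 3 with n
      push_cast; ring
    have e3 : ψ t / d = P G t + ∑' n : ℕ, g (t + (d + n * d)) := by
      have := (hψ t).unique (e2.mul_left d)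
      rw [this]; field_simp
    rw [e1, e3, sub_add_cancel_left, abs_neg, ← tsum_mul_left]
    refine tsum_of_norm_bounded (f := fun n : ℕ => g (t + (d + n * d)))
      ((summable_exp_lattice hδ hd d).mul_left _).hasSum fun n => ?_
    refine (hg _).trans ?_
    rw [mul_assoc, ← Real.exp_add]
    refine mul_le_mul_of_nonneg_left ((exp_abs_le hδ _).trans_eq ?_) hC
    congr 1; ring
  have hPD0 : Tendsto (P D) atTop (𝓝 0) := by
    refine squeeze_zero_norm' ((eventually_ge_atTop 0).mono hPDval) ?_
    have := ((Real.tendsto_exp_neg_atTop_nhds_zero.comp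
      (tendsto_id.const_mul_atTop hδ)).const_mul C).mul_const
      (∑' n : ℕ, Real.exp (-(δ * (d + n * d))))
    simpa using this
  have := (hPD0.sub hPD).const_mul (d / H)
  simp only [sub_zero, mul_zero] at this
  refine this.congr fun t => ?_
  rw [sub_sub_cancel]
  field_simp

/-- The renewal theorem in the non-arithmetic case. -/
theorem renewal_nonarithmetic (hp : ∀ a, 0 < p a) (hsum : ∑ a, p a = 1) (hx₀ : 0 < x₀)
    (hx : ∀ a, x₀ ≤ x a) {δ : ℝ} (hδ : 0 < δ) {G g : ℝ → ℝ} {C : ℝ} (hgc : Continuous g)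
    (hg : ∀ t, |g t| ≤ C * Real.exp (-(δ * |t|))) (hgi : Integrable g)
    (hG : ∀ t, G t = g t + stepAverage p x G t) (h0 : Tendsto G atBot (𝓝 0))
    (hcl : Dense (AddSubgroup.closure (Set.range x) : Set ℝ)) :
    Tendsto (fun t => G t - (∫ s, g s) / ∑ a, p a * x a) atTop (𝓝 0) := by
  have hC : 0 ≤ C := by
    have := (abs_nonneg _).trans (hg 0)
    simpa using this
  have hne : Nonempty A := by
    by_contra h
    rw [not_nonempty_iff] at h
    simp at hsum
  set H := ∑ a, p a * x a with hH
  have hHpos : 0 < H := Finset.sum_pos (fun a _ => mul_pos (hp a) (hx₀.trans_le (hx a)))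
    Finset.univ_nonempty
  obtain ⟨K, -, hKb⟩ := exists_renewal_bound (fun a => (hp a).le) hsum hx₀ hx hδ
  have hGb := hKb G g C hC hg hG h0
  have hg0 : Tendsto g atTop (𝓝 0) := by
    refine squeeze_zero_norm (fun t => (hg t).trans
      (mul_le_mul_of_nonneg_left (exp_abs_le hδ t) hC)) ?_
    have := (Real.tendsto_exp_neg_atTop_nhds_zero.comp
      (tendsto_id.const_mul_atTop hδ)).const_mul C
    simpa using this
  have hunif := fun {η : ℝ} (hη : 0 < η) =>
    renewal_uniform (fun a => (hp a).le) hsum hx₀ hx hδ hgc hg hG h0 hη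
  have hGc : Continuous G := by
    rw [Metric.continuous_iff]
    intro t ε hε
    obtain ⟨ρ, hρ, h⟩ := hunif (half_pos hε)
    refine ⟨ρ, hρ, fun s hs => ?_⟩
    have := h (s - t) hs t
    rw [add_sub_cancel] at this
    rw [Real.dist_eq]
    linarith
  have hGeq : Tendsto (fun t => G t - stepAverage p x G t) atTop (𝓝 0) :=
    hg0.congr fun t => by rw [hG t]; ring_nf
  -- uniform asymptotic invariance on compact sets of shifts
  have hinv : ∀ η > 0, ∀ L : ℝ, ∀ᶠ t in atTop, ∀ u ∈ Set.Icc 0 L, |G t - G (t - u)| ≤ η := by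
    intro η hη L
    refine (isCompact_Icc (a := (0:ℝ)) (b := L)).induction_on
      (p := fun S => ∀ᶠ t in atTop, ∀ u ∈ S, |G t - G (t - u)| ≤ η) (by simp)
      (fun s t hst h => h.mono fun _ h' u hu => h' u (hst hu))
      (fun s t h1 h2 => by
        filter_upwards [h1, h2] with r h1 h2 u hu
        exact hu.elim (h1 u) (h2 u)) ?_
    intro u _
    obtain ⟨ρ, hρ, hρ'⟩ := hunif (half_pos hη)
    obtain ⟨y, hyc, hy⟩ := hcl.exists_dist_lt u (half_pos hρ)
    have h1 := tendsto_sub_shift_closure hp hsum hGb hGeq hyc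
    refine ⟨Metric.ball u (ρ / 2), mem_nhdsWithin_of_mem_nhds (Metric.ball_mem_nhds _ (half_pos hρ)),
      ?_⟩
    have h2 := h1.abs
    rw [abs_zero] at h2
    filter_upwards [h2.eventually (gt_mem_nhds (half_pos hη))] with t ht v hv
    have hvy : |y - v| < ρ := by
      rw [Real.dist_eq] at hy
      rw [Metric.mem_ball, Real.dist_eq] at hv
      have := abs_sub_le y u v
      rw [abs_sub_comm y u, abs_sub_comm u v] at this
      linarith
    have h3 := hρ' (y - v) hvy (t - y)
    rw [show t - y + (y - v) = t - v by ring] at h3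
    have := abs_sub_le (G t) (G (t - y)) (G (t - v))
    rw [abs_sub_comm (G (t - y))] at this
    linarith
  set P : ℝ → ℝ := fun t => ∑ a, p a * ∫ s in (t - x a)..t, G s with hP
  have hPder : ∀ t, HasDerivAt P (g t) t := by
    intro t
    have h1 : ∀ a, HasDerivAt (fun t => ∫ s in (t - x a)..t, G s) (G t - G (t - x a)) t := by
      intro a
      have e : (fun t => ∫ s in (t - x a)..t, G s) =
          fun t => (∫ s in (0:ℝ)..t, G s) - ∫ s in (0:ℝ)..(t - x a), G s := by
        ext t
        rw [intervalIntegral.integral_interval_sub_left] <;> exact hGc.intervalIntegrable _ _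
      rw [e]
      refine HasDerivAt.sub (hGc.integral_hasStrictDerivAt 0 t).hasDerivAt ?_
      have := (hGc.integral_hasStrictDerivAt 0 (t - x a)).hasDerivAt
      exact this.comp_sub_const t (x a)
    have h2 := HasDerivAt.fun_sum (u := Finset.univ) fun a _ => (h1 a).const_mul (p a)
    refine h2.congr_deriv ?_
    simp only [mul_sub, Finset.sum_sub_distrib]
    rw [← Finset.sum_mul, hsum, one_mul]
    have := hG t
    rw [stepAverage] at this
    linarith
  have hPsub : ∀ t, P t = ∑ a, p a * ∫ u in (0:ℝ)..(x a), G (t - u) := by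
    intro t
    refine Finset.sum_congr rfl fun a _ => ?_
    rw [intervalIntegral.integral_comp_sub_left (fun s => G s) t]
    simp
  have hbound : ∀ t η v, (∀ u ∈ Set.Icc 0 (∑ a, x a), |G (t - u) - v| ≤ η) →
      |P t - H * v| ≤ H * η := by
    intro t η v h
    have hx0 : ∀ a, 0 ≤ x a := fun a => hx₀.le.trans (hx a)
    have e : P t - H * v = ∑ a, p a * ∫ u in (0:ℝ)..(x a), (G (t - u) - v) := by
      rw [hPsub, hH, Finset.sum_mul, ← Finset.sum_sub_distrib]
      refine Finset.sum_congr rfl fun a _ => ?_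
      have hi : IntervalIntegrable (fun u => G (t - u)) volume 0 (x a) :=
        (show Continuous fun u => G (t - u) by fun_prop).intervalIntegrable _ _
      rw [intervalIntegral.integral_sub hi intervalIntegrable_const,
        intervalIntegral.integral_const, sub_zero, smul_eq_mul]
      ring
    rw [e, hH, Finset.sum_mul]
    refine (Finset.abs_sum_le_sum_abs _ _).trans (Finset.sum_le_sum fun a _ => ?_)
    rw [abs_mul, abs_of_pos (hp a), mul_assoc]
    refine mul_le_mul_of_nonneg_left ?_ (hp a).le
    have := intervalIntegral.norm_integral_le_of_norm_le_const (a := 0) (b := x a) (C := η)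
      (f := fun u => G (t - u) - v) (fun u hu => by
        rw [Set.uIoc_of_le (hx0 a)] at hu
        exact h u ⟨hu.1.le, hu.2.trans
          (Finset.single_le_sum (f := x) (fun b _ => hx0 b) (Finset.mem_univ a))⟩)
    rw [sub_zero, abs_of_nonneg (hx0 a), mul_comm] at this
    exact this
  have hPbot : Tendsto P atBot (𝓝 0) := by
    rw [Metric.tendsto_nhds]
    intro η hη
    obtain ⟨t₀, ht₀⟩ := ((Metric.tendsto_nhds.1 h0) (η / (2 * H))
      (by positivity)).exists_forall_of_atBot
    filter_upwards [eventually_le_atBot t₀] with t ht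
    have := hbound t (η / (2 * H)) 0 fun u hu => by
      have := ht₀ (t - u) (by linarith [hu.1])
      rw [Real.dist_eq] at this
      exact this.le
    rw [Real.dist_eq]
    rw [mul_zero] at this
    refine this.trans_lt ?_
    rw [show H * (η / (2 * H)) = η / 2 by field_simp]
    linarith
  have hPint : ∀ t, P t = ∫ s in Set.Iic t, g s := by
    intro t
    rw [integral_Iic_of_hasDerivAt_of_tendsto' (fun s _ => hPder s) hgi.integrableOn hPbot, sub_zero]
  have hPtop : Tendsto P atTop (𝓝 (∫ s, g s)) := by
    have h := (aecover_Iic (μ := volume) (tendsto_id (x := (atTop : Filter ℝ)))).integral_tendsto_of_countably_generated hgi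
    exact h.congr fun t => (hPint t).symm
  have hPG : Tendsto (fun t => P t - H * G t) atTop (𝓝 0) := by
    rw [Metric.tendsto_nhds]
    intro η hη
    filter_upwards [hinv (η / (2 * H)) (by positivity) (∑ a, x a)] with t ht
    have := hbound t (η / (2 * H)) (G t) fun u hu => by rw [abs_sub_comm]; exact ht u hu
    rw [Real.dist_eq, sub_zero]
    refine this.trans_lt ?_
    rw [show H * (η / (2 * H)) = η / 2 by field_simp]
    linarith
  have := (((hPtop.sub_const (∫ s, g s)).sub hPG).const_mul (1 / H))
  simp only [sub_self, mul_zero] at this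
  refine this.congr fun t => ?_
  field_simp
  ring

end Renewal
end RandomTrie

namespace RandomTrie
open Filter Topology MeasureTheory Asymptotics

/-! ### The functions `ψ` -/

/-- The function `t ↦ e^{-t} f(e^t)`. -/
noncomputable def logForm (f : ℝ → ℝ) (t : ℝ) : ℝ := Real.exp (-t) * f (Real.exp t)

lemma eq_mul_logForm (f : ℝ → ℝ) {x : ℝ} (hx : 0 < x) : f x = x * logForm f (Real.log x) := by
  rw [logForm, Real.exp_neg, Real.exp_log hx]
  field_simp

lemma continuous_logForm {f : ℝ → ℝ} (hf : ContinuousOn f (Set.Ioi 0)) :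
    Continuous (logForm f) := by
  unfold logForm
  exact (by fun_prop : Continuous fun t : ℝ => Real.exp (-t)).mul
    (hf.comp_continuous Real.continuous_exp fun t => Real.exp_pos t)

/-- Polynomial bounds at `0` and `∞` give exponential decay in the logarithmic variable. -/
lemma exists_exp_decay {h : ℝ → ℝ} (hc : ContinuousOn h (Set.Ioi 0)) {b ε : ℝ}
    (h0 : ∃ C, ∀ x, 0 < x → x ≤ 1 → |h x| ≤ C * x ^ (b + 1))
    (htop : h =O[atTop] fun x : ℝ => x ^ (b - ε)) :
    ∃ C, ∀ t, |Real.exp (-(b * t)) * h (Real.exp t)| ≤ C * Real.exp (-(min ε 1 * |t|)) := by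
  obtain ⟨C₀, hC₀⟩ := h0
  obtain ⟨C₁, hC₁⟩ := htop.bound
  obtain ⟨X, hX⟩ := hC₁.exists_forall_of_atTop
  set T := max 1 X with hT
  have hT1 : 1 ≤ T := le_max_left _ _
  obtain ⟨C₂, hC₂⟩ := (isCompact_Icc (a := (1:ℝ)) (b := T)).exists_bound_of_continuousOn
    (f := fun x => x ^ (-(b - ε)) * h x)
    ((continuousOn_id.rpow_const fun x hx => Or.inl (by
      have := hx.1; simp only [id]; linarith)).mul
      (hc.mono fun x hx => lt_of_lt_of_le one_pos hx.1))
  have hC₀0 : 0 ≤ C₀ := by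
    have := hC₀ 1 one_pos le_rfl
    rw [Real.one_rpow, mul_one] at this
    exact (abs_nonneg _).trans this
  have hbig : ∀ x, 1 ≤ x → |h x| ≤ max C₁ C₂ * x ^ (b - ε) := by
    intro x hx
    have hx0 : 0 < x := by linarith
    rcases le_or_gt x T with h1 | h1
    · have := hC₂ x ⟨hx, h1⟩
      rw [norm_mul, Real.norm_of_nonneg (by positivity), Real.rpow_neg hx0.le,
        inv_mul_le_iff₀ (by positivity)] at this
      refine this.trans ?_
      rw [mul_comm]
      gcongr
      exact le_max_right _ _
    · have := hX x ((le_max_right _ _).trans h1.le)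
      rw [Real.norm_eq_abs, Real.norm_of_nonneg (by positivity)] at this
      refine this.trans ?_
      gcongr
      exact le_max_left _ _
  have hm : 0 ≤ max C₁ C₂ := by
    have := (abs_nonneg _).trans (hbig 1 le_rfl)
    rwa [Real.one_rpow, mul_one] at this
  refine ⟨max C₀ (max C₁ C₂), fun t => ?_⟩
  rw [abs_mul, Real.abs_exp]
  rcases le_or_gt t 0 with ht | ht
  · have h1 := hC₀ (Real.exp t) (Real.exp_pos t) (Real.exp_le_one_iff.2 ht)
    calc Real.exp (-(b * t)) * |h (Real.exp t)|
        ≤ Real.exp (-(b * t)) * (C₀ * (Real.exp t) ^ (b + 1)) := by gcongr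
      _ = C₀ * Real.exp t := by
        rw [← Real.exp_mul, mul_left_comm, ← Real.exp_add]; ring_nf
      _ ≤ _ := by
        gcongr
        · exact le_max_left _ _
        · rw [abs_of_nonpos ht]
          nlinarith [min_le_right ε 1]
  · have h1 := hbig (Real.exp t) (Real.one_le_exp ht.le)
    calc Real.exp (-(b * t)) * |h (Real.exp t)|
        ≤ Real.exp (-(b * t)) * (max C₁ C₂ * (Real.exp t) ^ (b - ε)) := by gcongr
      _ = max C₁ C₂ * Real.exp (-(ε * t)) := by
        rw [← Real.exp_mul, mul_left_comm, ← Real.exp_add]; ring_nf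
      _ ≤ _ := by
        rw [abs_of_pos ht]
        have h2 : Real.exp (-(ε * t)) ≤ Real.exp (-(min ε 1 * t)) :=
          Real.exp_le_exp.2 (by nlinarith [min_le_left ε 1])
        exact mul_le_mul (le_max_right _ _) h2 (by positivity) (hm.trans (le_max_right _ _))

section Psi

variable {f : ℝ → ℝ} {C δ : ℝ}

lemma integrable_exp_neg_mul_abs (hδ : 0 < δ) : Integrable fun t : ℝ => Real.exp (-(δ * |t|)) := by
  have h1 : IntegrableOn (fun t : ℝ => Real.exp (-(δ * |t|))) (Set.Ioi 0) := by
    refine (exp_neg_integrableOn_Ioi 0 hδ).congr_fun (fun t ht => ?_) measurableSet_Ioi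
    rw [abs_of_pos ht]; simp
  rw [← integrableOn_univ, ← Set.Iic_union_Ioi (a := (0:ℝ))]
  refine IntegrableOn.union ?_ h1
  rw [integrableOn_Iic_iff_integrableOn_Iio]
  have := h1.comp_neg
  simpa using this

lemma integrable_of_exp_decay {g : ℝ → ℝ} (hδ : 0 < δ) (hc : Continuous g)
    (hg : ∀ t, |g t| ≤ C * Real.exp (-(δ * |t|))) : Integrable g :=
  ((integrable_exp_neg_mul_abs hδ).const_mul C).mono' hc.aestronglyMeasurable
    (Eventually.of_forall hg)

lemma summable_exp_int {d : ℝ} (hδ : 0 < δ) (hd : 0 < d) :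
    Summable fun k : ℤ => Real.exp (-(δ * (|(k:ℝ)| * d))) := by
  refine Summable.of_nat_of_neg ?_ ?_
  · refine (summable_exp_lattice hδ hd 0).congr fun n => ?_
    simp
  · refine (summable_exp_lattice hδ hd 0).congr fun n => ?_
    simp

lemma lattice_bound {g : ℝ → ℝ} {d : ℝ} (hδ : 0 < δ) (hd : 0 < d)
    (hg : ∀ t, |g t| ≤ C * Real.exp (-(δ * |t|))) {M t : ℝ} (ht : |t| ≤ M) (k : ℤ) :
    |g (t - k * d)| ≤ C * Real.exp (δ * M) * Real.exp (-(δ * (|(k:ℝ)| * d))) := by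
  have hC : 0 ≤ C := by
    have := (abs_nonneg _).trans (hg 0)
    simpa using this
  refine (hg _).trans ?_
  rw [mul_assoc, ← Real.exp_add]
  gcongr
  have h1 : |(k:ℝ) * d| ≤ |t - k * d| + |t| := by
    have := abs_sub t (t - k * d)
    rw [sub_sub_cancel] at this
    linarith
  rw [abs_mul, abs_of_pos hd] at h1
  nlinarith

/-- The sum `d ∑_k g(t - k d)`. -/
noncomputable def latticeSum (d : ℝ) (g : ℝ → ℝ) (t : ℝ) : ℝ := ∑' k : ℤ, d * g (t - k * d)

lemma summable_lattice {g : ℝ → ℝ} {d : ℝ} (hδ : 0 < δ) (hd : 0 < d)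
    (hg : ∀ t, |g t| ≤ C * Real.exp (-(δ * |t|))) (t : ℝ) :
    Summable fun k : ℤ => d * g (t - k * d) :=
  (Summable.of_norm_bounded ((summable_exp_int hδ hd).mul_left _)
    (lattice_bound hδ hd hg le_rfl)).mul_left d

lemma continuous_latticeSum {g : ℝ → ℝ} {d : ℝ} (hδ : 0 < δ) (hd : 0 < d) (hc : Continuous g)
    (hg : ∀ t, |g t| ≤ C * Real.exp (-(δ * |t|))) : Continuous (latticeSum d g) := by
  rw [continuous_iff_continuousAt]
  intro t
  have h1 : ContinuousOn (latticeSum d g) (Set.Ioo (-(|t| + 1)) (|t| + 1)) := by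
    unfold latticeSum
    refine continuousOn_tsum
      (u := fun k : ℤ => d * (C * Real.exp (δ * (|t| + 1)) * Real.exp (-(δ * (|(k:ℝ)| * d)))))
      (fun k => by fun_prop) (((summable_exp_int hδ hd).mul_left _).mul_left d) ?_
    intro k s hs
    rw [norm_mul, Real.norm_of_nonneg hd.le]
    refine mul_le_mul_of_nonneg_left ?_ hd.le
    exact lattice_bound hδ hd hg (abs_le.2 ⟨hs.1.le, hs.2.le⟩) k
  refine h1.continuousAt (Ioo_mem_nhds ?_ ?_)
  · linarith [neg_abs_le t]
  · linarith [le_abs_self t]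

lemma periodic_latticeSum (g : ℝ → ℝ) (d : ℝ) : Function.Periodic (latticeSum d g) d := by
  intro t
  unfold latticeSum
  rw [← (Equiv.addRight (1:ℤ)).tsum_eq]
  refine tsum_congr fun k => ?_
  simp only [Equiv.coe_addRight]
  congr 2
  push_cast
  ring

lemma bounded_latticeSum {g : ℝ → ℝ} {d : ℝ} (hδ : 0 < δ) (hd : 0 < d) (hc : Continuous g)
    (hg : ∀ t, |g t| ≤ C * Real.exp (-(δ * |t|))) : ∃ B, ∀ t, |latticeSum d g t| ≤ B := by
  obtain ⟨B, hB⟩ := (isCompact_Icc (a := (0:ℝ)) (b := d)).exists_bound_of_continuousOn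
    (continuous_latticeSum hδ hd hc hg).continuousOn
  refine ⟨B, fun t => ?_⟩
  obtain ⟨s, hs, e⟩ := (periodic_latticeSum g d).exists_mem_Ico₀ hd t
  rw [e]
  exact hB s ⟨hs.1, hs.2.le⟩

lemma fourierCoeffOn_latticeSum {g : ℝ → ℝ} {d : ℝ} (hδ : 0 < δ) (hd : 0 < d) (hc : Continuous g)
    (hg : ∀ t, |g t| ≤ C * Real.exp (-(δ * |t|))) (m : ℤ) :
    fourierCoeffOn hd (fun t => (latticeSum d g t : ℂ)) m =
      ∫ t : ℝ, Complex.exp (-(2 * Real.pi * m / d : ℝ) * t * Complex.I) * g t := by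
  have hC : 0 ≤ C := by
    have := (abs_nonneg _).trans (hg 0)
    simpa using this
  set E : ℝ → ℂ := fun t => Complex.exp (-(2 * Real.pi * m / d : ℝ) * t * Complex.I) with hE
  have hEn : ∀ t, ‖E t‖ = 1 := fun t => by
    rw [hE]
    simp only
    rw [show (-(2 * Real.pi * m / d : ℝ) * t * Complex.I : ℂ) =
      ((-(2 * Real.pi * m / d) * t : ℝ) : ℂ) * Complex.I by push_cast; ring]
    exact Complex.norm_exp_ofReal_mul_I _
  have hEc : Continuous E := by fun_prop
  have hEper : ∀ t (k : ℤ), E (t - k * d) = E t := fun t k => by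
    have hd' : (d : ℂ) ≠ 0 := by exact_mod_cast hd.ne'
    rw [hE]
    simp only
    rw [show (-((2 * Real.pi * m / d : ℝ) : ℂ) * ((t - k * d : ℝ) : ℂ) * Complex.I) =
      -((2 * Real.pi * m / d : ℝ) : ℂ) * t * Complex.I + ((m * k : ℤ) : ℂ) * (2 * Real.pi * Complex.I) by
        push_cast; field_simp; ring]
    exact (Complex.exp_periodic.int_mul (m * k)) _
  have hEg : Integrable fun t => E t * g t := by
    have h1 := (integrable_of_exp_decay hδ hc hg).ofReal (𝕜 := ℂ)
    refine h1.bdd_mul hEc.aestronglyMeasurable (c := 1) (Eventually.of_forall fun t => (hEn t).le)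
  have hEg' : Integrable fun s => E (d * s) * g (d * s) := by
    exact hEg.comp_mul_left' hd.ne'
  have hsum := hEg'.hasSum_intervalIntegral_comp_add_int
  have hval : ∫ s, E (d * s) * g (d * s) = (d:ℂ)⁻¹ * ∫ t, E t * g t := by
    rw [Measure.integral_comp_mul_left (fun t => E t * g t) d, abs_of_pos (inv_pos.2 hd),
      Complex.real_smul]
    push_cast; rfl
  rw [fourierCoeffOn_eq_integral]
  have hterm : ∀ n : ℤ, ∫ s in (0:ℝ)..1, E (d * (s + n)) * g (d * (s + n)) =
      (d:ℂ)⁻¹ * ∫ t in (0:ℝ)..d, E t * g (t - (-n : ℤ) * d) := by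
    intro n
    have := intervalIntegral.integral_comp_mul_left (a := 0) (b := 1)
      (fun t => E t * g (t - (-n : ℤ) * d)) hd.ne'
    rw [mul_zero, mul_one, Complex.real_smul] at this
    push_cast at this ⊢
    rw [← this]
    refine intervalIntegral.integral_congr fun s _ => ?_
    rw [show d * (s + n) = d * s - (-n : ℤ) * d by push_cast; ring, hEper]
    push_cast; rfl
  have hdom : HasSum (fun n : ℤ => ∫ t in (0:ℝ)..d, E t * (d * g (t - n * d) : ℝ))
      (∫ t in (0:ℝ)..d, E t * latticeSum d g t) := by
    refine intervalIntegral.hasSum_integral_of_dominated_convergence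
      (fun n _ => d * (C * Real.exp (δ * d) * Real.exp (-(δ * (|(n:ℝ)| * d)))))
      (fun n => Continuous.aestronglyMeasurable (by fun_prop)) ?_ ?_ ?_ ?_
    · refine fun n => Eventually.of_forall fun t ht => ?_
      rw [Set.uIoc_of_le hd.le] at ht
      rw [norm_mul, hEn, one_mul, Complex.norm_real, norm_mul, Real.norm_of_nonneg hd.le]
      refine mul_le_mul_of_nonneg_left ?_ hd.le
      exact lattice_bound hδ hd hg (by rw [abs_of_pos ht.1]; exact ht.2) n
    · exact Eventually.of_forall fun t _ => ((summable_exp_int hδ hd).mul_left _).mul_left d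
    · exact intervalIntegrable_const
    · refine Eventually.of_forall fun t _ => ?_
      refine HasSum.mul_left _ ?_
      exact_mod_cast (summable_lattice hδ hd hg t).hasSum
  have hE2 : ∀ t : ℝ, fourier (-m) (t : AddCircle (d - 0)) = E t := by
    intro t
    have hd' : (d : ℂ) ≠ 0 := by exact_mod_cast hd.ne'
    rw [fourier_coe_apply, hE]
    simp only
    congr 1
    push_cast
    rw [sub_zero]
    field_simp
  have h3 : HasSum (fun n : ℤ => (d:ℂ)⁻¹ * ∫ t in (0:ℝ)..d, E t * g (t - n * d))
      ((d:ℂ)⁻¹ * ∫ t, E t * g t) := by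
    rw [← hval]
    have := (Equiv.neg ℤ).hasSum_iff.2 hsum
    refine this.congr_fun ?_ |> fun h => h
    intro n
    simp only [Function.comp, Equiv.neg_apply]
    rw [hterm]
    simp
  have hd' : (d : ℂ) ≠ 0 := by exact_mod_cast hd.ne'
  have h4 := (h3.mul_left ((d:ℂ) * d)).unique (hdom.congr_fun ?_)
  · simp only [hE2, smul_eq_mul, sub_zero]
    rw [← h4, Complex.real_smul, Complex.ofReal_div, Complex.ofReal_one]
    generalize ∫ t, E t * g t = I
    field_simp
  · intro n
    rw [mul_assoc, mul_inv_cancel_left₀ hd', ← intervalIntegral.integral_const_mul]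
    refine intervalIntegral.integral_congr fun t _ => ?_
    push_cast
    ring
end Psi
end RandomTrie

namespace RandomTrie
open Filter Topology MeasureTheory Asymptotics

section Psi

variable {f : ℝ → ℝ} {C δ : ℝ}

lemma mellinConvergent_of_exp_decay (hδ : 0 < δ) (hf : ContinuousOn f (Set.Ioi 0))
    (hg : ∀ t, |logForm f t| ≤ C * Real.exp (-(δ * |t|))) {s : ℂ} (hs : s.re = -1) :
    MellinConvergent (fun x => (f x : ℂ)) s := by
  have hC : 0 ≤ C := by
    have := (abs_nonneg _).trans (hg 0)
    simpa using this
  have hb : ∀ x, 0 < x → ‖(f x : ℂ)‖ ≤ C * (x * Real.exp (-(δ * |Real.log x|))) := by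
    intro x hx
    rw [Complex.norm_real, eq_mul_logForm f hx, norm_mul, Real.norm_of_nonneg hx.le]
    calc _ ≤ x * (C * Real.exp (-(δ * |Real.log x|))) := by gcongr; exact hg _
      _ = _ := by ring
  refine mellinConvergent_of_isBigO_rpow (a := -1 + δ) (b := -1 - δ) ?_ ?_ ?_ ?_ ?_
  · exact ((Complex.continuous_ofReal.comp_continuousOn hf)).locallyIntegrableOn measurableSet_Ioi
  · refine IsBigO.of_bound C ?_
    filter_upwards [eventually_gt_atTop 0] with x hx
    refine (hb x hx).trans ?_
    rw [Real.norm_of_nonneg (by positivity)]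
    gcongr
    rw [Real.rpow_def_of_pos hx]
    nth_rewrite 1 [← Real.exp_log hx]
    rw [← Real.exp_add]
    refine Real.exp_le_exp.2 ?_
    nlinarith [le_abs_self (Real.log x)]
  · rw [hs]; linarith
  · refine IsBigO.of_bound C ?_
    filter_upwards [self_mem_nhdsWithin] with x hx
    rw [Set.mem_Ioi] at hx
    refine (hb x hx).trans ?_
    rw [Real.norm_of_nonneg (by positivity)]
    gcongr
    rw [Real.rpow_def_of_pos hx]
    nth_rewrite 1 [← Real.exp_log hx]
    rw [← Real.exp_add]
    refine Real.exp_le_exp.2 ?_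
    nlinarith [neg_abs_le (Real.log x)]
  · rw [hs]; linarith

lemma mellinR_eq_integral (f : ℝ → ℝ) (w : ℝ) :
    mellinR f (-1 - w * Complex.I) =
      ∫ t : ℝ, Complex.exp (-w * t * Complex.I) * logForm f t := by
  rw [mellinR, mellin_eq_fourier, Real.fourier_real_eq_integral_exp_smul,
    ← integral_neg_eq_self]
  refine integral_congr_ae (Eventually.of_forall fun t => ?_)
  simp only [smul_eq_mul, logForm, neg_neg, Complex.real_smul, Complex.sub_re, Complex.neg_re,
    Complex.one_re, Complex.mul_re, Complex.ofReal_re, Complex.I_re, mul_zero, Complex.ofReal_im,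
    Complex.I_im, mul_one, sub_zero, Complex.sub_im, Complex.neg_im, Complex.one_im, neg_zero,
    Complex.mul_im, add_zero, zero_sub, Complex.ofReal_mul]
  rw [one_mul]
  congr 2
  push_cast
  have := Real.pi_ne_zero
  field_simp

lemma mellinR_neg_one (f : ℝ → ℝ) :
    mellinR f (-1) = ((∫ x in Set.Ioi (0 : ℝ), f x / x ^ 2 : ℝ) : ℂ) := by
  rw [mellinR, mellin, ← integral_complex_ofReal]
  refine setIntegral_congr_fun measurableSet_Ioi fun x hx => ?_
  have hx' : (x : ℂ) ≠ 0 := by exact_mod_cast (ne_of_gt hx)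
  rw [show (-1 - 1 : ℂ) = -((2:ℕ) : ℂ) by norm_num, Complex.cpow_neg, Complex.cpow_natCast]
  simp only [smul_eq_mul]
  push_cast
  field_simp

lemma mellinR_neg_one' (f : ℝ → ℝ) : mellinR f (-1) = ((∫ t, logForm f t : ℝ) : ℂ) := by
  have := mellinR_eq_integral f 0
  simp only [Complex.ofReal_zero, zero_mul, sub_zero, neg_zero, Complex.exp_zero, one_mul] at this
  rw [this, integral_complex_ofReal]

lemma integral_logForm (f : ℝ → ℝ) :
    ∫ t, logForm f t = ∫ x in Set.Ioi (0 : ℝ), f x / x ^ 2 := by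
  have := (mellinR_neg_one f).symm.trans (mellinR_neg_one' f)
  exact_mod_cast this.symm

/-- The bounded continuous function attached to `f` and `d`. -/
noncomputable def psi (d : ℝ) (f : ℝ → ℝ) (t : ℝ) : ℝ :=
  if d = 0 then ∫ s, logForm f s else latticeSum d (logForm f) t

lemma psi_of_pos {d : ℝ} (hd : 0 < d) (f : ℝ → ℝ) : psi d f = latticeSum d (logForm f) := by
  ext t; rw [psi, if_neg hd.ne']

theorem isPsi_psi {d : ℝ} (hd : 0 ≤ d) (hδ : 0 < δ) (hf : ContinuousOn f (Set.Ioi 0))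
    (hg : ∀ t, |logForm f t| ≤ C * Real.exp (-(δ * |t|))) : IsPsi d f (psi d f) := by
  have hc := continuous_logForm hf
  have hzero : ∀ hd' : d = 0, psi d f = fun _ => ∫ s, logForm f s := fun hd' => by
    ext t; rw [psi, if_pos hd']
  have hre : ∀ m : ℤ, (mellinPoint d m).re = -1 := fun m => by
    rw [mellinPoint, Complex.sub_re, Complex.re_ofReal_mul]
    simp
  refine ⟨?_, ?_, mellinConvergent_of_exp_decay hδ hf hg (by simp), ?_, ?_, ?_, ?_, ?_⟩
  · rcases hd.eq_or_lt with h | h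
    · rw [hzero h.symm]; exact continuous_const
    · rw [psi_of_pos h]; exact continuous_latticeSum hδ h hc hg
  · rcases hd.eq_or_lt with h | h
    · rw [hzero h.symm]; exact ⟨_, fun _ => le_rfl⟩
    · rw [psi_of_pos h]; exact bounded_latticeSum hδ h hc hg
  · intro h t
    rw [hzero h, mellinR_neg_one']
  · intro h
    rw [psi_of_pos h]; exact periodic_latticeSum _ d
  · intro h m
    exact mellinConvergent_of_exp_decay hδ hf hg (hre m)
  · intro h m
    rw [psi_of_pos h, fourierCoeffOn_latticeSum hδ h hc hg, mellinPoint, mellinR_eq_integral]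
  · intro h t
    rw [psi_of_pos h]
    refine (summable_lattice hδ h hg t).hasSum.congr_fun fun k => ?_
    rw [logForm, neg_sub]

lemma hasDerivAt_latticeSum {g g' : ℝ → ℝ} {C' d : ℝ} (hδ : 0 < δ) (hd : 0 < d)
    (hder : ∀ t, HasDerivAt g (g' t) t)
    (hg : ∀ t, |g t| ≤ C * Real.exp (-(δ * |t|))) (hg' : ∀ t, |g' t| ≤ C' * Real.exp (-(δ * |t|)))
    (t : ℝ) : HasDerivAt (latticeSum d g) (latticeSum d g' t) t := by
  unfold latticeSum
  refine hasDerivAt_tsum_of_isPreconnected (t := Set.Ioo (-(|t| + 1)) (|t| + 1)) (y₀ := t)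
    (g := fun (k : ℤ) t => d * g (t - k * d)) (g' := fun (k : ℤ) t => d * g' (t - k * d))
    (u := fun k : ℤ => d * (C' * Real.exp (δ * (|t| + 1)) * Real.exp (-(δ * (|(k:ℝ)| * d)))))
    (((summable_exp_int hδ hd).mul_left _).mul_left d) isOpen_Ioo isPreconnected_Ioo ?_ ?_ ?_
    (summable_lattice hδ hd hg t) ?_
  · intro k s _
    exact ((hder (s - k * d)).comp_sub_const s (k * d)).const_mul d
  · intro k s hs
    rw [norm_mul, Real.norm_of_nonneg hd.le]
    refine mul_le_mul_of_nonneg_left ?_ hd.le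
    exact lattice_bound hδ hd hg' (abs_le.2 ⟨hs.1.le, hs.2.le⟩) k
  · exact ⟨by linarith [neg_abs_le t], by linarith [le_abs_self t]⟩
  · exact ⟨by linarith [neg_abs_le t], by linarith [le_abs_self t]⟩

/-- The Fourier coefficients of a continuously differentiable periodic function are absolutely
summable. -/
lemma summable_fourierCoeffOn_of_periodic {d : ℝ} (hd : 0 < d) {u u' : ℝ → ℝ}
    (hper : Function.Periodic u d) (hder : ∀ t, HasDerivAt u (u' t) t) (hc : Continuous u') :
    Summable fun m : ℤ => ‖fourierCoeffOn hd (fun t => (u t : ℂ)) m‖ := by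
  have hc' : Continuous fun t => (u' t : ℂ) := by fun_prop
  have hL2 : MemLp (fun t => (u' t : ℂ)) 2 (volume.restrict (Set.Ioc 0 d)) := by
    obtain ⟨B, hB⟩ := (isCompact_Icc (a := (0:ℝ)) (b := d)).exists_bound_of_continuousOn
      hc'.continuousOn
    refine MemLp.of_bound hc'.aestronglyMeasurable B ?_
    exact (ae_restrict_mem measurableSet_Ioc).mono fun t ht => hB t (Set.Ioc_subset_Icc_self ht)
  have hsq := (hasSum_sq_fourierCoeffOn hd hL2).summable
  have hinv : Summable fun m : ℤ => 1 / (m : ℝ) ^ 2 :=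
    (Real.summable_one_div_int_pow (p := 2)).2 (by norm_num)
  rw [← (Set.finite_singleton (0:ℤ)).summable_compl_iff]
  have hs := ((hsq.add hinv).mul_left (d / (2 * Real.pi)))
  refine Summable.of_nonneg_of_le (fun _ => norm_nonneg _) ?_ (hs.subtype ({0}ᶜ : Set ℤ))
  rintro ⟨m, hm⟩
  simp only [Set.mem_compl_iff, Set.mem_singleton_iff] at hm
  have h1 := fourierCoeffOn_of_hasDerivAt hd hm (f := fun t => (u t : ℂ))
    (f' := fun t => (u' t : ℂ)) (fun t _ => (hder t).ofReal_comp) (hc'.intervalIntegrable _ _)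
  have h2 : u d = u 0 := by simpa using hper 0
  simp only [h2, sub_self, mul_zero, zero_sub] at h1
  simp only [Function.comp]
  rw [h1, norm_mul, norm_neg, norm_mul, norm_div, norm_one]
  set c := ‖fourierCoeffOn hd (fun t => (u' t : ℂ)) m‖
  have h3 : ‖(-2 * Real.pi * Complex.I * m : ℂ)‖ = 2 * Real.pi * |(m:ℝ)| := by
    simp [abs_of_pos Real.pi_pos]
  have h4 : ‖(d : ℂ) - (0:ℝ)‖ = d := by simp [abs_of_pos hd]
  rw [h3, h4]
  have hm' : 0 < |(m:ℝ)| := by simpa using hm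
  have h5 : c / |(m:ℝ)| ≤ c ^ 2 + 1 / (m:ℝ) ^ 2 := by
    rw [← sq_abs (m:ℝ)]
    have := two_mul_le_add_sq c (1 / |(m:ℝ)|)
    have h0 : 0 ≤ c / |(m:ℝ)| := by positivity
    rw [div_pow, one_pow] at this
    have e : 2 * c * (1 / |(m:ℝ)|) = 2 * (c / |(m:ℝ)|) := by ring
    linarith
  calc _ = d / (2 * Real.pi) * (c / |(m:ℝ)|) := by
        have := Real.pi_pos
        field_simp
    _ ≤ _ := by
        refine mul_le_mul_of_nonneg_left h5 ?_
        have := Real.pi_pos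
        positivity

lemma hasSum_fourier_of_periodic {d : ℝ} (hd : 0 < d) {u : ℝ → ℝ}
    (hper : Function.Periodic u d) (hc : Continuous u)
    (hs : Summable fun m : ℤ => ‖fourierCoeffOn hd (fun t => (u t : ℂ)) m‖) (t : ℝ) :
    HasSum (fun m : ℤ => fourierCoeffOn hd (fun t => (u t : ℂ)) m *
      Complex.exp (2 * Real.pi * Complex.I * m * t / d)) (u t : ℂ) := by
  have : Fact (0 < d) := ⟨hd⟩
  have hper' : Function.Periodic (fun t => (u t : ℂ)) d := fun t => by simp only [hper t]
  set U : C(AddCircle d, ℂ) := ⟨hper'.lift, continuous_coinduced_dom.mpr (by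
    show Continuous fun t => (u t : ℂ)
    fun_prop)⟩ with hU
  have hcoef : ∀ m, fourierCoeff U m = fourierCoeffOn hd (fun t => (u t : ℂ)) m := by
    intro m
    rw [fourierCoeff_eq_intervalIntegral _ m 0, fourierCoeffOn_eq_integral, zero_add]
    have e : d - 0 = d := sub_zero d
    simp only [fourier_coe_apply, e]
    rfl
  have h := has_pointwise_sum_fourier_series_of_summable (f := U)
    (by simp only [funext hcoef]; exact hs.of_norm) (t : AddCircle d)
  refine h.congr_fun fun m => ?_
  rw [hcoef, fourier_coe_apply, smul_eq_mul]

theorem fourierSeriesConverges_psi {d : ℝ} (hd : 0 < d) (hδ : 0 < δ) {f' : ℝ → ℝ} {C' : ℝ}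
    (hder : ∀ x, 0 < x → HasDerivAt f (f' x) x) (hf' : ContinuousOn f' (Set.Ioi 0))
    (hg : ∀ t, |logForm f t| ≤ C * Real.exp (-(δ * |t|)))
    (hg' : ∀ t, |f' (Real.exp t)| ≤ C' * Real.exp (-(δ * |t|))) :
    FourierSeriesConverges d f (psi d f) := by
  have hf : ContinuousOn f (Set.Ioi 0) := fun x hx => (hder x hx).continuousAt.continuousWithinAt
  have hpsi := isPsi_psi hd.le hδ hf hg
  have hgder : ∀ t, HasDerivAt (logForm f) (-logForm f t + f' (Real.exp t)) t := by
    intro t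
    have h1 : HasDerivAt (fun t => Real.exp (-t)) (-Real.exp (-t)) t := by
      simpa using (hasDerivAt_neg t).exp
    have h2 := (hder (Real.exp t) (Real.exp_pos t)).comp t (Real.hasDerivAt_exp t)
    refine (h1.mul h2).congr_deriv ?_
    have : Real.exp (-t) * Real.exp t = 1 := by rw [← Real.exp_add]; simp
    simp only [logForm, Function.comp]
    linear_combination f' (Real.exp t) * this
  have hgc' : Continuous fun t => -logForm f t + f' (Real.exp t) :=
    (continuous_logForm hf).neg.add
      (hf'.comp_continuous Real.continuous_exp fun t => Real.exp_pos t)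
  have hgb' : ∀ t, |-logForm f t + f' (Real.exp t)| ≤ (C + C') * Real.exp (-(δ * |t|)) := by
    intro t
    have := abs_add_le (-logForm f t) (f' (Real.exp t))
    rw [abs_neg] at this
    linarith [hg t, hg' t]
  have hs := summable_fourierCoeffOn_of_periodic hd (periodic_latticeSum (logForm f) d)
    (hasDerivAt_latticeSum hδ hd hgder hg hgb') (continuous_latticeSum hδ hd hgc' hgb')
  have hcoef : ∀ m, fourierCoeffOn hd (fun t => (latticeSum d (logForm f) t : ℂ)) m =
      mellinR f (mellinPoint d m) := fun m => by
    rw [← hpsi.fourier hd m, psi_of_pos hd]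
  refine ⟨by simpa only [hcoef] using hs, fun t => ?_⟩
  rw [psi_of_pos hd]
  simpa only [hcoef] using hasSum_fourier_of_periodic hd (periodic_latticeSum (logForm f) d)
    (continuous_latticeSum hδ hd (continuous_logForm hf) hg) hs t

end Psi

/-! ### The period of a letter distribution -/

lemma realGcd_eq_of_closure {S : Set ℝ} {d : ℝ} (hd : 0 < d)
    (hS : AddSubgroup.closure S = AddSubgroup.zmultiples d) : realGcd S = d := by
  refine IsGreatest.csSup_eq ⟨⟨hd, fun x hx => ?_⟩, ?_⟩
  · have : x ∈ AddSubgroup.zmultiples d := hS ▸ AddSubgroup.subset_closure hx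
    obtain ⟨k, hk⟩ := AddSubgroup.mem_zmultiples_iff.1 this
    exact ⟨k, by rw [← hk, zsmul_eq_mul]⟩
  · rintro e ⟨he, hx⟩
    have h1 : AddSubgroup.closure S ≤ AddSubgroup.zmultiples e := by
      rw [AddSubgroup.closure_le]
      intro x hxS
      obtain ⟨k, hk⟩ := hx x hxS
      exact AddSubgroup.mem_zmultiples_iff.2 ⟨k, by rw [zsmul_eq_mul, hk]⟩
    obtain ⟨k, hk⟩ := AddSubgroup.mem_zmultiples_iff.1
      (h1 (hS ▸ AddSubgroup.mem_zmultiples d))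
    rw [zsmul_eq_mul] at hk
    have hk0 : 0 < (k:ℝ) := by
      by_contra h
      push Not at h
      nlinarith
    have hk1 : (1:ℝ) ≤ k := by exact_mod_cast (by exact_mod_cast hk0 : 0 < k)
    nlinarith

lemma realGcd_cases {S : Set ℝ} (hS : ∃ x ∈ S, x ≠ 0) :
    (realGcd S = 0 ∧ Dense (AddSubgroup.closure S : Set ℝ)) ∨
      (0 < realGcd S ∧ AddSubgroup.closure S = AddSubgroup.zmultiples (realGcd S)) := by
  obtain ⟨x, hxS, hx⟩ := hS
  have hcyc : ∀ g : ℝ, AddSubgroup.closure S = AddSubgroup.zmultiples g →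
      0 < |g| ∧ AddSubgroup.closure S = AddSubgroup.zmultiples |g| := by
    intro g hg
    have hg0 : g ≠ 0 := by
      rintro rfl
      have : x ∈ AddSubgroup.zmultiples (0:ℝ) := hg ▸ AddSubgroup.subset_closure hxS
      simp at this
      exact hx this
    refine ⟨abs_pos.2 hg0, ?_⟩
    rw [hg]
    rcases abs_choice g with h | h
    · rw [h]
    · rw [h, AddSubgroup.zmultiples_neg]
  by_cases hne : ∃ d, 0 < d ∧ ∀ x ∈ S, ∃ k : ℤ, x = k * d
  · obtain ⟨d, hd, hdS⟩ := hne
    right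
    have h1 : AddSubgroup.closure S ≤ AddSubgroup.zmultiples d := by
      rw [AddSubgroup.closure_le]
      intro y hy
      obtain ⟨k, hk⟩ := hdS y hy
      exact AddSubgroup.mem_zmultiples_iff.2 ⟨k, by rw [zsmul_eq_mul, hk]⟩
    have hnd : ¬ Dense (AddSubgroup.closure S : Set ℝ) := by
      intro hD
      obtain ⟨y, hy, hyd⟩ := hD.exists_dist_lt (d / 2) (show 0 < d / 4 by linarith)
      obtain ⟨k, hk⟩ := AddSubgroup.mem_zmultiples_iff.1 (h1 hy)
      rw [zsmul_eq_mul] at hk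
      rw [Real.dist_eq, ← hk, abs_lt] at hyd
      rcases le_or_gt k 0 with h | h
      · have : (k:ℝ) ≤ 0 := by exact_mod_cast h
        nlinarith
      · have : (1:ℝ) ≤ k := by exact_mod_cast h
        nlinarith
    obtain ⟨g, hg⟩ := (AddSubgroup.dense_or_cyclic _).resolve_left hnd
    rw [← AddSubgroup.zmultiples_eq_closure] at hg
    obtain ⟨h2, h3⟩ := hcyc g hg
    rw [realGcd_eq_of_closure h2 h3]
    exact ⟨h2, h3⟩
  · left
    constructor
    · rw [realGcd]
      convert Real.sSup_empty
      ext d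
      simp only [Set.mem_ofPred_eq, Set.mem_empty_iff_false, iff_false]
      exact fun h => hne ⟨d, h⟩
    · refine (AddSubgroup.dense_or_cyclic _).resolve_right ?_
      rintro ⟨g, hg⟩
      rw [← AddSubgroup.zmultiples_eq_closure] at hg
      obtain ⟨h2, h3⟩ := hcyc g hg
      refine hne ⟨|g|, h2, fun y hy => ?_⟩
      obtain ⟨k, hk⟩ := AddSubgroup.mem_zmultiples_iff.1 (h3 ▸ AddSubgroup.subset_closure hy)
      exact ⟨k, by rw [← hk, zsmul_eq_mul]⟩

section LetterDistribution

variable {A : Type*} [Fintype A] {p : PMF A}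

lemma sum_toReal (p : PMF A) : ∑ a, (p a).toReal = 1 := by
  have h := p.tsum_coe
  rw [tsum_fintype] at h
  rw [← ENNReal.toReal_sum fun a _ => p.apply_ne_top a, h, ENNReal.toReal_one]

lemma toReal_pos {A : Type*} {p : PMF A} (hp : ∀ a, p a ≠ 0) (a : A) : 0 < (p a).toReal :=
  ENNReal.toReal_pos (hp a) (p.apply_ne_top a)

lemma toReal_lt_one [Nontrivial A] (hp : ∀ a, p a ≠ 0) (a : A) : (p a).toReal < 1 := by
  obtain ⟨b, hb⟩ := exists_ne a
  classical
  have h1 : (p a).toReal + (p b).toReal ≤ ∑ c, (p c).toReal := by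
    rw [← Finset.sum_pair (f := fun c => (p c).toReal) hb.symm]
    exact Finset.sum_le_sum_of_subset_of_nonneg (Finset.subset_univ _)
      fun _ _ _ => ENNReal.toReal_nonneg
  rw [sum_toReal] at h1
  linarith [toReal_pos hp b]

lemma exists_le_neg_log [Nontrivial A] (hp : ∀ a, p a ≠ 0) :
    ∃ x₀ : ℝ, 0 < x₀ ∧ ∀ a, x₀ ≤ -Real.log (p a).toReal := by
  obtain ⟨a₀, ha₀⟩ := Finite.exists_min fun a => -Real.log (p a).toReal
  exact ⟨_, by have := Real.log_neg (toReal_pos hp a₀) (toReal_lt_one hp a₀); linarith, ha₀⟩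

lemma entropy_eq (p : PMF A) : entropy p = ∑ a, (p a).toReal * -Real.log (p a).toReal := by
  simp [entropy]

lemma entropy_pos [Nontrivial A] (hp : ∀ a, p a ≠ 0) : 0 < entropy p := by
  obtain ⟨x₀, hx₀, hx⟩ := exists_le_neg_log hp
  rw [entropy_eq]
  exact Finset.sum_pos (fun a _ => mul_pos (toReal_pos hp a) (hx₀.trans_le (hx a)))
    Finset.univ_nonempty

lemma period_nonneg [Nontrivial A] (hp : ∀ a, p a ≠ 0) : 0 ≤ period p := by
  obtain ⟨x₀, hx₀, hx⟩ := exists_le_neg_log hp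
  obtain ⟨a⟩ := (inferInstance : Nonempty A)
  rcases realGcd_cases (S := Set.range fun a => -Real.log (p a).toReal)
    ⟨_, ⟨a, rfl⟩, (hx₀.trans_le (hx a)).ne'⟩ with h | h
  · exact h.1.ge
  · exact h.1.le

/-- Asymptotics of the solution of a recursion `F(λ) = f(λ) + ∑ F(λ p_a)`. -/
theorem tendsto_div_sub_psi [Nontrivial A] (hp : ∀ a, p a ≠ 0) {f F : ℝ → ℝ} {C δ : ℝ}
    (hδ : 0 < δ) (hf : ContinuousOn f (Set.Ioi 0))
    (hg : ∀ t, |logForm f t| ≤ C * Real.exp (-(δ * |t|)))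
    (hF : ∀ l, 0 < l → F l = f l + ∑ a, F (l * (p a).toReal))
    (hF0 : Tendsto (fun l => F l / l) (𝓝[>] 0) (𝓝 0)) :
    Tendsto (fun l => F l / l - 1 / entropy p * psi (period p) f (Real.log l)) atTop (𝓝 0) := by
  obtain ⟨x₀, hx₀, hx⟩ := exists_le_neg_log hp
  have hc := continuous_logForm hf
  have hpos := toReal_pos hp
  have hGF : ∀ t, logForm F t = F (Real.exp t) / Real.exp t := fun t => by
    rw [logForm, Real.exp_neg]; ring
  have hG : ∀ t, logForm F t = logForm f t +
      stepAverage (fun a => (p a).toReal) (fun a => -Real.log (p a).toReal) (logForm F) t := by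
    intro t
    simp only [logForm, stepAverage]
    rw [hF _ (Real.exp_pos t), mul_add, Finset.mul_sum]
    congr 1
    refine Finset.sum_congr rfl fun a _ => ?_
    rw [sub_neg_eq_add, neg_add, Real.exp_add, Real.exp_add, Real.exp_neg (Real.log _),
      Real.exp_log (hpos a)]
    have := (hpos a).ne'
    field_simp
  have hG0 : Tendsto (logForm F) atBot (𝓝 0) := by
    have h1 : Tendsto Real.exp atBot (𝓝[>] 0) :=
      tendsto_nhdsWithin_iff.2 ⟨Real.tendsto_exp_atBot, Eventually.of_forall Real.exp_pos⟩
    exact (hF0.comp h1).congr fun t => (hGF t).symm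
  have key : Tendsto (fun t => logForm F t - psi (period p) f t / entropy p) atTop (𝓝 0) := by
    obtain ⟨a₀⟩ := (inferInstance : Nonempty A)
    rw [entropy_eq]
    rcases realGcd_cases (S := Set.range fun a => -Real.log (p a).toReal)
      ⟨_, ⟨a₀, rfl⟩, (hx₀.trans_le (hx a₀)).ne'⟩ with h | h
    · have h1 := renewal_nonarithmetic hpos (sum_toReal p) hx₀ hx hδ hc hg
        (integrable_of_exp_decay hδ hc hg) hG hG0 h.2
      refine h1.congr fun t => ?_
      rw [psi, if_pos (show period p = 0 from h.1)]
    · have hk : ∀ a, ∃ k : ℕ, -Real.log (p a).toReal = k * period p := by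
        intro a
        have : -Real.log (p a).toReal ∈ AddSubgroup.zmultiples (period p) := by
          rw [period, ← h.2]; exact AddSubgroup.subset_closure ⟨a, rfl⟩
        obtain ⟨k, hk⟩ := AddSubgroup.mem_zmultiples_iff.1 this
        rw [zsmul_eq_mul] at hk
        have hk0 : 0 < (k:ℝ) := by
          have h2 := hx₀.trans_le (hx a)
          rw [← hk] at h2
          exact pos_of_mul_pos_left h2 h.1.le
        lift k to ℕ using by exact_mod_cast hk0.le
        exact ⟨k, by rw [← hk]; simp⟩
      choose k hk using hk
      have hd : 0 < period p := h.1
      obtain ⟨B, hB⟩ := bounded_latticeSum hδ hd hc hg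
      rw [psi_of_pos hd]
      exact renewal_arithmetic hpos (sum_toReal p) hx₀ hx hδ hg hG hG0 hd k hk
        (by rw [h.2]; exact AddSubgroup.mem_zmultiples _) hB (periodic_latticeSum _ _)
        fun t => (summable_lattice hδ hd hg t).hasSum
  refine (key.comp Real.tendsto_log_atTop).congr' ?_
  filter_upwards [eventually_gt_atTop 0] with l hl
  simp only [Function.comp, hGF, Real.exp_log hl]
  ring

end LetterDistribution
end RandomTrie

namespace RandomTrie
open Filter Topology MeasureTheory

/-! ### Deterministic properties of tries -/

section Deterministic

variable {A : Type*}

open scoped Classical in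
/-- The number of strings with index in `S` that have prefix `α`. -/
noncomputable def countOn (Ξ : ℕ → ℕ → A) (S : Finset ℕ) (α : List A) : ℕ :=
  (S.filter fun k => IsPrefixOf α (Ξ k)).card

/-- The node set of the trie built from the strings with index in `S`. -/
def nodesOn (Ξ : ℕ → ℕ → A) (S : Finset ℕ) : Set (List A) :=
  {α | 2 ≤ countOn Ξ S α ∨ (countOn Ξ S α = 1 ∧ (α = [] ∨ 2 ≤ countOn Ξ S α.dropLast))}

open scoped Classical in
/-- The trie built from the strings with index in `S`. -/
noncomputable def trieOn (Ξ : ℕ → ℕ → A) (S : Finset ℕ) : Finset (List A) :=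
  if h : (nodesOn Ξ S).Finite then h.toFinset else ∅

lemma trie_eq_trieOn (Ξ : ℕ → ℕ → A) (n : ℕ) : trie Ξ n = trieOn Ξ (Finset.range n) := rfl

/-- The strings with their first letters removed. -/
def tails (Ξ : ℕ → ℕ → A) : ℕ → ℕ → A := fun k i => Ξ k (i + 1)

open scoped Classical in
/-- The indices in `S` of the strings with first letter `a`. -/
noncomputable def headClass (h : ℕ → A) (S : Finset ℕ) (a : A) : Finset ℕ := S.filter fun k => h k = a

/-- The first letters. -/
def heads (Ξ : ℕ → ℕ → A) : ℕ → A := fun k => Ξ k 0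

lemma mem_headClass {h : ℕ → A} {S : Finset ℕ} {a : A} {k : ℕ} :
    k ∈ headClass h S a ↔ k ∈ S ∧ h k = a := by
  classical
  rw [headClass, Finset.mem_filter]

lemma isPrefixOf_nil (x : ℕ → A) : IsPrefixOf [] x := fun i h => by simp at h

lemma isPrefixOf_cons (a : A) (β : List A) (x : ℕ → A) :
    IsPrefixOf (a :: β) x ↔ x 0 = a ∧ IsPrefixOf β fun i => x (i + 1) := by
  constructor
  · intro h
    exact ⟨h 0 (by simp), fun i hi => h (i + 1) (by simpa using hi)⟩
  · rintro ⟨h0, h⟩ i hi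
    cases i with
    | zero => exact h0
    | succ i => exact h i (by simpa using hi)

lemma countOn_nil (Ξ : ℕ → ℕ → A) (S : Finset ℕ) : countOn Ξ S [] = S.card := by
  simp [countOn, isPrefixOf_nil]

lemma countOn_cons (Ξ : ℕ → ℕ → A) (S : Finset ℕ) (a : A) (β : List A) :
    countOn Ξ S (a :: β) = countOn (tails Ξ) (headClass (heads Ξ) S a) β := by
  classical
  rw [countOn, countOn]
  congr 1
  ext k
  rw [Finset.mem_filter, Finset.mem_filter, mem_headClass, isPrefixOf_cons, and_assoc]
  rfl

lemma countOn_congr_index {Ξ Ξ' : ℕ → ℕ → A} {S S' : Finset ℕ} (σ : ℕ → ℕ)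
    (hσ : Set.InjOn σ S) (hS : S.image σ = S') (h : ∀ k ∈ S, Ξ k = Ξ' (σ k)) (α : List A) :
    countOn Ξ S α = countOn Ξ' S' α := by
  subst hS
  classical
  rw [countOn, countOn, Finset.filter_image, Finset.card_image_of_injOn
    (hσ.mono (by intro k hk; simp only [Finset.coe_filter] at hk; exact hk.1))]
  congr 1
  refine Finset.filter_congr fun k hk => ?_
  rw [h k hk]

lemma mem_trieOn {Ξ : ℕ → ℕ → A} {S : Finset ℕ} {α : List A} :
    α ∈ trieOn Ξ S ↔ (nodesOn Ξ S).Finite ∧ α ∈ nodesOn Ξ S := by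
  unfold trieOn
  split_ifs with h <;> simp [h]

lemma trieOn_congr {Ξ Ξ' : ℕ → ℕ → A} {S S' : Finset ℕ}
    (h : ∀ α, countOn Ξ S α = countOn Ξ' S' α) : trieOn Ξ S = trieOn Ξ' S' := by
  have : nodesOn Ξ S = nodesOn Ξ' S' := by simp only [nodesOn, h]
  ext α
  rw [mem_trieOn, mem_trieOn, this]

lemma countOn_append_le (Ξ : ℕ → ℕ → A) (S : Finset ℕ) (α β : List A) :
    countOn Ξ S (α ++ β) ≤ countOn Ξ S α := by
  classical
  refine Finset.card_le_card fun k hk => ?_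
  simp only [Finset.mem_filter] at hk ⊢
  refine ⟨hk.1, fun i hi => ?_⟩
  rw [hk.2 i (by simp; omega), List.getElem_append_left hi]

/-- The prefixes of length `h` of the strings in `S` are distinct. -/
def SeparatedAt (Ξ : ℕ → ℕ → A) (S : Finset ℕ) (h : ℕ) : Prop :=
  ∀ j ∈ S, ∀ k ∈ S, (∀ i < h, Ξ j i = Ξ k i) → j = k

lemma exists_separatedAt {Ξ : ℕ → ℕ → A} {S : Finset ℕ} (hΞ : Set.InjOn Ξ S) :
    ∃ h, SeparatedAt Ξ S h := by
  classical
  have h1 : ∀ q : ℕ × ℕ, ∃ i, q.1 ∈ S → q.2 ∈ S → q.1 ≠ q.2 → Ξ q.1 i ≠ Ξ q.2 i := by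
    rintro ⟨j, k⟩
    by_cases h : j ∈ S ∧ k ∈ S ∧ j ≠ k
    · obtain ⟨hj, hk, hjk⟩ := h
      obtain ⟨i, hi⟩ := Function.ne_iff.1 (fun e => hjk (hΞ hj hk e))
      exact ⟨i, fun _ _ _ => hi⟩
    · exact ⟨0, fun a b c => absurd ⟨a, b, c⟩ h⟩
  choose i hi using h1
  refine ⟨(S ×ˢ S).sup i + 1, fun j hj k hk hjk => ?_⟩
  by_contra hne
  exact hi (j, k) hj hk hne (hjk _ (Nat.lt_succ_of_le
    (Finset.le_sup (f := i) (b := (j, k)) (Finset.mk_mem_product hj hk))))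

lemma SeparatedAt.countOn_le_one {Ξ : ℕ → ℕ → A} {S : Finset ℕ} {h : ℕ} (hs : SeparatedAt Ξ S h)
    {α : List A} (hα : h ≤ α.length) : countOn Ξ S α ≤ 1 := by
  classical
  refine Finset.card_le_one.2 fun j hj k hk => ?_
  simp only [Finset.mem_filter] at hj hk
  refine hs j hj.1 k hk.1 fun i hi => ?_
  rw [hj.2 i (by omega), hk.2 i (by omega)]

lemma SeparatedAt.length_le {Ξ : ℕ → ℕ → A} {S : Finset ℕ} {h : ℕ} (hs : SeparatedAt Ξ S h)
    {α : List A} (hα : α ∈ nodesOn Ξ S) : α.length ≤ h := by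
  rcases hα with h2 | ⟨_, h3 | h3⟩
  · by_contra hc
    have := hs.countOn_le_one (α := α) (by omega)
    omega
  · simp [h3]
  · by_contra hc
    have := hs.countOn_le_one (α := α.dropLast) (by rw [List.length_dropLast]; omega)
    omega

lemma SeparatedAt.finite [Finite A] {Ξ : ℕ → ℕ → A} {S : Finset ℕ} {h : ℕ}
    (hs : SeparatedAt Ξ S h) : (nodesOn Ξ S).Finite :=
  (List.finite_length_le A h).subset fun _ hα => hs.length_le hα

lemma finite_nodesOn [Finite A] {Ξ : ℕ → ℕ → A} {S : Finset ℕ} (hΞ : Set.InjOn Ξ S) :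
    (nodesOn Ξ S).Finite := by
  obtain ⟨h, hs⟩ := exists_separatedAt hΞ
  exact hs.finite

lemma injOn_tails {Ξ : ℕ → ℕ → A} {S : Finset ℕ} (hΞ : Set.InjOn Ξ S) (a : A) :
    Set.InjOn (tails Ξ) (headClass (heads Ξ) S a) := by
  intro j hj k hk hjk
  rw [Finset.mem_coe, mem_headClass] at hj hk
  refine hΞ hj.1 hk.1 (funext fun i => ?_)
  cases i with
  | zero => exact hj.2.trans hk.2.symm
  | succ i => exact congrFun hjk i

lemma mem_fringe {T : Finset (List A)} {v β : List A} : β ∈ fringe T v ↔ v ++ β ∈ T := by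
  simp [fringe]

lemma fringe_nil (T : Finset (List A)) : fringe T [] = T := by
  ext β; simp [mem_fringe]

lemma fringe_fringe (T : Finset (List A)) (v w : List A) :
    fringe (fringe T v) w = fringe T (v ++ w) := by
  ext β; simp [mem_fringe, List.append_assoc]

lemma fringe_trieOn [Finite A] {Ξ : ℕ → ℕ → A} {S : Finset ℕ} (hΞ : Set.InjOn Ξ S)
    (hS : 2 ≤ S.card) (a : A) :
    fringe (trieOn Ξ S) [a] = trieOn (tails Ξ) (headClass (heads Ξ) S a) := by
  ext β
  rw [mem_fringe, mem_trieOn, mem_trieOn, and_iff_right (finite_nodesOn hΞ),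
    and_iff_right (finite_nodesOn (injOn_tails hΞ a))]
  simp only [nodesOn, Set.mem_ofPred_eq, List.singleton_append, countOn_cons]
  cases β with
  | nil => simp [countOn_nil, hS]
  | cons b γ => simp [countOn_cons]

/-- The part of the additive functional that comes from the nodes of depth less than `k`. -/
noncomputable def additiveBelow (k : ℕ∞) (φ : Finset (List A) → ℝ) (T : Finset (List A)) : ℝ :=
  ∑ v ∈ T, if (v.length : ℕ∞) < k then φ (fringe T v) else 0

lemma additiveBelow_top (φ : Finset (List A) → ℝ) : additiveBelow ⊤ φ = additive φ := by
  ext T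
  refine Finset.sum_congr rfl fun v _ => ?_
  rw [if_pos (ENat.natCast_lt_top _)]

lemma additiveBelow_empty (k : ℕ∞) (φ : Finset (List A) → ℝ) : additiveBelow k φ ∅ = 0 := by
  simp [additiveBelow]

lemma additiveBelow_bullet {k : ℕ∞} (hk : 1 ≤ k) (φ : Finset (List A) → ℝ) :
    additiveBelow k φ (bullet A) = φ (bullet A) := by
  have : 0 < k := lt_of_lt_of_le (by norm_num) hk
  simp [additiveBelow, bullet, fringe_nil, this]

lemma additiveBelow_one {φ : Finset (List A) → ℝ} (hφ : φ ∅ = 0) {T : Finset (List A)}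
    (hT : T.Nonempty → [] ∈ T) : additiveBelow 1 φ T = φ T := by
  classical
  rcases T.eq_empty_or_nonempty with rfl | hne
  · simp [additiveBelow, hφ]
  · rw [additiveBelow, Finset.sum_eq_single_of_mem [] (hT hne)]
    · simp [fringe_nil]
    · intro v _ hv
      rw [if_neg]
      have : 1 ≤ v.length := List.length_pos_iff.2 hv
      simpa using hv

lemma additiveBelow_succ [Fintype A] (k : ℕ∞) (φ : Finset (List A) → ℝ) {T : Finset (List A)}
    (hT : [] ∈ T) : additiveBelow (k + 1) φ T = φ T + ∑ a, additiveBelow k φ (fringe T [a]) := by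
  classical
  have hdec : T = insert [] (Finset.univ.biUnion fun a =>
      (fringe T [a]).map ⟨fun β => a :: β, List.cons_injective⟩) := by
    ext v
    simp only [Finset.mem_insert, Finset.mem_biUnion, Finset.mem_univ, true_and, Finset.mem_map,
      Function.Embedding.coeFn_mk, mem_fringe, List.singleton_append]
    cases v with
    | nil => simp [hT]
    | cons a β => simp
  have hsum : ∀ F : List A → ℝ, ∑ v ∈ T, F v = F [] + ∑ a, ∑ β ∈ fringe T [a], F (a :: β) := by
    intro F
    conv_lhs => rw [hdec]
    rw [Finset.sum_insert (by simp), Finset.sum_biUnion]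
    · simp
    · intro a _ b _ hab
      rw [Function.onFun, Finset.disjoint_left]
      intro v hv hw
      simp only [Finset.mem_map, Function.Embedding.coeFn_mk] at hv hw
      obtain ⟨β, _, rfl⟩ := hv
      obtain ⟨γ, _, h⟩ := hw
      exact hab (List.cons.inj h).1.symm
  rw [additiveBelow, hsum]
  congr 1
  · rw [if_pos (by simp), fringe_nil]
  · refine Finset.sum_congr rfl fun a _ => ?_
    rw [additiveBelow]
    refine Finset.sum_congr rfl fun β _ => ?_
    rw [fringe_fringe, List.singleton_append]
    congr 1
    rw [List.length_cons, Nat.cast_add, Nat.cast_one, eq_iff_iff]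
    exact ENat.add_lt_add_iff_right (by simp)

/-- The toll function modified to vanish at `•`. -/
noncomputable def reducedToll (φ : Finset (List A) → ℝ) (T : Finset (List A)) : ℝ :=
  open scoped Classical in φ T - if T = bullet A then φ (bullet A) else 0

lemma trieOn_of_card_eq_zero (Ξ : ℕ → ℕ → A) {S : Finset ℕ} (hS : S.card = 0) :
    trieOn Ξ S = ∅ := by
  obtain rfl := Finset.card_eq_zero.1 hS
  ext α
  simp [mem_trieOn, nodesOn, countOn]

lemma trieOn_of_card_eq_one (Ξ : ℕ → ℕ → A) {S : Finset ℕ} (hS : S.card = 1) :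
    trieOn Ξ S = bullet A := by
  have hc : ∀ α, countOn Ξ S α ≤ 1 := fun α => by
    rw [← hS, ← countOn_nil Ξ S]
    simpa using countOn_append_le Ξ S [] α
  have hn : nodesOn Ξ S = {[]} := by
    ext α
    simp only [nodesOn, Set.mem_ofPred_eq, Set.mem_singleton_iff]
    constructor
    · rintro (h | ⟨_, h | h⟩)
      · have := hc α; omega
      · exact h
      · have := hc α.dropLast; omega
    · rintro rfl
      exact Or.inr ⟨by rw [countOn_nil, hS], Or.inl rfl⟩
  ext α
  rw [mem_trieOn, hn]
  simp [bullet]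

lemma nil_mem_trieOn [Finite A] {Ξ : ℕ → ℕ → A} {S : Finset ℕ} (hΞ : Set.InjOn Ξ S)
    (hS : 1 ≤ S.card) : [] ∈ trieOn Ξ S := by
  rw [mem_trieOn]
  refine ⟨finite_nodesOn hΞ, ?_⟩
  simp only [nodesOn, Set.mem_ofPred_eq, countOn_nil, true_or, and_true]
  omega

lemma trieOn_ne_bullet [Finite A] {Ξ : ℕ → ℕ → A} {S : Finset ℕ} (hΞ : Set.InjOn Ξ S)
    (hS : 2 ≤ S.card) : trieOn Ξ S ≠ bullet A := by
  intro h
  obtain ⟨k, hk⟩ := Finset.card_pos.1 (by omega : 0 < S.card)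
  have h1 := fringe_trieOn hΞ hS (Ξ k 0)
  have h2 : [] ∈ trieOn (tails Ξ) (headClass (heads Ξ) S (Ξ k 0)) := by
    refine nil_mem_trieOn (injOn_tails hΞ _) (Finset.card_pos.2 ⟨k, ?_⟩)
    exact mem_headClass.2 ⟨hk, rfl⟩
  rw [← h1, mem_fringe, h] at h2
  simp [bullet] at h2

lemma reducedToll_trieOn [Finite A] {φ : Finset (List A) → ℝ} (hφ : φ ∅ = 0) {Ξ : ℕ → ℕ → A}
    {S : Finset ℕ} (hΞ : Set.InjOn Ξ S) :
    reducedToll φ (trieOn Ξ S) = if 2 ≤ S.card then φ (trieOn Ξ S) else 0 := by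
  rcases Nat.lt_or_ge S.card 2 with h | h
  · rw [if_neg (by omega)]
    interval_cases h' : S.card
    · rw [trieOn_of_card_eq_zero Ξ h', reducedToll, if_neg, hφ, sub_zero]
      exact (Finset.singleton_ne_empty _).symm
    · rw [trieOn_of_card_eq_one Ξ h', reducedToll, if_pos rfl, sub_self]
  · rw [if_pos h, reducedToll, if_neg (trieOn_ne_bullet hΞ h), sub_zero]

/-- The recursion satisfied by (truncated) additive functionals of a trie. -/
lemma additiveBelow_trieOn [Fintype A] {φ : Finset (List A) → ℝ} (hφ : φ ∅ = 0) {k : ℕ∞}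
    (hk : 1 ≤ k) {Ξ : ℕ → ℕ → A} {S : Finset ℕ} (hΞ : Set.InjOn Ξ S) :
    additiveBelow (k + 1) φ (trieOn Ξ S) = reducedToll φ (trieOn Ξ S) +
      ∑ a, additiveBelow k φ (trieOn (tails Ξ) (headClass (heads Ξ) S a)) := by
  classical
  rcases Nat.lt_or_ge S.card 2 with h | h
  · rw [reducedToll_trieOn hφ hΞ, if_neg (by omega), zero_add]
    interval_cases h' : S.card
    · rw [trieOn_of_card_eq_zero Ξ h', additiveBelow_empty, Finset.sum_eq_zero]
      intro a _
      rw [trieOn_of_card_eq_zero, additiveBelow_empty]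
      rw [headClass, Finset.card_eq_zero.1 h', Finset.filter_empty, Finset.card_empty]
    · obtain ⟨j, hj⟩ := Finset.card_eq_one.1 h'
      rw [trieOn_of_card_eq_one Ξ h', additiveBelow_bullet (le_add_self),
        Finset.sum_eq_single_of_mem (heads Ξ j) (Finset.mem_univ _)]
      · rw [trieOn_of_card_eq_one, additiveBelow_bullet hk]
        rw [headClass, hj, Finset.filter_singleton, if_pos rfl, Finset.card_singleton]
      · intro a _ ha
        rw [trieOn_of_card_eq_zero, additiveBelow_empty]
        rw [headClass, hj, Finset.filter_singleton, if_neg ha.symm, Finset.card_empty]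
  · rw [additiveBelow_succ k φ (nil_mem_trieOn hΞ (by omega)), reducedToll_trieOn hφ hΞ, if_pos h]
    congr 1
    exact Finset.sum_congr rfl fun a _ => by rw [fringe_trieOn hΞ h]

end Deterministic
end RandomTrie

namespace RandomTrie
open Filter Topology MeasureTheory ProbabilityTheory
open scoped ENNReal

/-! ### The law of the random trie and Poisson thinning -/

section Measurability

variable {A : Type*} [MeasurableSpace A]

lemma measurable_heads : Measurable (heads (A := A)) := by unfold heads; fun_prop

lemma measurable_tails : Measurable (tails (A := A)) := by unfold tails; fun_prop

variable [DiscreteMeasurableSpace A]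

lemma measurable_isPrefixOf (α : List A) (k : ℕ) :
    Measurable fun Ξ : ℕ → ℕ → A => IsPrefixOf α (Ξ k) := by
  unfold IsPrefixOf
  refine Measurable.forall fun i => Measurable.forall fun h => ?_
  exact measurableSet_setOfPred.1 ((MeasurableSet.of_discrete (s := {α[i]})).preimage
    (by fun_prop : Measurable fun Ξ : ℕ → ℕ → A => Ξ k i))

lemma measurable_countOn (S : Finset ℕ) (α : List A) :
    Measurable fun Ξ : ℕ → ℕ → A => countOn Ξ S α := by
  classical
  have : (fun Ξ : ℕ → ℕ → A => countOn Ξ S α) =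
      fun Ξ => ∑ k ∈ S, if IsPrefixOf α (Ξ k) then 1 else 0 := by
    ext Ξ
    rw [countOn, Finset.card_filter]
  rw [this]
  refine Finset.measurable_fun_sum _ fun k _ => ?_
  exact Measurable.ite (measurableSet_setOfPred.2 (measurable_isPrefixOf α k)) measurable_const
    measurable_const

lemma measurable_nodesOn (S : Finset ℕ) : Measurable fun Ξ : ℕ → ℕ → A => nodesOn Ξ S := by
  rw [measurable_set_iff]
  intro α
  have h2 : ∀ β : List A, Measurable fun Ξ : ℕ → ℕ → A => 2 ≤ countOn Ξ S β := fun β =>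
    measurableSet_setOfPred.1 ((MeasurableSet.of_discrete (s := Set.Ici 2)).preimage
      (measurable_countOn S β))
  have h1 : Measurable fun Ξ : ℕ → ℕ → A => countOn Ξ S α = 1 :=
    measurableSet_setOfPred.1 ((MeasurableSet.of_discrete (s := {1})).preimage
      (measurable_countOn S α))
  exact (h2 α).or (h1.and (measurable_const.or (h2 _)))

variable [Countable A]

lemma measurable_trieOn (S : Finset ℕ) : Measurable fun Ξ : ℕ → ℕ → A => trieOn Ξ S := by
  rw [measurable_finset_iff]
  intro α
  simp only [mem_trieOn]
  refine Measurable.and ?_ ?_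
  · exact measurableSet_setOfPred.1 (MeasurableSet.setOfPred_finite.preimage (measurable_nodesOn S))
  · exact (measurable_set_iff.1 (measurable_nodesOn S)) α

lemma measurable_randomTrie : Measurable (randomTrie (A := A)) :=
  measurable_from_prod_countable_right fun n => measurable_trieOn (Finset.range n)

lemma measurable_toll (φ : Finset (List A) → ℝ) :
    Measurable fun ω : ℕ × (ℕ → ℕ → A) => φ (randomTrie ω) :=
  (measurable_of_countable φ).comp measurable_randomTrie

end Measurability

section Law

/-- The product of two infinite product measures is an infinite product over the sum type. -/
lemma infinitePi_map_sum {I J X : Type*} [MeasurableSpace X] (μ : Measure X)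
    [IsProbabilityMeasure μ] :
    (Measure.infinitePi fun _ : I ⊕ J => μ).map (fun x => (fun i => x (.inl i), fun j => x (.inr j)))
      = (Measure.infinitePi fun _ : I => μ).prod (Measure.infinitePi fun _ : J => μ) := by
  classical
  have hm : Measurable fun q : (I → X) × (J → X) => (Sum.elim q.1 q.2 : I ⊕ J → X) := by
    refine measurable_pi_lambda _ fun a => ?_
    rcases a with i | j <;> simp only [Sum.elim_inl, Sum.elim_inr] <;> fun_prop
  have h : ((Measure.infinitePi fun _ : I => μ).prod (Measure.infinitePi fun _ : J => μ)).map
      (fun q => (Sum.elim q.1 q.2 : I ⊕ J → X)) = Measure.infinitePi fun _ : I ⊕ J => μ := by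
    refine Measure.eq_infinitePi _ fun s t ht => ?_
    rw [Measure.map_apply hm (.pi s.countable_toSet fun _ _ => ht _)]
    have : (fun q : (I → X) × (J → X) => (Sum.elim q.1 q.2 : I ⊕ J → X)) ⁻¹' (Set.pi s t) =
        (Set.pi s.toLeft fun i => t (.inl i)) ×ˢ (Set.pi s.toRight fun j => t (.inr j)) := by
      ext q
      simp only [Set.mem_preimage, Set.mem_pi, Set.mem_prod, Finset.mem_coe, Finset.mem_toLeft,
        Finset.mem_toRight, Sum.forall, Sum.elim_inl, Sum.elim_inr]
    rw [this, Measure.prod_prod, Measure.infinitePi_pi _ fun i _ => ht _,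
      Measure.infinitePi_pi _ fun i _ => ht _]
    conv_rhs => rw [← Finset.toLeft_disjSum_toRight (u := s), Finset.prod_disjSum]
  rw [← h, Measure.map_map (by fun_prop) hm]
  convert Measure.map_id
  ext q <;> rfl

variable {A : Type*} [MeasurableSpace A]

/-- The law of a sequence of i.i.d. strings. -/
noncomputable abbrev stringsLaw (p : PMF A) : Measure (ℕ → ℕ → A) :=
  Measure.infinitePi fun _ : ℕ => Measure.infinitePi fun _ : ℕ => p.toMeasure

lemma stringsLaw_map_heads_tails (p : PMF A) :
    (stringsLaw p).map (fun Ξ => (heads Ξ, tails Ξ)) =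
      (Measure.infinitePi fun _ : ℕ => p.toMeasure).prod (stringsLaw p) := by
  have hcurry : (Measure.infinitePi fun _ : ℕ × ℕ => p.toMeasure).map
      (MeasurableEquiv.curry ℕ ℕ A) = stringsLaw p :=
    Measure.infinitePi_map_curry fun _ _ => p.toMeasure
  set σ : ℕ ⊕ ℕ × ℕ → ℕ × ℕ := Sum.elim (fun k => (k, 0)) fun q => (q.1, q.2 + 1) with hσ
  have hinj : Function.Injective σ := by
    rintro (k | ⟨k, i⟩) (l | ⟨l, j⟩) h <;> simp_all
  have h1 : (Measure.infinitePi fun _ : ℕ × ℕ => p.toMeasure).map (fun x i => x (σ i)) =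
      Measure.infinitePi fun _ : ℕ ⊕ ℕ × ℕ => p.toMeasure :=
    Measure.map_infinitePi_infinitePi_of_inj (P := fun _ : ℕ × ℕ => p.toMeasure) hinj
  have h2 := infinitePi_map_sum (I := ℕ) (J := ℕ × ℕ) p.toMeasure
  have hmeas : Measurable (fun Ξ : ℕ → ℕ → A => (heads Ξ, tails Ξ)) :=
    measurable_heads.prodMk measurable_tails
  have hl : (stringsLaw p).map (fun Ξ => (heads Ξ, tails Ξ)) =
      (((Measure.infinitePi fun _ : ℕ ⊕ ℕ × ℕ => p.toMeasure).map
        (fun x => (fun i => x (.inl i), fun j => x (.inr j)))).map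
        (Prod.map id (MeasurableEquiv.curry ℕ ℕ A))) := by
    rw [← hcurry, ← h1, Measure.map_map hmeas (by fun_prop), Measure.map_map (by fun_prop)
      (by fun_prop), Measure.map_map (by fun_prop) (by fun_prop)]
    rfl
  rw [hl, h2, ← Measure.map_prod_map _ _ measurable_id (by fun_prop), Measure.map_id, hcurry]

variable [Fintype A] [DiscreteMeasurableSpace A] (p : PMF A)

/-- Disjoint blocks of strings generate independent tries, and the law of the trie of a block
depends only on the size of the block. -/
lemma stringsLaw_map_trieOn {S : A → Finset ℕ} (hS : Pairwise fun a b => Disjoint (S a) (S b)) :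
    (stringsLaw p).map (fun Ξ a => trieOn Ξ (S a)) =
      Measure.pi fun a => (stringsLaw p).map fun Ξ => trieOn Ξ (Finset.range (S a).card) := by
  classical
  obtain ⟨N, hN⟩ : ∃ N, ∀ a, ∀ k ∈ S a, k < N :=
    ⟨(Finset.univ.biUnion S).sup id + 1, fun a k hk => Nat.lt_succ_of_le
      (Finset.le_sup (f := id) (Finset.mem_biUnion.2 ⟨a, Finset.mem_univ a, hk⟩))⟩
  let _ : Encodable A := Fintype.toEncodable A
  set σ : A × ℕ → ℕ := fun q =>
    if h : q.2 < (S q.1).card then ((S q.1).equivFin.symm ⟨q.2, h⟩ : ℕ) else N + Encodable.encode q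
    with hσ
  have hσ1 : ∀ a k (h : k < (S a).card), σ (a, k) = ((S a).equivFin.symm ⟨k, h⟩ : ℕ) :=
    fun a k h => by rw [hσ]; simp only; rw [dif_pos h]
  have hσ2 : ∀ a k, ¬ k < (S a).card → σ (a, k) = N + Encodable.encode (a, k) :=
    fun a k h => by rw [hσ]; simp only; rw [dif_neg h]
  have hmem : ∀ a k, k < (S a).card → σ (a, k) ∈ S a := fun a k h => by
    rw [hσ1 a k h]; exact ((S a).equivFin.symm ⟨k, h⟩).2
  have hinj : Function.Injective σ := by
    rintro ⟨a, k⟩ ⟨b, l⟩ h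
    by_cases hk : k < (S a).card <;> by_cases hl : l < (S b).card
    · have hab : a = b := by
        by_contra hne
        exact Finset.disjoint_left.1 (hS hne) (hmem a k hk) (h ▸ hmem b l hl)
      subst hab
      rw [hσ1 a k hk, hσ1 a l hl] at h
      have := (S a).equivFin.symm.injective (Subtype.ext h)
      rw [Fin.mk.injEq] at this
      rw [this]
    · have := hN a _ (hmem a k hk)
      rw [h, hσ2 b l hl] at this
      omega
    · have := hN b _ (hmem b l hl)
      rw [← h, hσ2 a k hk] at this
      omega
    · rw [hσ2 a k hk, hσ2 b l hl] at h
      exact Encodable.encode_injective (by omega)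
  have himg : ∀ a, (Finset.range (S a).card).image (fun k => σ (a, k)) = S a := by
    intro a
    refine Finset.eq_of_subset_of_card_le (fun x hx => ?_) ?_
    · obtain ⟨k, hk, rfl⟩ := Finset.mem_image.1 hx
      exact hmem a k (Finset.mem_range.1 hk)
    · rw [Finset.card_image_of_injective _ fun k l h => by simpa using hinj h, Finset.card_range]
  have htrie : ∀ (Ξ : ℕ → ℕ → A) a, trieOn Ξ (S a) =
      trieOn (fun k => Ξ (σ (a, k))) (Finset.range (S a).card) := by
    intro Ξ a
    refine (trieOn_congr fun α => ?_).symm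
    exact countOn_congr_index (fun k => σ (a, k)) (fun k _ l _ h => by simpa using hinj h)
      (himg a) (fun k _ => rfl) α
  set B := Measure.infinitePi fun _ : ℕ => p.toMeasure with hB
  have h1 : (stringsLaw p).map (fun Ξ i => Ξ (σ i)) = Measure.infinitePi fun _ : A × ℕ => B :=
    Measure.map_infinitePi_infinitePi_of_inj (P := fun _ : ℕ => B) hinj
  have h2 : (Measure.infinitePi fun _ : A × ℕ => B).map (MeasurableEquiv.curry A ℕ (ℕ → A)) =
      Measure.infinitePi fun _ : A => stringsLaw p :=
    Measure.infinitePi_map_curry fun _ _ => B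
  have hmt : Measurable fun (Θ : A → ℕ → ℕ → A) a => trieOn (Θ a) (Finset.range (S a).card) :=
    measurable_pi_lambda _ fun a => (measurable_trieOn _).comp (measurable_pi_apply a)
  have h3 : (stringsLaw p).map (fun Ξ a => trieOn Ξ (S a)) =
      (Measure.infinitePi fun _ : A => stringsLaw p).map
        fun Θ a => trieOn (Θ a) (Finset.range (S a).card) := by
    rw [← h2, ← h1, Measure.map_map (MeasurableEquiv.measurable _) (by fun_prop),
      Measure.map_map hmt (by fun_prop)]
    congr 1
    funext Ξ a
    exact htrie Ξ a
  rw [h3, Measure.infinitePi_map_pi (μ := fun _ : A => stringsLaw p)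
    (f := fun a Ξ => trieOn Ξ (Finset.range (S a).card)) fun a => measurable_trieOn _]
  have (a : A) : IsProbabilityMeasure
      ((stringsLaw p).map fun Ξ => trieOn Ξ (Finset.range (S a).card)) :=
    Measure.isProbabilityMeasure_map (measurable_trieOn _).aemeasurable
  rw [Measure.infinitePi_eq_pi]

end Law
end RandomTrie

namespace RandomTrie
open Filter Topology MeasureTheory ProbabilityTheory
open scoped ENNReal Nat

section Thinning

/-- The number of occurrences of each letter in a word. -/
def letterCount {A : Type*} [DecidableEq A] {n : ℕ} (w : Fin n → A) (a : A) : ℕ :=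
  (Finset.univ.filter fun i => w i = a).card

lemma sum_letterCount {A : Type*} [Fintype A] [DecidableEq A] {n : ℕ} (w : Fin n → A) :
    ∑ a, letterCount w a = n := by
  have := Finset.sum_fiberwise (Finset.univ : Finset (Fin n)) w fun _ => 1
  simpa [letterCount] using this

lemma prod_letterCount {A M : Type*} [Fintype A] [DecidableEq A] [CommMonoid M] {n : ℕ}
    (w : Fin n → A) (f : A → M) : ∏ i, f (w i) = ∏ a, f a ^ letterCount w a := by
  rw [← Finset.prod_fiberwise' Finset.univ w f]
  simp [letterCount]

/-- The number of words with given letter counts is a multinomial coefficient. -/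
lemma card_letterCount_eq {A : Type*} [Fintype A] [DecidableEq A] {n : ℕ} {m : A → ℕ}
    (hm : ∑ a, m a = n) :
    (Finset.univ.filter fun w : Fin n → A => letterCount w = m).card =
      Nat.multinomial Finset.univ m := by
  classical
  have hind : ∀ f : A → ℕ, Finsupp.indicator Finset.univ (fun i _ => f i) =
      Finsupp.equivFunOnFinite.symm f := fun f => by ext; simp
  have h1 : (∑ a, (MvPolynomial.X a : MvPolynomial A ℕ)) ^ n =
      ∑ w : Fin n → A, ∏ a, MvPolynomial.X a ^ letterCount w a := by
    rw [Fintype.sum_pow]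
    exact Finset.sum_congr rfl fun w _ => prod_letterCount w _
  have h2 := Finset.sum_pow_eq_sum_piAntidiag Finset.univ
    (fun a => (MvPolynomial.X a : MvPolynomial A ℕ)) n
  have h3 := congrArg (MvPolynomial.coeff (Finsupp.equivFunOnFinite.symm m)) (h1.symm.trans h2)
  simp only [MvPolynomial.coeff_sum, MvPolynomial.coeff_prod_X_pow, hind,
    EmbeddingLike.apply_eq_iff_eq] at h3
  rw [Finset.card_filter]
  simp only [eq_comm (b := m)]
  rw [h3, Finset.sum_eq_single_of_mem m]
  · rw [← MvPolynomial.C_eq_coe_nat, MvPolynomial.coeff_C_mul, MvPolynomial.coeff_prod_X_pow, hind,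
      if_pos rfl]
    simp
  · simp [Finset.mem_piAntidiag, hm]
  · intro k _ hk
    rw [← MvPolynomial.C_eq_coe_nat, MvPolynomial.coeff_C_mul, MvPolynomial.coeff_prod_X_pow, hind,
      if_neg (by simpa [eq_comm] using hk), mul_zero]

lemma prod_tsum_ennreal {A : Type*} [Fintype A] (l : A → NNReal) (u : A → ℕ → ℝ≥0∞) :
    ∏ a, ∫⁻ n, u a n ∂(poissonMeasure (l a)) =
      ∑' m : A → ℕ, ∏ a, u a (m a) * poissonMeasure (l a) {m a} := by
  have h := lintegral_prod_eq_prod_lintegral_of_indepFun Finset.univ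
    (μ := Measure.pi fun a => poissonMeasure (l a)) (fun a (m : A → ℕ) => u a (m a))
    (iIndepFun_pi (X := u) fun a => (measurable_of_countable _).aemeasurable)
    fun a => (measurable_of_countable _).comp (measurable_pi_apply a)
  have h2 : ∀ a, ∫⁻ m : A → ℕ, u a (m a) ∂(Measure.pi fun a => poissonMeasure (l a)) =
      ∫⁻ n, u a n ∂(poissonMeasure (l a)) := fun a =>
    (measurePreserving_eval (fun a => poissonMeasure (l a)) a).lintegral_comp
      (measurable_of_countable (u a))
  simp only [h2] at h
  rw [← h, lintegral_countable']
  refine tsum_congr fun m => ?_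
  rw [Measure.pi_singleton, Finset.prod_mul_distrib]

lemma poisson_multinomial {A : Type*} [Fintype A] {p : PMF A} {l : ℝ} (hl : 0 ≤ l) (m : A → ℕ) :
    poissonMeasure l.toNNReal {∑ a, m a} * (Nat.multinomial Finset.univ m * ∏ a, p a ^ m a) =
      ∏ a, poissonMeasure (l * (p a).toReal).toNNReal {m a} := by
  have hpa : ∀ a, p a = ENNReal.ofReal (p a).toReal := fun a =>
    (ENNReal.ofReal_toReal (p.apply_ne_top a)).symm
  have hq : ∀ a, 0 ≤ (p a).toReal := fun a => ENNReal.toReal_nonneg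
  have h1 : ∏ a, p a ^ m a = ENNReal.ofReal (∏ a, (p a).toReal ^ m a) := by
    rw [ENNReal.ofReal_prod_of_nonneg fun a _ => pow_nonneg (hq a) _]
    refine Finset.prod_congr rfl fun a _ => ?_
    rw [ENNReal.ofReal_pow (hq a), ← hpa]
  have hq2 : 0 ≤ ∏ a, (p a).toReal ^ m a := Finset.prod_nonneg fun a _ => pow_nonneg (hq a) _
  rw [h1, ← ENNReal.ofReal_natCast, ← ENNReal.ofReal_mul (by positivity)]
  simp only [poissonMeasure_singleton]
  rw [← ENNReal.ofReal_mul (by positivity), ← ENNReal.ofReal_prod_of_nonneg (fun a _ => by positivity)]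
  congr 1
  rw [Real.coe_toNNReal _ hl]
  have h2 : ∀ a, ((l * (p a).toReal).toNNReal : ℝ) = l * (p a).toReal := fun a =>
    Real.coe_toNNReal _ (mul_nonneg hl (hq a))
  simp only [h2]
  rw [Finset.prod_div_distrib, Finset.prod_mul_distrib, ← Real.exp_sum, Finset.sum_neg_distrib,
    ← Finset.mul_sum, sum_toReal, mul_one]
  simp only [mul_pow]
  rw [Finset.prod_mul_distrib, Finset.prod_pow_eq_pow_sum]
  have h3 : ((Nat.multinomial Finset.univ m : ℕ) : ℝ) * ∏ a, ((m a)! : ℝ) = ((∑ a, m a)! : ℝ) := by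
    rw [mul_comm]
    exact_mod_cast Nat.multinomial_spec Finset.univ m
  have h4 : (∏ a, ((m a)! : ℝ)) ≠ 0 := Finset.prod_ne_zero_iff.2 fun a _ => by positivity
  have h5 : ((∑ a, m a)! : ℝ) ≠ 0 := by positivity
  rw [div_mul_eq_mul_div, div_eq_div_iff h5 h4, ← h3]
  ring

/-- Splitting a Poisson number of i.i.d. letters into classes. -/
lemma tsum_poisson_words {A : Type*} [Fintype A] [DecidableEq A] {p : PMF A} {l : ℝ} (hl : 0 ≤ l)
    (u : A → ℕ → ℝ≥0∞) :
    ∑' n : ℕ, (∑ w : Fin n → A, (∏ i, p (w i)) * ∏ a, u a (letterCount w a)) *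
      poissonMeasure l.toNNReal {n} =
      ∏ a, ∫⁻ n, u a n ∂(poissonMeasure (l * (p a).toReal).toNNReal) := by
  classical
  rw [prod_tsum_ennreal]
  set F : (A → ℕ) → ℝ≥0∞ := fun m =>
    ∏ a, u a (m a) * poissonMeasure (l * (p a).toReal).toNNReal {m a} with hF
  have h1 : ∀ n : ℕ, (∑ w : Fin n → A, (∏ i, p (w i)) * ∏ a, u a (letterCount w a)) *
      poissonMeasure l.toNNReal {n} = ∑' m : A → ℕ, if ∑ a, m a = n then F m else 0 := by
    intro n
    have h2 : ∑ w : Fin n → A, (∏ i, p (w i)) * ∏ a, u a (letterCount w a) =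
        ∑ m ∈ Finset.piAntidiag Finset.univ n, Nat.multinomial Finset.univ m *
          ((∏ a, p a ^ m a) * ∏ a, u a (m a)) := by
      rw [← Finset.sum_fiberwise_of_maps_to (g := letterCount)
        (t := Finset.piAntidiag Finset.univ n) (fun w _ => by
          simp [Finset.mem_piAntidiag, sum_letterCount w])]
      refine Finset.sum_congr rfl fun m hm => ?_
      have hm' : ∑ a, m a = n := by simpa [Finset.mem_piAntidiag] using hm
      rw [← card_letterCount_eq hm', ← nsmul_eq_mul, ← Finset.sum_const]
      refine Finset.sum_congr rfl fun w hw => ?_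
      rw [prod_letterCount w, (Finset.mem_filter.1 hw).2]
    rw [h2, tsum_eq_sum (s := Finset.piAntidiag Finset.univ n) (fun m hm => by
      rw [if_neg]
      simpa [Finset.mem_piAntidiag] using hm), Finset.sum_mul]
    refine Finset.sum_congr rfl fun m hm => ?_
    have hm' : ∑ a, m a = n := by simpa [Finset.mem_piAntidiag] using hm
    rw [if_pos hm', hF]
    simp only
    rw [Finset.prod_mul_distrib, ← poisson_multinomial hl, hm']
    ring
  simp only [h1]
  rw [ENNReal.tsum_comm]
  refine tsum_congr fun m => ?_
  rw [tsum_eq_single (∑ a, m a) (fun n hn => if_neg hn.symm), if_pos rfl]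

variable {A : Type*} [Fintype A] [MeasurableSpace A] [DiscreteMeasurableSpace A] (p : PMF A)

instance (l : ℝ) : IsProbabilityMeasure (model p l) := by
  unfold model; infer_instance

lemma measurable_headClass_trie (n : ℕ) :
    Measurable fun q : (ℕ → A) × (ℕ → ℕ → A) => fun a =>
      trieOn q.2 (headClass q.1 (Finset.range n) a) := by
  classical
  refine measurable_pi_lambda _ fun a => ?_
  have h : ∀ q : (ℕ → A) × (ℕ → ℕ → A), headClass q.1 (Finset.range n) a =
      (Finset.univ.filter fun i : Fin n => q.1 i = a).map Fin.valEmbedding := by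
    intro q
    ext k
    rw [mem_headClass, Finset.mem_map]
    simp only [Finset.mem_range, Finset.mem_filter, Finset.mem_univ, true_and,
      Fin.valEmbedding_apply]
    constructor
    · rintro ⟨hk, e⟩
      exact ⟨⟨k, hk⟩, e, rfl⟩
    · rintro ⟨i, e, rfl⟩
      exact ⟨i.2, e⟩
  simp only [h]
  have h2 : Measurable fun r : (Fin n → A) × (ℕ → ℕ → A) =>
      trieOn r.2 ((Finset.univ.filter fun i : Fin n => r.1 i = a).map Fin.valEmbedding) :=
    measurable_from_prod_countable_right fun w => measurable_trieOn
      ((Finset.univ.filter fun i : Fin n => w i = a).map Fin.valEmbedding)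
  have h3 : Measurable fun q : (ℕ → A) × (ℕ → ℕ → A) => ((fun i : Fin n => q.1 i), q.2) := by
    fun_prop
  have h4 := h2.comp h3
  simp only [Function.comp_def] at h4
  exact h4

/-- The tries of the strings with given first letters, these letters being removed. -/
noncomputable def branches {A : Type*} (ω : ℕ × (ℕ → ℕ → A)) (a : A) : Finset (List A) :=
  trieOn (tails ω.2) (headClass (heads ω.2) (Finset.range ω.1) a)

lemma measurable_branches : Measurable (branches (A := A)) := by
  refine measurable_from_prod_countable_right fun n => ?_
  have h : Measurable fun Ξ : ℕ → ℕ → A => (heads Ξ, tails Ξ) :=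
    measurable_heads.prodMk measurable_tails
  have h2 := (measurable_headClass_trie n).comp h
  simp only [Function.comp_def] at h2
  unfold branches
  exact h2

lemma stringsLaw_branches (n : ℕ) (T : A → Finset (List A)) [DecidableEq A] :
    stringsLaw p ((fun Ξ => branches (n, Ξ)) ⁻¹' {T}) =
      ∑ w : Fin n → A, (∏ i, p (w i)) *
        ∏ a, stringsLaw p ((fun Ξ => trie Ξ (letterCount w a)) ⁻¹' {T a}) := by
  have hm := measurable_headClass_trie (A := A) n
  have h1 : stringsLaw p ((fun Ξ => branches (n, Ξ)) ⁻¹' {T}) =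
      (stringsLaw p).map (fun Ξ => (heads Ξ, tails Ξ))
        ((fun q => fun a => trieOn q.2 (headClass q.1 (Finset.range n) a)) ⁻¹' {T}) := by
    rw [Measure.map_apply (measurable_heads.prodMk measurable_tails)
      (hm (MeasurableSet.of_discrete))]
    rfl
  rw [h1, stringsLaw_map_heads_tails, Measure.prod_apply (hm (MeasurableSet.of_discrete))]
  have hcard : ∀ (h : ℕ → A) a, (headClass h (Finset.range n) a).card =
      letterCount (fun i : Fin n => h i) a := by
    intro h a
    rw [letterCount, ← Finset.card_map Fin.valEmbedding]
    congr 1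
    ext k
    rw [mem_headClass, Finset.mem_map]
    simp only [Finset.mem_range, Finset.mem_filter, Finset.mem_univ, true_and,
      Fin.valEmbedding_apply]
    constructor
    · rintro ⟨hk, e⟩
      exact ⟨⟨k, hk⟩, e, rfl⟩
    · rintro ⟨i, e, rfl⟩
      exact ⟨i.2, e⟩
  have h2 : ∀ h : ℕ → A, stringsLaw p (Prod.mk h ⁻¹'
      ((fun q : (ℕ → A) × (ℕ → ℕ → A) => fun a =>
        trieOn q.2 (headClass q.1 (Finset.range n) a)) ⁻¹' {T})) =
      ∏ a, stringsLaw p ((fun Ξ => trie Ξ (letterCount (fun i : Fin n => h i) a)) ⁻¹' {T a}) := by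
    intro h
    have hd : Pairwise fun a b => Disjoint (headClass h (Finset.range n) a)
        (headClass h (Finset.range n) b) := by
      intro a b hab
      rw [Finset.disjoint_left]
      intro k hk hk'
      exact hab ((mem_headClass.1 hk).2.symm.trans (mem_headClass.1 hk').2)
    have h3 := congrArg (fun μ => μ {T}) (stringsLaw_map_trieOn p hd)
    have (a : A) : IsProbabilityMeasure ((stringsLaw p).map
        fun Ξ => trieOn Ξ (Finset.range (headClass h (Finset.range n) a).card)) :=
      Measure.isProbabilityMeasure_map (measurable_trieOn _).aemeasurable
    rw [Measure.map_apply (measurable_pi_lambda _ fun a => measurable_trieOn _)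
      MeasurableSet.of_discrete, Measure.pi_singleton] at h3
    refine h3.trans (Finset.prod_congr rfl fun a _ => ?_)
    rw [Measure.map_apply (measurable_trieOn _) MeasurableSet.of_discrete, hcard]
    rfl
  simp only [h2]
  have h4 : (Measure.infinitePi fun _ : ℕ => p.toMeasure).map (fun h (i : Fin n) => h i) =
      Measure.infinitePi fun _ : Fin n => p.toMeasure :=
    Measure.map_infinitePi_infinitePi_of_inj (P := fun _ : ℕ => p.toMeasure) Fin.val_injective
  have h5 : ∫⁻ h, (∏ a, stringsLaw p ((fun Ξ => trie Ξ (letterCount (fun i : Fin n => h i) a)) ⁻¹'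
      {T a})) ∂(Measure.infinitePi fun _ : ℕ => p.toMeasure) =
      ∫⁻ w, (∏ a, stringsLaw p ((fun Ξ => trie Ξ (letterCount w a)) ⁻¹' {T a}))
        ∂(Measure.infinitePi fun _ : Fin n => p.toMeasure) := by
    rw [← h4, lintegral_map (measurable_of_countable _) (by fun_prop)]
  rw [h5, lintegral_countable', tsum_fintype]
  refine Finset.sum_congr rfl fun w _ => ?_
  rw [mul_comm, Measure.infinitePi_singleton_of_fintype]
  congr 1
  refine Finset.prod_congr rfl fun i _ => ?_
  rw [PMF.toMeasure_apply_singleton _ _ MeasurableSet.of_discrete]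

lemma model_apply {A : Type*} [MeasurableSpace A] (p : PMF A) {l : ℝ} {s : Set (ℕ × (ℕ → ℕ → A))} (hs : MeasurableSet s) :
    model p l s = ∑' n, stringsLaw p (Prod.mk n ⁻¹' s) * poissonMeasure l.toNNReal {n} := by
  rw [model, Measure.prod_apply hs, lintegral_countable']

/-- **Poisson thinning**: the branches of the random trie are independent random tries. -/
theorem model_map_branches {l : ℝ} (hl : 0 ≤ l) :
    (model p l).map branches =
      Measure.pi fun a => (model p (l * (p a).toReal)).map randomTrie := by
  classical
  have (a : A) : IsProbabilityMeasure ((model p (l * (p a).toReal)).map randomTrie) :=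
    Measure.isProbabilityMeasure_map measurable_randomTrie.aemeasurable
  refine Measure.ext_of_singleton fun T => ?_
  rw [Measure.pi_singleton, Measure.map_apply measurable_branches MeasurableSet.of_discrete,
    model_apply p (measurable_branches MeasurableSet.of_discrete)]
  have h1 : ∀ n, stringsLaw p (Prod.mk n ⁻¹' (branches ⁻¹' {T})) = _ :=
    fun n => stringsLaw_branches p n T
  simp only [h1]
  rw [tsum_poisson_words hl fun a n => stringsLaw p ((fun Ξ => trie Ξ n) ⁻¹' {T a})]
  refine Finset.prod_congr rfl fun a _ => ?_
  rw [Measure.map_apply measurable_randomTrie MeasurableSet.of_discrete,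
    model_apply p (measurable_randomTrie MeasurableSet.of_discrete), lintegral_countable']
  rfl

end Thinning
end RandomTrie

namespace RandomTrie
open Filter Topology MeasureTheory ProbabilityTheory
open scoped ENNReal

/-! ### Almost sure distinctness, and moments of the branches -/

section Moments

variable {A : Type*} [Fintype A] [MeasurableSpace A] [DiscreteMeasurableSpace A] {p : PMF A}

lemma infinitePi_singleton_eq_zero [Nontrivial A] (hp : ∀ a, p a ≠ 0) (x : ℕ → A) :
    (Measure.infinitePi fun _ : ℕ => p.toMeasure) {x} = 0 := by
  obtain ⟨a₀, ha₀⟩ := Finite.exists_max fun a => p a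
  have hlt : p a₀ < 1 := by
    have := toReal_lt_one hp a₀
    rw [← ENNReal.toReal_one, ENNReal.toReal_lt_toReal (p.apply_ne_top _) ENNReal.one_ne_top] at this
    exact this
  have hle : ∀ n : ℕ, (Measure.infinitePi fun _ : ℕ => p.toMeasure) {x} ≤ p a₀ ^ n := by
    intro n
    calc (Measure.infinitePi fun _ : ℕ => p.toMeasure) {x}
        ≤ (Measure.infinitePi fun _ : ℕ => p.toMeasure) (Set.pi (Finset.range n) fun i => {x i}) :=
          measure_mono (by rintro _ rfl; simp [Set.mem_pi])
      _ = ∏ i ∈ Finset.range n, p (x i) := by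
          rw [Measure.infinitePi_pi _ fun i _ => MeasurableSet.of_discrete]
          refine Finset.prod_congr rfl fun i _ => ?_
          rw [PMF.toMeasure_apply_singleton _ _ MeasurableSet.of_discrete]
      _ ≤ ∏ i ∈ Finset.range n, p a₀ := Finset.prod_le_prod' fun i _ => ha₀ _
      _ = p a₀ ^ n := by simp
  refine le_antisymm (ge_of_tendsto' (ENNReal.tendsto_pow_atTop_nhds_zero_of_lt_one hlt) hle) bot_le

lemma ae_injective_strings [Nontrivial A] (hp : ∀ a, p a ≠ 0) :
    ∀ᵐ Ξ ∂(stringsLaw p), Function.Injective Ξ := by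
  have h : ∀ j k : ℕ, j ≠ k → ∀ᵐ Ξ ∂(stringsLaw p), Ξ j ≠ Ξ k := by
    intro j k hjk
    set B := Measure.infinitePi fun _ : ℕ => p.toMeasure with hB
    have hdiag : MeasurableSet {q : (ℕ → A) × (ℕ → A) | q.1 = q.2} := by
      have : {q : (ℕ → A) × (ℕ → A) | q.1 = q.2} = ⋂ i : ℕ, ⋃ a : A,
          {q | q.1 i = a} ∩ {q | q.2 i = a} := by
        ext q
        simp [funext_iff, eq_comm]
      rw [this]
      refine MeasurableSet.iInter fun i => MeasurableSet.iUnion fun a => ?_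
      exact ((MeasurableSet.of_discrete (s := {a})).preimage
          (by fun_prop : Measurable fun q : (ℕ → A) × (ℕ → A) => q.1 i)).inter
        ((MeasurableSet.of_discrete (s := {a})).preimage
          (by fun_prop : Measurable fun q : (ℕ → A) × (ℕ → A) => q.2 i))
    have h1 : (stringsLaw p).map (fun Ξ => (Ξ j, Ξ k)) = B.prod B :=
      Measure.infinitePi_map_eval_prod (P := fun _ : ℕ => B) hjk
    have h2 : (B.prod B) {q | q.1 = q.2} = 0 := by
      rw [Measure.prod_apply hdiag]
      refine (lintegral_congr fun x => ?_).trans lintegral_zero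
      have : Prod.mk x ⁻¹' {q : (ℕ → A) × (ℕ → A) | q.1 = q.2} = {x} := by
        ext y; simp [eq_comm]
      rw [this]
      exact infinitePi_singleton_eq_zero hp x
    rw [← h1, Measure.map_apply (by fun_prop) hdiag] at h2
    rw [ae_iff]
    simpa using h2
  have h2 : ∀ᵐ Ξ ∂(stringsLaw p), ∀ j k : ℕ, j ≠ k → Ξ j ≠ Ξ k := by
    rw [ae_all_iff]; intro j
    rw [ae_all_iff]; intro k
    by_cases hjk : j = k
    · exact Eventually.of_forall fun Ξ h => absurd hjk h
    · exact (h j k hjk).mono fun Ξ h _ => h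
  filter_upwards [h2] with Ξ hΞ j k hjk
  by_contra hne
  exact hΞ j k hne hjk

lemma ae_injective [Nontrivial A] (hp : ∀ a, p a ≠ 0) (l : ℝ) :
    ∀ᵐ ω ∂(model p l), Function.Injective ω.2 :=
  Measure.quasiMeasurePreserving_snd.ae (ae_injective_strings hp)

lemma ae_additiveBelow [Nontrivial A] (hp : ∀ a, p a ≠ 0) {φ : Finset (List A) → ℝ} (hφ : φ ∅ = 0)
    {k : ℕ∞} (hk : 1 ≤ k) (l : ℝ) :
    (fun ω => additiveBelow (k + 1) φ (randomTrie ω)) =ᵐ[model p l]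
      fun ω => reducedToll φ (randomTrie ω) + ∑ a, additiveBelow k φ (branches ω a) := by
  filter_upwards [ae_injective hp l] with ω hω
  exact additiveBelow_trieOn hφ hk hω.injOn

lemma model_map_branch {l : ℝ} (hl : 0 ≤ l) (a : A) :
    (model p l).map (fun ω => branches ω a) = (model p (l * (p a).toReal)).map randomTrie := by
  have (b : A) : IsProbabilityMeasure ((model p (l * (p b).toReal)).map randomTrie) :=
    Measure.isProbabilityMeasure_map measurable_randomTrie.aemeasurable
  have h := (measurePreserving_eval
    (fun a => (model p (l * (p a).toReal)).map randomTrie) a).map_eq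
  rw [← model_map_branches p hl, Measure.map_map (measurable_pi_apply a) measurable_branches] at h
  exact h

lemma measurable_branch (a : A) :
    Measurable fun ω : ℕ × (ℕ → ℕ → A) => branches ω a :=
  (measurable_pi_apply a).comp measurable_branches

lemma memLp_branch {l : ℝ} (hl : 0 ≤ l) (a : A) {h : Finset (List A) → ℝ}
    (hh : HasSecondMoment p h (l * (p a).toReal)) :
    MemLp (fun ω => h (branches ω a)) 2 (model p l) := by
  have hm := (measurable_of_countable h)
  have h1 : MemLp h 2 ((model p (l * (p a).toReal)).map randomTrie) :=
    (memLp_map_measure_iff hm.aestronglyMeasurable measurable_randomTrie.aemeasurable).2 hh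
  rw [← model_map_branch hl] at h1
  exact (memLp_map_measure_iff hm.aestronglyMeasurable (measurable_branch a).aemeasurable).1 h1

lemma integral_branch {l : ℝ} (hl : 0 ≤ l) (a : A) (h : Finset (List A) → ℝ) :
    ∫ ω, h (branches ω a) ∂(model p l) = meanOf p h (l * (p a).toReal) := by
  have hm := (measurable_of_countable h)
  rw [meanOf, ← integral_map (μ := model p (l * (p a).toReal)) (f := h)
    measurable_randomTrie.aemeasurable hm.aestronglyMeasurable, ← model_map_branch hl,
    integral_map (measurable_branch a).aemeasurable hm.aestronglyMeasurable]

lemma variance_sum_branches {l : ℝ} (hl : 0 ≤ l) {h : Finset (List A) → ℝ}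
    (hh : ∀ a, HasSecondMoment p h (l * (p a).toReal)) :
    variance (fun ω => ∑ a, h (branches ω a)) (model p l) = ∑ a, varOf p h (l * (p a).toReal) := by
  have (b : A) : IsProbabilityMeasure ((model p (l * (p b).toReal)).map randomTrie) :=
    Measure.isProbabilityMeasure_map measurable_randomTrie.aemeasurable
  have hm := (measurable_of_countable h)
  have h1 := variance_sum_pi (μ := fun a => (model p (l * (p a).toReal)).map randomTrie)
    (X := fun _ => h) fun a =>
      (memLp_map_measure_iff hm.aestronglyMeasurable measurable_randomTrie.aemeasurable).2 (hh a)
  rw [← model_map_branches p hl] at h1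
  have hm2 : Measurable (∑ a, fun T : A → Finset (List A) => h (T a)) := by
    have e : (∑ a, fun T : A → Finset (List A) => h (T a)) = fun T => ∑ a, h (T a) := by
      ext T; simp
    rw [e]
    exact Finset.measurable_fun_sum _ fun a _ => hm.comp (measurable_pi_apply a)
  rw [variance_map hm2.aemeasurable measurable_branches.aemeasurable] at h1
  have h2 : (fun ω => ∑ a, h (branches ω a)) =
      (∑ a, fun T : A → Finset (List A) => h (T a)) ∘ branches (A := A) := by
    ext ω; simp
  rw [h2, h1]
  refine Finset.sum_congr rfl fun a _ => ?_
  rw [variance_map hm.aemeasurable measurable_randomTrie.aemeasurable]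
  rfl

end Moments

section CauchySchwarz

variable {Ω : Type*} {mΩ : MeasurableSpace Ω} {μ : Measure Ω} [IsProbabilityMeasure μ]
  {X Y : Ω → ℝ}

/-- The Cauchy–Schwarz inequality for the covariance. -/
lemma abs_covariance_le_sqrt (hX : MemLp X 2 μ) (hY : MemLp Y 2 μ) :
    |covariance X Y μ| ≤ √(variance X μ) * √(variance Y μ) := by
  have h : ∀ t : ℝ, 0 ≤ variance Y μ * (t * t) + 2 * covariance X Y μ * t + variance X μ := by
    intro t
    have h1 := variance_add hX (hY.const_mul t)
    have h2 := variance_nonneg (X + fun ω => t * Y ω) μ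
    rw [h1, covariance_const_mul_right, variance_const_mul] at h2
    linarith
  have h1 := discrim_le_zero h
  rw [discrim] at h1
  rw [← Real.sqrt_mul (variance_nonneg _ _)]
  exact Real.abs_le_sqrt (by linarith)

/-- The triangle inequality for the standard deviation. -/
lemma sqrt_variance_add_le (hX : MemLp X 2 μ) (hY : MemLp Y 2 μ) :
    √(variance (fun ω => X ω + Y ω) μ) ≤ √(variance X μ) + √(variance Y μ) := by
  rw [Real.sqrt_le_left (by positivity), variance_fun_add hX hY, add_sq,
    Real.sq_sqrt (variance_nonneg _ _), Real.sq_sqrt (variance_nonneg _ _)]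
  have := (le_abs_self _).trans (abs_covariance_le_sqrt hX hY)
  linarith

end CauchySchwarz
end RandomTrie

namespace RandomTrie
open Filter Topology MeasureTheory ProbabilityTheory
open scoped ENNReal Nat

/-! ### Poisson transforms -/

section PoissonTransform

/-- The exponential generating function of `c` is entire. -/
def EntireSeq (c : ℕ → ℝ) : Prop := ∀ x : ℝ, 0 < x → Summable fun n => |c n| * (x ^ n / n !)

/-- The mean of `c N` for a Poisson variable `N` with parameter `x`. -/
noncomputable def poissonTransform (c : ℕ → ℝ) (x : ℝ) : ℝ :=
  Real.exp (-x) * ∑' n, c n * (x ^ n / n !)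

variable {c c' : ℕ → ℝ}

lemma EntireSeq.sub (hc : EntireSeq c) (hc' : EntireSeq c') : EntireSeq fun n => c n - c' n := by
  intro x hx
  refine ((hc x hx).add (hc' x hx)).of_nonneg_of_le (fun n => by positivity) fun n => ?_
  rw [← add_mul]
  exact mul_le_mul_of_nonneg_right (abs_sub _ _) (by positivity)

lemma EntireSeq.mul_cast (hc : EntireSeq c) : EntireSeq fun n => n * c n := by
  intro x hx
  refine (hc (2 * x) (by positivity)).of_nonneg_of_le (fun n => by positivity) fun n => ?_
  have h : (n : ℝ) ≤ 2 ^ n := by exact_mod_cast Nat.lt_two_pow_self.le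
  rw [abs_mul, Nat.abs_cast, mul_pow]
  have h0 : 0 ≤ |c n| * (x ^ n / n !) := by positivity
  calc (n : ℝ) * |c n| * (x ^ n / n !) = n * (|c n| * (x ^ n / n !)) := by ring
    _ ≤ 2 ^ n * (|c n| * (x ^ n / n !)) := mul_le_mul_of_nonneg_right h h0
    _ = |c n| * (2 ^ n * x ^ n / n !) := by ring

lemma succ_mul_pow_div (x : ℝ) (n : ℕ) :
    ((n + 1 : ℕ) : ℝ) * (x ^ (n + 1) / (n + 1)!) = x * (x ^ n / n !) := by
  rw [Nat.factorial_succ]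
  push_cast
  have : (n ! : ℝ) ≠ 0 := by positivity
  field_simp
  ring

lemma EntireSeq.succ (hc : EntireSeq c) : EntireSeq fun n => c (n + 1) := by
  intro x hx
  have h := ((summable_nat_add_iff 1).2 (hc.mul_cast x hx)).mul_left x⁻¹
  refine h.congr fun n => ?_
  rw [abs_mul, Nat.abs_cast]
  have := succ_mul_pow_div x n
  calc x⁻¹ * (((n + 1 : ℕ) : ℝ) * |c (n + 1)| * (x ^ (n + 1) / (n + 1)!))
      = x⁻¹ * |c (n + 1)| * (((n + 1 : ℕ) : ℝ) * (x ^ (n + 1) / (n + 1)!)) := by ring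
    _ = |c (n + 1)| * (x ^ n / n !) := by rw [this]; field_simp

lemma EntireSeq.diff (hc : EntireSeq c) : EntireSeq fun n => c (n + 1) - c n := hc.succ.sub hc

lemma EntireSeq.summable (hc : EntireSeq c) (x : ℝ) : Summable fun n => c n * (x ^ n / n !) := by
  refine Summable.of_norm_bounded (hc (|x| + 1) (by positivity)) fun n => ?_
  rw [norm_mul, norm_div, norm_pow, Real.norm_eq_abs, Real.norm_eq_abs, Real.norm_natCast]
  gcongr
  linarith

lemma hasDerivAt_pow_div_factorial (n : ℕ) (x : ℝ) :
    HasDerivAt (fun x : ℝ => x ^ n / n !) (n * x ^ (n - 1) / n !) x :=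
  (hasDerivAt_pow n x).div_const _

lemma succ_mul_pow_div' (x : ℝ) (n : ℕ) :
    ((n + 1 : ℕ) : ℝ) * x ^ (n + 1 - 1) / (n + 1)! = x ^ n / n ! := by
  rw [Nat.factorial_succ, Nat.add_sub_cancel]
  push_cast
  have : (n ! : ℝ) ≠ 0 := by positivity
  field_simp

lemma EntireSeq.hasDerivAt_tsum (hc : EntireSeq c) (x : ℝ) :
    HasDerivAt (fun x => ∑' n, c n * (x ^ n / n !)) (∑' n, c (n + 1) * (x ^ n / n !)) x := by
  set R := |x| + 1
  have hR : 0 < R := by positivity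
  have hu : Summable fun n : ℕ => |c n| * (n * R ^ (n - 1) / n !) := by
    refine (summable_nat_add_iff 1).1 ((hc.succ R hR).congr fun n => ?_)
    rw [succ_mul_pow_div']
  have hb : ∀ (n : ℕ) (y : ℝ), y ∈ Metric.ball (0 : ℝ) R →
      ‖c n * (n * y ^ (n - 1) / n !)‖ ≤ |c n| * (n * R ^ (n - 1) / n !) := by
    intro n y hy
    rw [mem_ball_zero_iff] at hy
    rw [norm_mul, norm_div, norm_mul, norm_pow, Real.norm_natCast, Real.norm_natCast,
      Real.norm_eq_abs (c n)]
    gcongr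
  have hx : x ∈ Metric.ball (0 : ℝ) R := by
    rw [mem_ball_zero_iff, Real.norm_eq_abs]
    exact lt_add_one _
  have h := hasDerivAt_tsum_of_isPreconnected hu Metric.isOpen_ball
    (convex_ball (0 : ℝ) R).isPreconnected
    (fun n y _ => (hasDerivAt_pow_div_factorial n y).const_mul (c n)) hb hx (hc.summable x) hx
  convert! h using 1
  rw [Summable.tsum_eq_zero_add (Summable.of_norm_bounded hu fun n => hb n x hx)]
  simp only [succ_mul_pow_div']
  simp

lemma EntireSeq.hasDerivAt (hc : EntireSeq c) (x : ℝ) :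
    HasDerivAt (poissonTransform c) (poissonTransform (fun n => c (n + 1) - c n) x) x := by
  have h := (hasDerivAt_neg x).exp.mul (hc.hasDerivAt_tsum x)
  convert! h using 1
  simp only [poissonTransform, sub_mul]
  rw [(hc.succ.summable x).tsum_sub (hc.summable x)]
  ring

lemma EntireSeq.continuous (hc : EntireSeq c) : Continuous (poissonTransform c) :=
  continuous_iff_continuousAt.2 fun x => (hc.hasDerivAt x).continuousAt

lemma poissonTransform_zero (c : ℕ → ℝ) : poissonTransform c 0 = c 0 := by
  rw [poissonTransform, tsum_eq_single 0]
  · simp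
  · intro n hn; simp [hn]

lemma EntireSeq.poissonTransform_mul_cast (hc : EntireSeq c) (x : ℝ) :
    poissonTransform (fun n => n * c n) x = x * poissonTransform (fun n => c (n + 1)) x := by
  rw [poissonTransform, poissonTransform, (hc.mul_cast.summable x).tsum_eq_zero_add]
  have : ∀ n : ℕ, ((n + 1 : ℕ) : ℝ) * c (n + 1) * (x ^ (n + 1) / (n + 1)!) =
      x * (c (n + 1) * (x ^ n / n !)) := fun n => by
    have := succ_mul_pow_div x n
    linear_combination c (n + 1) * this
  simp only [this, tsum_mul_left]
  simp only [CharP.cast_eq_zero, zero_mul, zero_add]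
  ring

lemma EntireSeq.poissonTransform_diff (hc : EntireSeq c) (x : ℝ) :
    poissonTransform (fun n => c (n + 1) - c n) x =
      poissonTransform (fun n => c (n + 1)) x - poissonTransform c x := by
  simp only [poissonTransform, sub_mul]
  rw [(hc.succ.summable x).tsum_sub (hc.summable x)]
  ring

lemma EntireSeq.tendsto_div (hc : EntireSeq c) (h0 : c 0 = 0) :
    Tendsto (fun x => poissonTransform c x / x) (𝓝[>] 0) (𝓝 (c 1)) := by
  have h := (hasDerivAt_iff_tendsto_slope_zero.1 (hc.hasDerivAt 0)).mono_left
    (nhdsWithin_mono 0 fun x (hx : 0 < x) => hx.ne')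
  simp only [poissonTransform_zero, h0, zero_add, sub_zero, smul_eq_mul] at h
  exact h.congr fun x => by rw [div_eq_inv_mul]

lemma EntireSeq.exists_le_pow (hc : EntireSeq c) (k : ℕ) (h0 : ∀ n < k, c n = 0) :
    ∃ C, ∀ x, 0 < x → x ≤ 1 → |poissonTransform c x| ≤ C * x ^ k := by
  refine ⟨∑' n, |c n| * (1 ^ n / n !), fun x hx hx1 => ?_⟩
  rw [poissonTransform, abs_mul, Real.abs_exp]
  have h1 : |∑' n, c n * (x ^ n / n !)| ≤ ∑' n, |c n| * (1 ^ n / n !) * x ^ k := by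
    rw [← Real.norm_eq_abs]
    refine tsum_of_norm_bounded ((hc 1 one_pos).mul_right (x ^ k)).hasSum fun n => ?_
    rcases lt_or_ge n k with hn | hn
    · simp [h0 n hn]
    · rw [norm_mul, Real.norm_eq_abs, Real.norm_of_nonneg (by positivity), mul_assoc, one_pow,
        div_mul_eq_mul_div, one_mul]
      exact mul_le_mul_of_nonneg_left (div_le_div_of_nonneg_right
        (pow_le_pow_of_le_one hx.le hx1 hn) (by positivity)) (abs_nonneg _)
  rw [tsum_mul_right] at h1
  calc Real.exp (-x) * |∑' n, c n * (x ^ n / n !)| ≤ 1 * |∑' n, c n * (x ^ n / n !)| := by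
        gcongr
        rw [Real.exp_le_one_iff]; linarith
    _ ≤ _ := by rwa [one_mul]

lemma entireSeq_const (r : ℝ) : EntireSeq fun _ => r :=
  fun x _ => (Real.summable_pow_div_factorial x).mul_left _

lemma poissonTransform_const (r x : ℝ) : poissonTransform (fun _ => r) x = r := by
  rw [poissonTransform, tsum_mul_left]
  have : ∑' n : ℕ, x ^ n / n ! = Real.exp x := by
    rw [Real.exp_eq_exp_ℝ, NormedSpace.exp_eq_tsum_div]
  rw [this, mul_comm r, ← mul_assoc, ← Real.exp_add]
  simp

end PoissonTransform

section PoissonModel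

variable {A : Type*} [MeasurableSpace A] {p : PMF A}

/-- The conditional mean of `F` given that there are `n` strings. -/
noncomputable def condMean (p : PMF A) (F : ℕ × (ℕ → ℕ → A) → ℝ) (n : ℕ) : ℝ :=
  ∫ Ξ, F (n, Ξ) ∂(stringsLaw p)

lemma integral_model {F : ℕ × (ℕ → ℕ → A) → ℝ} {l : ℝ} (hl : 0 ≤ l)
    (hF : Integrable F (model p l)) :
    ∫ ω, F ω ∂(model p l) = poissonTransform (condMean p F) l := by
  rw [model, integral_prod _ hF, integral_poissonMeasure, poissonTransform, ← tsum_mul_left]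
  refine tsum_congr fun n => ?_
  rw [Real.coe_toNNReal l hl, smul_eq_mul, condMean]
  ring

lemma entireSeq_condMean {F : ℕ × (ℕ → ℕ → A) → ℝ}
    (hF : ∀ l, 0 < l → Integrable F (model p l)) : EntireSeq (condMean p F) := by
  intro l hl
  have h := integrable_poissonMeasure_iff.1 (hF l hl).integral_prod_left
  refine (h.mul_left (Real.exp l)).congr fun n => ?_
  rw [Real.coe_toNNReal l hl.le, Real.norm_eq_abs, Real.exp_neg]
  have := Real.exp_ne_zero l
  field_simp
  rfl

lemma model_le_smul (p : PMF A) {l l' : ℝ} (hl : 0 ≤ l) (hl' : l ≤ l') :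
    model p l ≤ ENNReal.ofReal (Real.exp (l' - l)) • model p l' := by
  refine Measure.le_iff.2 fun s hs => ?_
  rw [Measure.smul_apply, model_apply p hs, model_apply p hs, smul_eq_mul, ← ENNReal.tsum_mul_left]
  refine ENNReal.tsum_le_tsum fun n => ?_
  rw [mul_left_comm]
  gcongr
  rw [poissonMeasure_singleton, poissonMeasure_singleton, ← ENNReal.ofReal_mul (by positivity)]
  refine ENNReal.ofReal_le_ofReal ?_
  rw [Real.coe_toNNReal l hl, Real.coe_toNNReal l' (hl.trans hl'), ← mul_div_assoc, ← mul_assoc,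
    ← Real.exp_add]
  have : l' - l + -l' = -l := by ring
  rw [this]
  gcongr

lemma memLp_numStrings (p : PMF A) {l : ℝ} (hl : 0 < l) : MemLp numStrings 2 (model p l) := by
  have h : MemLp (fun n : ℕ => (n : ℝ)) 2 (poissonMeasure l.toNNReal) := by
    rw [memLp_two_iff_integrable_sq (measurable_of_countable _).aestronglyMeasurable,
      integrable_poissonMeasure_iff]
    refine (((entireSeq_const 1).mul_cast.mul_cast l hl).mul_left (Real.exp (-l))).congr fun n => ?_
    rw [Real.coe_toNNReal l hl.le, Real.norm_of_nonneg (by positivity), abs_of_nonneg (by positivity)]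
    ring
  exact h.comp_measurePreserving measurePreserving_fst

lemma condMean_mul_numStrings (F : ℕ × (ℕ → ℕ → A) → ℝ) :
    condMean p (fun ω => F ω * numStrings ω) = fun n => n * condMean p F n := by
  ext n
  simp only [condMean, numStrings]
  rw [integral_mul_const, mul_comm]

lemma condMean_numStrings : condMean p numStrings = fun n : ℕ => (n : ℝ) * 1 := by
  ext n
  simp [condMean, numStrings]

/-- The covariance with a Poisson variable is given by the derivative of the mean. -/
lemma covariance_numStrings {F : ℕ × (ℕ → ℕ → A) → ℝ}
    (hF : ∀ l, 0 < l → MemLp F 2 (model p l)) {l : ℝ} (hl : 0 < l) :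
    covariance F numStrings (model p l) =
      l * poissonTransform (fun n => condMean p F (n + 1) - condMean p F n) l := by
  have hN := memLp_numStrings p hl
  have he : EntireSeq (condMean p F) :=
    entireSeq_condMean fun l hl => (hF l hl).integrable one_le_two
  rw [covariance_eq_sub (hF l hl) hN, integral_model hl.le ((hF l hl).integrable_mul hN),
    integral_model hl.le ((hF l hl).integrable one_le_two),
    integral_model hl.le (hN.integrable one_le_two), condMean_numStrings,
    (entireSeq_const 1).poissonTransform_mul_cast, poissonTransform_const]
  have := condMean_mul_numStrings (p := p) F
  rw [show F * numStrings = fun ω => F ω * numStrings ω from rfl, this,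
    he.poissonTransform_mul_cast, he.poissonTransform_diff]
  ring

lemma variance_numStrings (p : PMF A) {l : ℝ} (hl : 0 < l) :
    variance numStrings (model p l) = l := by
  rw [← covariance_self (memLp_numStrings p hl).aemeasurable,
    covariance_numStrings (fun l hl => memLp_numStrings p hl) hl, condMean_numStrings]
  have : (fun n : ℕ => ((n + 1 : ℕ) : ℝ) * 1 - (n : ℝ) * 1) = fun _ => 1 := by
    ext n; push_cast; ring
  rw [this, poissonTransform_const, mul_one]

end PoissonModel
end RandomTrie

namespace RandomTrie
open Filter Topology MeasureTheory ProbabilityTheory Asymptotics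

/-! ### Moments of functionals of the random trie -/

section TrieMean

variable {A : Type*} [MeasurableSpace A] {p : PMF A}
  {g h : Finset (List A) → ℝ}

/-- The mean of a functional of the trie of `n` random strings. -/
noncomputable def trieMean (p : PMF A) (h : Finset (List A) → ℝ) : ℕ → ℝ :=
  condMean p fun ω => h (randomTrie ω)

lemma trieMean_zero (p : PMF A) (h : Finset (List A) → ℝ) : trieMean p h 0 = h ∅ := by
  have : ∀ Ξ : ℕ → ℕ → A, trie Ξ 0 = ∅ := fun Ξ => trieOn_of_card_eq_zero Ξ (by simp)
  simp [trieMean, condMean, randomTrie, this]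

lemma trieMean_one (p : PMF A) (h : Finset (List A) → ℝ) : trieMean p h 1 = h (bullet A) := by
  have : ∀ Ξ : ℕ → ℕ → A, trie Ξ 1 = bullet A := fun Ξ => trieOn_of_card_eq_one Ξ (by simp)
  simp [trieMean, condMean, randomTrie, this]

lemma HasSecondMoment.integrable {l : ℝ} (hh : HasSecondMoment p h l) :
    Integrable (fun ω => h (randomTrie ω)) (model p l) :=
  MemLp.integrable one_le_two hh

lemma HasSecondMoment.integrable_mul {l : ℝ} (hg : HasSecondMoment p g l)
    (hh : HasSecondMoment p h l) :
    Integrable (fun ω => (g * h) (randomTrie ω)) (model p l) :=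
  MemLp.integrable_mul hg hh

lemma entireSeq_trieMean (hh : ∀ l, 0 < l → HasSecondMoment p h l) : EntireSeq (trieMean p h) :=
  entireSeq_condMean fun l hl => (hh l hl).integrable

lemma entireSeq_trieMean_mul (hg : ∀ l, 0 < l → HasSecondMoment p g l)
    (hh : ∀ l, 0 < l → HasSecondMoment p h l) : EntireSeq (trieMean p (g * h)) :=
  entireSeq_condMean fun l hl => (hg l hl).integrable_mul (hh l hl)

lemma meanOf_eq {l : ℝ} (hl : 0 < l) (hh : HasSecondMoment p h l) :
    meanOf p h l = poissonTransform (trieMean p h) l :=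
  integral_model hl.le hh.integrable

lemma covOf_eq_sub {l : ℝ} (hg : HasSecondMoment p g l) (hh : HasSecondMoment p h l) :
    covOf p g h l = meanOf p (g * h) l - meanOf p g l * meanOf p h l :=
  covariance_eq_sub hg hh

lemma covOf_eq {l : ℝ} (hl : 0 < l) (hg : HasSecondMoment p g l) (hh : HasSecondMoment p h l) :
    covOf p g h l = poissonTransform (trieMean p (g * h)) l -
      poissonTransform (trieMean p g) l * poissonTransform (trieMean p h) l := by
  rw [covOf_eq_sub hg hh, meanOf_eq hl hg, meanOf_eq hl hh]
  congr 1
  exact integral_model hl.le (hg.integrable_mul hh)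

lemma covOf_self [Fintype A] [DiscreteMeasurableSpace A] (p : PMF A) (h : Finset (List A) → ℝ) (l : ℝ) :
    covOf p h h l = varOf p h l :=
  covariance_self (measurable_toll h).aemeasurable

lemma varOf_eq [Fintype A] [DiscreteMeasurableSpace A] {l : ℝ} (hl : 0 < l) (hh : HasSecondMoment p h l) :
    varOf p h l =
      poissonTransform (trieMean p (h * h)) l - poissonTransform (trieMean p h) l ^ 2 := by
  rw [← covOf_self, covOf_eq hl hh hh, sq]

lemma varOf_nonneg (p : PMF A) (h : Finset (List A) → ℝ) (l : ℝ) : 0 ≤ varOf p h l :=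
  variance_nonneg _ _

lemma covNumOf_eq (hh : ∀ l, 0 < l → HasSecondMoment p h l) {l : ℝ} (hl : 0 < l) :
    covNumOf p h l = l * poissonTransform (fun n => trieMean p h (n + 1) - trieMean p h n) l :=
  covariance_numStrings hh hl

lemma abs_covOf_le {l : ℝ} (hg : HasSecondMoment p g l) (hh : HasSecondMoment p h l) :
    |covOf p g h l| ≤ √(varOf p g l) * √(varOf p h l) :=
  abs_covariance_le_sqrt hg hh

lemma abs_covNumOf_le {l : ℝ} (hl : 0 < l) (hh : HasSecondMoment p h l) :
    |covNumOf p h l| ≤ √(varOf p h l) * √l := by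
  have := abs_covariance_le_sqrt hh (memLp_numStrings p hl)
  rwa [variance_numStrings p hl] at this

lemma HasSecondMoment.mono {l l' : ℝ} (hl : 0 ≤ l) (hll' : l ≤ l') (hh : HasSecondMoment p h l') :
    HasSecondMoment p h l :=
  MemLp.of_measure_le_smul ENNReal.ofReal_ne_top (model_le_smul p hl hll') hh

lemma hasSecondMoment_of_eventually (hfin : ∀ᶠ l in atTop, HasSecondMoment p h l) {l : ℝ}
    (hl : 0 < l) : HasSecondMoment p h l := by
  obtain ⟨l', h1, h2⟩ := (hfin.and (eventually_ge_atTop l)).exists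
  exact h1.mono hl.le h2

end TrieMean

section Bullet

open scoped Classical in
/-- The indicator of `•`. -/
noncomputable def bulletIndicator (A : Type*) (T : Finset (List A)) : ℝ :=
  if T = bullet A then 1 else 0

lemma reducedToll_eq {A : Type*} (h : Finset (List A) → ℝ) :
    reducedToll h = fun T => h T - h (bullet A) * bulletIndicator A T := by
  ext T
  rw [reducedToll, bulletIndicator]
  split_ifs <;> simp

lemma reducedToll_empty {A : Type*} {h : Finset (List A) → ℝ} (hh : h ∅ = 0) :
    reducedToll h ∅ = 0 := by
  have : ∅ ≠ bullet A := (Finset.singleton_ne_empty _).symm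
  rw [reducedToll, if_neg this, hh, sub_zero]

lemma reducedToll_bullet {A : Type*} (h : Finset (List A) → ℝ) : reducedToll h (bullet A) = 0 := by
  rw [reducedToll, if_pos rfl, sub_self]

lemma additive_bullet {A : Type*} (h : Finset (List A) → ℝ) :
    additive h (bullet A) = h (bullet A) := by
  rw [← additiveBelow_top, additiveBelow_bullet (by simp)]

lemma mul_bulletIndicator {A : Type*} (h : Finset (List A) → ℝ) (T : Finset (List A)) :
    h T * bulletIndicator A T = h (bullet A) * bulletIndicator A T := by
  rw [bulletIndicator]
  split_ifs with hT
  · rw [hT]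
  · simp

variable {A : Type*} [Fintype A] [MeasurableSpace A] [DiscreteMeasurableSpace A] {p : PMF A}
  {h : Finset (List A) → ℝ}

lemma hasSecondMoment_bulletIndicator (p : PMF A) (l : ℝ) :
    HasSecondMoment p (bulletIndicator A) l := by
  refine MemLp.of_bound (measurable_toll _).aestronglyMeasurable 1 (Eventually.of_forall fun ω => ?_)
  rw [bulletIndicator]
  split_ifs <;> simp

lemma poissonTransform_indicator (k : ℕ) (x : ℝ) :
    poissonTransform (fun n => if n = k then 1 else 0) x =
      Real.exp (-x) * (x ^ k / k.factorial) := by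
  rw [poissonTransform, tsum_eq_single k]
  · simp
  · intro n hn; simp [hn]

lemma trieMean_bulletIndicator [Nontrivial A] (hp : ∀ a, p a ≠ 0) :
    trieMean p (bulletIndicator A) = fun n => if n = 1 then 1 else 0 := by
  ext n
  rcases Nat.lt_or_ge n 2 with hn | hn
  · interval_cases n
    · rw [trieMean_zero, bulletIndicator, if_neg, if_neg (by norm_num)]
      exact (Finset.singleton_ne_empty _).symm
    · rw [trieMean_one, bulletIndicator, if_pos rfl, if_pos rfl]
  · rw [if_neg (by omega), trieMean, condMean, ← integral_zero (ℕ → ℕ → A) ℝ]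
    refine integral_congr_ae ?_
    filter_upwards [ae_injective_strings hp] with Ξ hΞ
    exact if_neg (trieOn_ne_bullet hΞ.injOn (by simpa using hn))

lemma meanOf_bulletIndicator [Nontrivial A] (hp : ∀ a, p a ≠ 0) {l : ℝ} (hl : 0 < l) :
    meanOf p (bulletIndicator A) l = l * Real.exp (-l) := by
  rw [meanOf_eq hl (hasSecondMoment_bulletIndicator p l), trieMean_bulletIndicator hp,
    poissonTransform_indicator]
  simp [mul_comm]

lemma covOf_bulletIndicator [Nontrivial A] (hp : ∀ a, p a ≠ 0) {l : ℝ} (hl : 0 < l)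
    (hh : HasSecondMoment p h l) :
    covOf p h (bulletIndicator A) l = (h (bullet A) - meanOf p h l) * (l * Real.exp (-l)) := by
  rw [covOf_eq_sub hh (hasSecondMoment_bulletIndicator p l), meanOf_bulletIndicator hp hl, sub_mul]
  congr 1
  simp only [meanOf, Pi.mul_apply, mul_bulletIndicator]
  rw [integral_const_mul, ← meanOf_bulletIndicator hp hl]
  rfl

lemma covNumOf_bulletIndicator [Nontrivial A] (hp : ∀ a, p a ≠ 0) {l : ℝ} (hl : 0 < l) :
    covNumOf p (bulletIndicator A) l = -(l * (l - 1) * Real.exp (-l)) := by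
  have he := entireSeq_trieMean fun l _ => hasSecondMoment_bulletIndicator p l
  rw [covNumOf_eq (fun l _ => hasSecondMoment_bulletIndicator p l) hl, he.poissonTransform_diff,
    trieMean_bulletIndicator hp, poissonTransform_indicator]
  have : (fun n : ℕ => if n + 1 = 1 then (1 : ℝ) else 0) = fun n => if n = 0 then 1 else 0 := by
    ext n; simp
  rw [this, poissonTransform_indicator]
  simp
  ring

lemma HasSecondMoment.reducedToll {l : ℝ} (hh : HasSecondMoment p h l) :
    HasSecondMoment p (reducedToll h) l := by
  rw [reducedToll_eq]
  exact MemLp.sub hh ((hasSecondMoment_bulletIndicator p l).const_mul _)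

lemma meanOf_reducedToll [Nontrivial A] (hp : ∀ a, p a ≠ 0) {l : ℝ} (hl : 0 < l)
    (hh : HasSecondMoment p h l) : meanOf p (reducedToll h) l = fE p h l := by
  have hI := (hasSecondMoment_bulletIndicator p l).integrable
  rw [reducedToll_eq, meanOf, integral_sub hh.integrable (hI.const_mul _), integral_const_mul, fE,
    mul_assoc, ← meanOf_bulletIndicator hp hl]
  rfl

lemma covNumOf_reducedToll [Nontrivial A] (hp : ∀ a, p a ≠ 0) {l : ℝ} (hl : 0 < l)
    (hh : HasSecondMoment p h l) : covNumOf p (reducedToll h) l = fC p h l := by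
  have hI := hasSecondMoment_bulletIndicator p l
  rw [reducedToll_eq, covNumOf, covariance_fun_sub_left hh (hI.const_mul _)
    (memLp_numStrings p hl), covariance_const_mul_left, fC]
  have := covNumOf_bulletIndicator hp hl
  rw [covNumOf] at this
  rw [this, covNumOf]
  ring

lemma covOf_reducedToll_left [Nontrivial A] (hp : ∀ a, p a ≠ 0) {l : ℝ} (hl : 0 < l)
    {g : Finset (List A) → ℝ} (hg : HasSecondMoment p g l) (hh : HasSecondMoment p h l) :
    covOf p (reducedToll h) g l = covOf p h g l -
      h (bullet A) * ((g (bullet A) - meanOf p g l) * (l * Real.exp (-l))) := by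
  have hI := hasSecondMoment_bulletIndicator p l
  rw [reducedToll_eq, covOf, covariance_fun_sub_left hh (hI.const_mul _) hg,
    covariance_const_mul_left, ← covOf_bulletIndicator hp hl hg, covOf, covOf,
    covariance_comm fun ω => bulletIndicator A (randomTrie ω)]

lemma varOf_reducedToll [Nontrivial A] (hp : ∀ a, p a ≠ 0) {l : ℝ} (hl : 0 < l)
    (hh : HasSecondMoment p h l) :
    varOf p (reducedToll h) l = varOf p h l
      - 2 * h (bullet A) * ((h (bullet A) - meanOf p h l) * (l * Real.exp (-l)))
      + h (bullet A) ^ 2 * (l * Real.exp (-l) * (1 - l * Real.exp (-l))) := by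
  have hc : covOf p h (reducedToll h) l = covOf p (reducedToll h) h l := covariance_comm _ _
  rw [← covOf_self, covOf_reducedToll_left hp hl hh.reducedToll hh, reducedToll_bullet, hc,
    covOf_reducedToll_left hp hl hh hh, meanOf_reducedToll hp hl hh, fE, covOf_self]
  ring

lemma fV_eq [Nontrivial A] (hp : ∀ a, p a ≠ 0) {l : ℝ} (hl : 0 < l)
    (hh : HasSecondMoment p h l) (hΦ : HasSecondMoment p (additive h) l) :
    fV p h l = 2 * covOf p (reducedToll h) (additive h) l - varOf p (reducedToll h) l := by
  rw [covOf_reducedToll_left hp hl hΦ hh, varOf_reducedToll hp hl hh, fV, additive_bullet]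
  ring

end Bullet
end RandomTrie

namespace RandomTrie
open Filter Topology MeasureTheory ProbabilityTheory Asymptotics

/-! ### Recursions, and second moments of additive functionals -/

/-- Bounded super-solutions of the inequality `C e^{-δ|t|} + S (t - x) ≤ S t`. -/
lemma exists_superSolution {δ x₀ : ℝ} (hδ : 0 < δ) (hx₀ : 0 < x₀) {C : ℝ} (hC : 0 ≤ C) (K : ℝ) :
    ∃ (S : ℝ → ℝ) (M : ℝ), (∀ t, K ≤ S t) ∧ (∀ t, S t ≤ M) ∧
      ∀ t x, x₀ ≤ x → C * Real.exp (-(δ * |t|)) + S (t - x) ≤ S t := by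
  obtain ⟨c, hc, hb⟩ := exists_barrier_sub hδ hx₀
  have hCc : 0 ≤ C / c := by positivity
  refine ⟨fun t => K + C / c * barrier δ t, K + C / c * 2, fun t => ?_, fun t => ?_,
    fun t x hx => ?_⟩
  · have := mul_nonneg hCc (barrier_nonneg hδ t)
    linarith
  · have := mul_le_mul_of_nonneg_left (barrier_le_two hδ t) hCc
    linarith
  · have h := mul_le_mul_of_nonneg_left (hb t x hx) hCc
    have h2 : C / c * (c * Real.exp (-(δ * |t|))) = C * Real.exp (-(δ * |t|)) := by
      field_simp
    rw [h2] at h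
    linarith

section Letters

variable {A : Type*} {p : PMF A} {l C δ : ℝ}

lemma mul_toReal_pos (hp : ∀ a, p a ≠ 0) (hl : 0 < l) (a : A) : 0 < l * (p a).toReal :=
  mul_pos hl (toReal_pos hp a)

lemma log_mul_toReal (hp : ∀ a, p a ≠ 0) (hl : 0 < l) (a : A) :
    Real.log (l * (p a).toReal) = Real.log l - -Real.log (p a).toReal := by
  rw [Real.log_mul hl.ne' (toReal_pos hp a).ne']
  ring

lemma sum_mul_toReal [Fintype A] (p : PMF A) (l B : ℝ) : ∑ a, l * (p a).toReal * B = l * B := by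
  rw [← Finset.sum_mul, ← Finset.mul_sum, sum_toReal, mul_one]

lemma tendsto_additiveBelow (φ : Finset (List A) → ℝ) (T : Finset (List A)) :
    Tendsto (fun k : ℕ => additiveBelow (k + 1 : ℕ) φ T) atTop (𝓝 (additive φ T)) := by
  refine tendsto_const_nhds.congr' ?_
  filter_upwards [eventually_ge_atTop (T.sup List.length)] with k hk
  refine Finset.sum_congr rfl fun v hv => ?_
  rw [if_pos]
  have := (Finset.le_sup (f := List.length) hv).trans hk
  exact_mod_cast Nat.lt_succ_of_le this

lemma exists_superSolution_letters [Fintype A] [Nontrivial A] (hp : ∀ a, p a ≠ 0) (hδ : 0 < δ) (hC : 0 ≤ C) (K : ℝ) :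
    ∃ (S : ℝ → ℝ) (M : ℝ), (∀ t, K ≤ S t) ∧ (∀ t, S t ≤ M) ∧
      ∀ (a : A) t, C * Real.exp (-(δ * |t|)) + S (t - -Real.log (p a).toReal) ≤ S t := by
  obtain ⟨x₀, hx₀, hx⟩ := exists_le_neg_log hp
  obtain ⟨S, M, h1, h2, h3⟩ := exists_superSolution hδ hx₀ hC K
  exact ⟨S, M, h1, h2, fun a t => h3 t _ (hx a)⟩

lemma mul_exp_neg_le (l : ℝ) : l * Real.exp (-l) ≤ 1 := by
  have h1 := Real.add_one_le_exp l
  rw [Real.exp_neg, ← div_eq_mul_inv, div_le_one (Real.exp_pos _)]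
  linarith

lemma exp_neg_mul_abs_le_one (hδ : 0 < δ) (t : ℝ) : Real.exp (-(δ * |t|)) ≤ 1 := by
  rw [Real.exp_le_one_iff, neg_nonpos]
  positivity

end Letters

section Decay

variable {A : Type*} [MeasurableSpace A] {p : PMF A} {φ : Finset (List A) → ℝ} {l C δ : ℝ}

/-- Exponential decay, on a logarithmic scale, of the mean and the variance of the toll. -/
structure TollDecay (p : PMF A) (φ : Finset (List A) → ℝ) (C δ : ℝ) : Prop where
  pos : 0 < δ
  nonneg : 0 ≤ C
  mean : ∀ l, 0 < l → |fE p φ l| ≤ l * (C * Real.exp (-(δ * |Real.log l|)))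
  sqrt_var : ∀ l, 0 < l →
    √(varOf p (reducedToll φ) l) ≤ √l * (C * Real.exp (-(δ * |Real.log l|)))

lemma abs_meanOf_le (hd : TollDecay p φ C δ) (hl : 0 < l) :
    |meanOf p φ l| ≤ l * (C + |φ (bullet A)|) := by
  have h1 : meanOf p φ l = fE p φ l + φ (bullet A) * l * Real.exp (-l) := by rw [fE]; ring
  have he : Real.exp (-l) ≤ 1 := by rw [Real.exp_le_one_iff]; linarith
  rw [h1]
  calc _ ≤ |fE p φ l| + |φ (bullet A) * l * Real.exp (-l)| := abs_add_le _ _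
    _ ≤ l * (C * 1) + |φ (bullet A)| * l * 1 := by
        refine add_le_add ((hd.mean l hl).trans ?_) ?_
        · have := hd.nonneg
          have := exp_neg_mul_abs_le_one hd.pos (Real.log l)
          gcongr
        · rw [abs_mul, abs_mul, abs_of_pos hl, Real.abs_exp]
          gcongr
    _ = _ := by ring

end Decay

section Recursion

variable {A : Type*} [Fintype A] [MeasurableSpace A] [DiscreteMeasurableSpace A]
  {p : PMF A} {φ : Finset (List A) → ℝ} {k : ℕ∞} {l : ℝ}

lemma memLp_sum_branches (hp : ∀ a, p a ≠ 0) (hl : 0 < l) {h : Finset (List A) → ℝ}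
    (hh : ∀ l, 0 < l → HasSecondMoment p h l) :
    MemLp (fun ω => ∑ a, h (branches ω a)) 2 (model p l) :=
  memLp_finsetSum _ fun a _ => memLp_branch hl.le a (hh _ (mul_toReal_pos hp hl a))

variable [Nontrivial A]

lemma hasSecondMoment_additiveBelow_succ (hp : ∀ a, p a ≠ 0) (hφ : φ ∅ = 0) (hk : 1 ≤ k)
    (h2 : ∀ l, 0 < l → HasSecondMoment p φ l)
    (hh : ∀ l, 0 < l → HasSecondMoment p (additiveBelow k φ) l) (hl : 0 < l) :
    HasSecondMoment p (additiveBelow (k + 1) φ) l :=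
  ((h2 l hl).reducedToll.add (memLp_sum_branches hp hl hh)).ae_eq (ae_additiveBelow hp hφ hk l).symm

lemma meanOf_additiveBelow_succ (hp : ∀ a, p a ≠ 0) (hφ : φ ∅ = 0) (hk : 1 ≤ k)
    (h2 : ∀ l, 0 < l → HasSecondMoment p φ l)
    (hh : ∀ l, 0 < l → HasSecondMoment p (additiveBelow k φ) l) (hl : 0 < l) :
    meanOf p (additiveBelow (k + 1) φ) l =
      fE p φ l + ∑ a, meanOf p (additiveBelow k φ) (l * (p a).toReal) := by
  rw [meanOf, integral_congr_ae (ae_additiveBelow hp hφ hk l),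
    integral_add (h2 l hl).reducedToll.integrable
      ((memLp_sum_branches hp hl hh).integrable one_le_two), integral_finsetSum,
    ← meanOf_reducedToll hp hl (h2 l hl)]
  · congr 1
    exact Finset.sum_congr rfl fun a _ => integral_branch hl.le a _
  · exact fun a _ => (memLp_branch hl.le a (hh _ (mul_toReal_pos hp hl a))).integrable one_le_two

lemma sqrt_varOf_additiveBelow_succ_le (hp : ∀ a, p a ≠ 0) (hφ : φ ∅ = 0) (hk : 1 ≤ k)
    (h2 : ∀ l, 0 < l → HasSecondMoment p φ l)
    (hh : ∀ l, 0 < l → HasSecondMoment p (additiveBelow k φ) l) (hl : 0 < l) :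
    √(varOf p (additiveBelow (k + 1) φ) l) ≤ √(varOf p (reducedToll φ) l) +
      √(∑ a, varOf p (additiveBelow k φ) (l * (p a).toReal)) := by
  rw [varOf, variance_congr (ae_additiveBelow hp hφ hk l),
    ← variance_sum_branches hl.le fun a => hh _ (mul_toReal_pos hp hl a)]
  exact sqrt_variance_add_le (h2 l hl).reducedToll (memLp_sum_branches hp hl hh)

lemma varOf_additive (hp : ∀ a, p a ≠ 0) (hφ : φ ∅ = 0)
    (h2 : ∀ l, 0 < l → HasSecondMoment p φ l)
    (hh : ∀ l, 0 < l → HasSecondMoment p (additive φ) l) (hl : 0 < l) :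
    varOf p (additive φ) l = fV p φ l + ∑ a, varOf p (additive φ) (l * (p a).toReal) := by
  have h := ae_additiveBelow hp hφ (k := ⊤) (by simp) l
  rw [top_add, additiveBelow_top] at h
  have h' : (fun ω => ∑ a, additive φ (branches ω a)) =ᵐ[model p l]
      fun ω => additive φ (randomTrie ω) - reducedToll φ (randomTrie ω) := by
    filter_upwards [h] with ω hω
    rw [hω]; ring
  rw [← variance_sum_branches hl.le fun a => hh _ (mul_toReal_pos hp hl a), variance_congr h',
    variance_fun_sub (hh l hl) (h2 l hl).reducedToll, fV_eq hp hl (h2 l hl) (hh l hl), covOf,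
    covariance_comm, varOf, varOf]
  ring

lemma additiveBelow_one_ae (hp : ∀ a, p a ≠ 0) (hφ : φ ∅ = 0) (l : ℝ) :
    (fun ω => additiveBelow 1 φ (randomTrie ω)) =ᵐ[model p l] fun ω => φ (randomTrie ω) := by
  filter_upwards [ae_injective hp l] with ω hω
  refine additiveBelow_one hφ fun hne => ?_
  refine nil_mem_trieOn hω.injOn ?_
  by_contra h
  have : randomTrie ω = ∅ := trieOn_of_card_eq_zero ω.2 (by omega)
  rw [this] at hne
  exact Finset.not_nonempty_empty hne

lemma hasSecondMoment_additiveBelow (hp : ∀ a, p a ≠ 0) (hφ : φ ∅ = 0)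
    (h2 : ∀ l, 0 < l → HasSecondMoment p φ l) (k : ℕ) :
    ∀ l, 0 < l → HasSecondMoment p (additiveBelow (k + 1 : ℕ) φ) l := by
  induction k with
  | zero => exact fun l hl => (h2 l hl).ae_eq (by
      simpa using (additiveBelow_one_ae hp hφ l).symm)
  | succ k ih =>
    intro l hl
    have := hasSecondMoment_additiveBelow_succ hp hφ (k := (k + 1 : ℕ)) (by simp) h2 ih hl
    exact_mod_cast this

variable {C δ : ℝ}

lemma abs_meanOf_step (hp : ∀ a, p a ≠ 0) (hφ : φ ∅ = 0) (hk : 1 ≤ k)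
    (h2 : ∀ l, 0 < l → HasSecondMoment p φ l)
    (hh : ∀ l, 0 < l → HasSecondMoment p (additiveBelow k φ) l) (hd : TollDecay p φ C δ)
    {S : ℝ → ℝ} (hS : ∀ a t, C * Real.exp (-(δ * |t|)) + S (t - -Real.log (p a).toReal) ≤ S t)
    (hl : 0 < l) (ih : ∀ a, |meanOf p (additiveBelow k φ) (l * (p a).toReal)| ≤
      l * (p a).toReal * S (Real.log (l * (p a).toReal))) :
    |meanOf p (additiveBelow (k + 1) φ) l| ≤ l * S (Real.log l) := by
  rw [meanOf_additiveBelow_succ hp hφ hk h2 hh hl]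
  have h1 : ∀ a, |meanOf p (additiveBelow k φ) (l * (p a).toReal)| ≤
      l * (p a).toReal * (S (Real.log l) - C * Real.exp (-(δ * |Real.log l|))) := fun a => by
    refine (ih a).trans (mul_le_mul_of_nonneg_left ?_ (mul_toReal_pos hp hl a).le)
    rw [log_mul_toReal hp hl]
    linarith [hS a (Real.log l)]
  calc |fE p φ l + ∑ a, meanOf p (additiveBelow k φ) (l * (p a).toReal)|
      ≤ |fE p φ l| + ∑ a, |meanOf p (additiveBelow k φ) (l * (p a).toReal)| :=
        (abs_add_le _ _).trans (add_le_add_right (Finset.abs_sum_le_sum_abs _ _) _)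
    _ ≤ l * (C * Real.exp (-(δ * |Real.log l|))) + ∑ a, l * (p a).toReal *
          (S (Real.log l) - C * Real.exp (-(δ * |Real.log l|))) :=
        add_le_add (hd.mean l hl) (Finset.sum_le_sum fun a _ => h1 a)
    _ = l * S (Real.log l) := by rw [sum_mul_toReal]; ring

lemma sqrt_varOf_step (hp : ∀ a, p a ≠ 0) (hφ : φ ∅ = 0) (hk : 1 ≤ k)
    (h2 : ∀ l, 0 < l → HasSecondMoment p φ l)
    (hh : ∀ l, 0 < l → HasSecondMoment p (additiveBelow k φ) l) (hd : TollDecay p φ C δ)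
    {S : ℝ → ℝ} (hS : ∀ a t, C * Real.exp (-(δ * |t|)) + S (t - -Real.log (p a).toReal) ≤ S t)
    (hS0 : ∀ t, 0 ≤ S t)
    (hl : 0 < l) (ih : ∀ a, √(varOf p (additiveBelow k φ) (l * (p a).toReal)) ≤
      √(l * (p a).toReal) * S (Real.log (l * (p a).toReal))) :
    √(varOf p (additiveBelow (k + 1) φ) l) ≤ √l * S (Real.log l) := by
  set B := S (Real.log l) - C * Real.exp (-(δ * |Real.log l|)) with hB
  have hSB : ∀ a, S (Real.log (l * (p a).toReal)) ≤ B := fun a => by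
    rw [log_mul_toReal hp hl]
    linarith [hS a (Real.log l)]
  have hB0 : 0 ≤ B := (hS0 _).trans (hSB (Classical.arbitrary A))
  have h1 : ∀ a, varOf p (additiveBelow k φ) (l * (p a).toReal) ≤ l * (p a).toReal * B ^ 2 := by
    intro a
    have hpos := (mul_toReal_pos hp hl a).le
    have := (ih a).trans (mul_le_mul_of_nonneg_left (hSB a) (Real.sqrt_nonneg _))
    rw [Real.sqrt_le_left (by positivity), mul_pow, Real.sq_sqrt hpos] at this
    exact this
  have h3 : √(∑ a, varOf p (additiveBelow k φ) (l * (p a).toReal)) ≤ √l * B := by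
    rw [Real.sqrt_le_left (by positivity), mul_pow, Real.sq_sqrt hl.le, ← sum_mul_toReal p]
    exact Finset.sum_le_sum fun a _ => h1 a
  calc √(varOf p (additiveBelow (k + 1) φ) l)
      ≤ √l * (C * Real.exp (-(δ * |Real.log l|))) + √l * B :=
        (sqrt_varOf_additiveBelow_succ_le hp hφ hk h2 hh hl).trans
          (add_le_add (hd.sqrt_var l hl) h3)
    _ = √l * S (Real.log l) := by rw [hB]; ring

lemma sqrt_varOf_le (hp : ∀ a, p a ≠ 0) (hd : TollDecay p φ C δ) (hl : 0 < l)
    (h2 : HasSecondMoment p φ l) : √(varOf p φ l) ≤ √l * (C + |φ (bullet A)|) := by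
  have hI := hasSecondMoment_bulletIndicator p l
  have h1 : (fun ω => φ (randomTrie ω)) = fun ω => reducedToll φ (randomTrie ω) +
      φ (bullet A) * bulletIndicator A (randomTrie ω) := by
    ext ω; rw [reducedToll_eq]; ring
  have hvI : varOf p (bulletIndicator A) l ≤ l := by
    rw [← covOf_self, covOf_bulletIndicator hp hl hI, meanOf_bulletIndicator hp hl, bulletIndicator,
      if_pos rfl]
    have h3 := mul_exp_neg_le l
    have he : Real.exp (-l) ≤ 1 := by rw [Real.exp_le_one_iff]; linarith
    have h4 : 0 ≤ l * Real.exp (-l) := by positivity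
    nlinarith
  rw [varOf, h1]
  refine (sqrt_variance_add_le h2.reducedToll (hI.const_mul _)).trans ?_
  rw [variance_const_mul, Real.sqrt_mul (sq_nonneg _), Real.sqrt_sq_eq_abs]
  calc _ ≤ √l * (C * 1) + |φ (bullet A)| * √l := by
        refine add_le_add ((hd.sqrt_var l hl).trans ?_) ?_
        · have := hd.nonneg
          have := exp_neg_mul_abs_le_one hd.pos (Real.log l)
          gcongr
        · gcongr
          exact hvI
    _ = _ := by ring

/-- Linear bounds for the mean and the variance of truncated additive functionals. -/
lemma exists_additiveBelow_le (hp : ∀ a, p a ≠ 0) (hφ : φ ∅ = 0)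
    (h2 : ∀ l, 0 < l → HasSecondMoment p φ l) (hd : TollDecay p φ C δ) :
    ∃ M, 0 ≤ M ∧ ∀ (k : ℕ) (l : ℝ), 0 < l → |meanOf p (additiveBelow (k + 1 : ℕ) φ) l| ≤ l * M ∧
      √(varOf p (additiveBelow (k + 1 : ℕ) φ) l) ≤ √l * M := by
  have hK : 0 ≤ C + |φ (bullet A)| := add_nonneg hd.nonneg (abs_nonneg _)
  obtain ⟨S, M, hS0, hSM, hS⟩ :=
    exists_superSolution_letters hp hd.pos hd.nonneg (C + |φ (bullet A)|)
  have key : ∀ (k : ℕ) (l : ℝ), 0 < l →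
      |meanOf p (additiveBelow (k + 1 : ℕ) φ) l| ≤ l * S (Real.log l) ∧
      √(varOf p (additiveBelow (k + 1 : ℕ) φ) l) ≤ √l * S (Real.log l) := by
    intro k
    induction k with
    | zero =>
      intro l hl
      rw [zero_add, Nat.cast_one, meanOf, varOf, integral_congr_ae (additiveBelow_one_ae hp hφ l),
        variance_congr (additiveBelow_one_ae hp hφ l)]
      exact ⟨(abs_meanOf_le hd hl).trans (mul_le_mul_of_nonneg_left (hS0 _) hl.le),
        (sqrt_varOf_le hp hd hl (h2 l hl)).trans
          (mul_le_mul_of_nonneg_left (hS0 _) (Real.sqrt_nonneg _))⟩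
    | succ k ih =>
      intro l hl
      have hh := hasSecondMoment_additiveBelow hp hφ h2 k
      have e : ((k + 1 + 1 : ℕ) : ℕ∞) = (k + 1 : ℕ) + 1 := by push_cast; rfl
      rw [e]
      exact ⟨abs_meanOf_step hp hφ (by simp) h2 hh hd hS hl fun a =>
          (ih _ (mul_toReal_pos hp hl a)).1,
        sqrt_varOf_step hp hφ (by simp) h2 hh hd hS (fun t => hK.trans (hS0 t)) hl fun a =>
          (ih _ (mul_toReal_pos hp hl a)).2⟩
  refine ⟨M, (hK.trans (hS0 0)).trans (hSM 0), fun k l hl => ?_⟩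
  exact ⟨(key k l hl).1.trans (mul_le_mul_of_nonneg_left (hSM _) hl.le),
    (key k l hl).2.trans (mul_le_mul_of_nonneg_left (hSM _) (Real.sqrt_nonneg _))⟩

/-- A limit of random variables with bounded second moments has a finite second moment. -/
lemma memLp_two_of_tendsto {Ω : Type*} {mΩ : MeasurableSpace Ω} {μ : Measure Ω}
    {X : ℕ → Ω → ℝ} {Y : Ω → ℝ} (hX : ∀ k, MemLp (X k) 2 μ) {B : ℝ}
    (hB : ∀ k, ∫ ω, X k ω ^ 2 ∂μ ≤ B) (hY : AEStronglyMeasurable Y μ)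
    (hlim : ∀ ω, Tendsto (fun k => X k ω) atTop (𝓝 (Y ω))) : MemLp Y 2 μ := by
  refine ⟨hY, lt_of_le_of_lt (Lp.eLpNorm_lim_le_liminf_eLpNorm
    (fun k => (hX k).aestronglyMeasurable) Y (Eventually.of_forall hlim)) ?_⟩
  have h1 : ∀ k, eLpNorm (X k) 2 μ ≤ ENNReal.ofReal (√B) := by
    intro k
    rw [(hX k).eLpNorm_eq_integral_rpow_norm (by norm_num) (by norm_num)]
    refine ENNReal.ofReal_le_ofReal ?_
    simp only [ENNReal.toReal_ofNat, Real.rpow_ofNat, Real.norm_eq_abs, sq_abs]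
    rw [Real.sqrt_eq_rpow, one_div]
    exact Real.rpow_le_rpow (integral_nonneg fun _ => sq_nonneg _) (hB k) (by norm_num)
  refine lt_of_le_of_lt (liminf_le_of_frequently_le' (Frequently.of_forall h1)) ENNReal.ofReal_lt_top

lemma hasSecondMoment_additive (hp : ∀ a, p a ≠ 0) (hφ : φ ∅ = 0)
    (h2 : ∀ l, 0 < l → HasSecondMoment p φ l) (hd : TollDecay p φ C δ) (hl : 0 < l) :
    HasSecondMoment p (additive φ) l := by
  obtain ⟨M, hM0, hM⟩ := exists_additiveBelow_le hp hφ h2 hd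
  refine memLp_two_of_tendsto (B := (√l * M) ^ 2 + (l * M) ^ 2)
    (fun k => hasSecondMoment_additiveBelow hp hφ h2 k l hl) (fun k => ?_)
    (measurable_toll _).aestronglyMeasurable fun ω => tendsto_additiveBelow φ (randomTrie ω)
  have h1 := variance_eq_sub (hasSecondMoment_additiveBelow hp hφ h2 k l hl)
  obtain ⟨h3, h4⟩ := hM k l hl
  rw [Real.sqrt_le_left (by positivity)] at h4
  have h5 := pow_le_pow_left₀ (abs_nonneg _) h3 2
  rw [sq_abs] at h5
  simp only [varOf, meanOf] at h4 h5
  simp only [Pi.pow_def] at h1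
  linarith

/-- The variance of an additive functional grows at most linearly. -/
lemma exists_sqrt_varOf_additive_le (hp : ∀ a, p a ≠ 0) (hφ : φ ∅ = 0)
    (h2 : ∀ l, 0 < l → HasSecondMoment p φ l) (hd : TollDecay p φ C δ) :
    ∃ M, 0 ≤ M ∧ ∀ l, 0 < l → √(varOf p (additive φ) l) ≤ √l * M := by
  have hh : ∀ l, 0 < l → HasSecondMoment p (additive φ) l := fun l hl =>
    hasSecondMoment_additive hp hφ h2 hd hl
  obtain ⟨C', hC'⟩ := (entireSeq_trieMean_mul hh hh).exists_le_pow 1 (by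
    intro n hn
    obtain rfl : n = 0 := by omega
    simp [trieMean_zero, additive])
  have hsmall : ∀ l, 0 < l → l ≤ 1 → varOf p (additive φ) l ≤ l * C' := fun l hl hl1 => by
    rw [varOf_eq hl (hh l hl)]
    have := (le_abs_self _).trans (hC' l hl hl1)
    rw [pow_one] at this
    nlinarith [sq_nonneg (poissonTransform (trieMean p (additive φ)) l)]
  obtain ⟨S, M, hS0, hSM, hS⟩ := exists_superSolution_letters hp hd.pos hd.nonneg (√C')
  obtain ⟨x₀, hx₀, hx⟩ := exists_le_neg_log hp
  have hSnn : ∀ t, 0 ≤ S t := fun t => (Real.sqrt_nonneg _).trans (hS0 t)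
  have key : ∀ t, √(varOf p (additive φ) (Real.exp t)) / √(Real.exp t) ≤ S t := by
    refine le_of_step hx₀ (t₀ := 0) (fun t ht => ?_) fun t ih => ?_
    · have h1 := hsmall _ (Real.exp_pos t) (Real.exp_le_one_iff.2 ht)
      rw [div_le_iff₀ (Real.sqrt_pos.2 (Real.exp_pos t))]
      calc _ ≤ √(Real.exp t * C') := Real.sqrt_le_sqrt h1
        _ = √C' * √(Real.exp t) := by rw [Real.sqrt_mul (Real.exp_pos t).le, mul_comm]
        _ ≤ _ := mul_le_mul_of_nonneg_right (hS0 t) (Real.sqrt_nonneg _)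
    · have := sqrt_varOf_step hp hφ (k := ⊤) (by simp) h2
        (by rwa [additiveBelow_top]) hd hS hSnn (Real.exp_pos t) fun a => by
          have hpos := mul_toReal_pos hp (Real.exp_pos t) a
          have hlog := log_mul_toReal hp (Real.exp_pos t) a
          rw [Real.log_exp] at hlog
          have h1 := ih (Real.log (Real.exp t * (p a).toReal)) (by linarith [hx a])
          rw [Real.exp_log hpos, div_le_iff₀ (Real.sqrt_pos.2 hpos)] at h1
          rw [additiveBelow_top]
          linarith
      rw [top_add, additiveBelow_top, Real.log_exp] at this
      rwa [div_le_iff₀ (Real.sqrt_pos.2 (Real.exp_pos t)), mul_comm]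
  refine ⟨M, (hSnn 0).trans (hSM 0), fun l hl => ?_⟩
  have := (key (Real.log l)).trans (hSM _)
  rwa [Real.exp_log hl, div_le_iff₀ (Real.sqrt_pos.2 hl), mul_comm] at this

end Recursion
end RandomTrie

namespace RandomTrie
open Filter Topology MeasureTheory ProbabilityTheory Asymptotics

/-! ### Asymptotics of the moments of additive functionals -/

lemma isBigO_mul_exp_neg (ε : ℝ) :
    (fun l : ℝ => l * Real.exp (-l)) =O[atTop] fun l : ℝ => l ^ (1 - ε) := by
  have h := (isBigO_refl (fun l : ℝ => l) atTop).mul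
    (isLittleO_exp_neg_mul_rpow_atTop one_pos (-ε)).isBigO
  refine (h.congr_left fun l => by rw [neg_one_mul]).congr' EventuallyEq.rfl ?_
  filter_upwards [eventually_gt_atTop 0] with l hl
  rw [sub_eq_add_neg, Real.rpow_add hl, Real.rpow_one]

lemma exists_le_mul_exp_log {h : ℝ → ℝ} (hc : ContinuousOn h (Set.Ioi 0)) {ε : ℝ}
    (h0 : ∃ C, ∀ x, 0 < x → x ≤ 1 → |h x| ≤ C * x ^ 2)
    (htop : h =O[atTop] fun x : ℝ => x ^ (1 - ε)) :
    ∃ C, 0 ≤ C ∧ ∀ l, 0 < l → |h l| ≤ l * (C * Real.exp (-(min ε 1 * |Real.log l|))) := by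
  obtain ⟨C, hC⟩ := exists_exp_decay hc (b := 1) (ε := ε) (by
    obtain ⟨C, hC⟩ := h0
    refine ⟨C, fun x hx hx1 => (hC x hx hx1).trans_eq ?_⟩
    norm_num) htop
  have hC0 : 0 ≤ C := by simpa using (abs_nonneg _).trans (hC 0)
  refine ⟨C, hC0, fun l hl => ?_⟩
  have := hC (Real.log l)
  rw [one_mul, Real.exp_neg, Real.exp_log hl, abs_mul, abs_of_pos (inv_pos.2 hl),
    inv_mul_le_iff₀ hl] at this
  exact this

lemma abs_logForm_le {f : ℝ → ℝ} {C δ : ℝ}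
    (hf : ∀ l, 0 < l → |f l| ≤ l * (C * Real.exp (-(δ * |Real.log l|)))) (t : ℝ) :
    |logForm f t| ≤ C * Real.exp (-(δ * |t|)) := by
  have := hf _ (Real.exp_pos t)
  rw [Real.log_exp] at this
  rw [logForm, abs_mul, Real.abs_exp, Real.exp_neg, inv_mul_le_iff₀ (Real.exp_pos t)]
  exact this

/-- The renewal theorem for `F + χ l`, where `F` satisfies the recursion with toll `f`. -/
lemma tendsto_div_sub_add_psi {A : Type*} [Fintype A] [Nontrivial A] {p : PMF A} {C δ : ℝ}
    (hp : ∀ a, p a ≠ 0) (hδ : 0 < δ) {f F : ℝ → ℝ} {χ : ℝ}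
    (hf : ContinuousOn f (Set.Ioi 0))
    (hg : ∀ l, 0 < l → |f l| ≤ l * (C * Real.exp (-(δ * |Real.log l|))))
    (hF : ∀ l, 0 < l → F l = f l + ∑ a, F (l * (p a).toReal))
    (hF0 : Tendsto (fun l => F l / l) (𝓝[>] 0) (𝓝 χ)) :
    Tendsto (fun l => F l / l - (χ + 1 / entropy p * psi (period p) f (Real.log l))) atTop
      (𝓝 0) := by
  have h := tendsto_div_sub_psi hp hδ hf (abs_logForm_le hg) (F := fun l => F l - χ * l)
    (fun l hl => by
      rw [hF l hl, Finset.sum_sub_distrib]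
      have : ∑ a, χ * (l * (p a).toReal) = χ * l := by
        rw [← Finset.mul_sum, ← Finset.mul_sum, sum_toReal, mul_one]
      rw [this]; ring) (by
      have := hF0.sub_const χ
      rw [sub_self] at this
      refine this.congr' ?_
      filter_upwards [self_mem_nhdsWithin] with l hl
      have : l ≠ 0 := ne_of_gt hl
      field_simp)
  refine h.congr' ?_
  filter_upwards [eventually_gt_atTop 0] with l hl
  have : l ≠ 0 := hl.ne'
  field_simp
  ring

/-- Absolute convergence of the Fourier series, from a bound on the derivative. -/
lemma fourierSeriesConverges_of_deriv {d : ℝ} (hd : 0 < d) {f f' : ℝ → ℝ} {C δ : ℝ} (hδ : 0 < δ)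
    (hg : ∀ t, |logForm f t| ≤ C * Real.exp (-(δ * |t|))) (hf' : Continuous f')
    (hder : ∀ l, 0 < l → HasDerivAt f (f' l) l) (h0 : ∃ K, ∀ l, 0 < l → l ≤ 1 → |f' l| ≤ K * l)
    {ε₁ : ℝ} (hε₁ : 0 < ε₁) (hO : deriv f =O[atTop] fun l : ℝ => l ^ (-ε₁)) :
    FourierSeriesConverges d f (psi d f) := by
  have hO' : f' =O[atTop] fun l : ℝ => l ^ ((0 : ℝ) - ε₁) := by
    rw [zero_sub]
    refine hO.congr' ?_ EventuallyEq.rfl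
    filter_upwards [eventually_gt_atTop 0] with l hl using (hder l hl).deriv
  obtain ⟨C', hC'⟩ := exists_exp_decay hf'.continuousOn (b := 0) (by simpa using h0) hO'
  have hδ' : 0 < min ε₁ 1 := lt_min hε₁ one_pos
  have hC'0 : 0 ≤ C' := by simpa using (abs_nonneg _).trans (hC' 0)
  have hC0 : 0 ≤ C := by simpa using (abs_nonneg _).trans (hg 0)
  refine fourierSeriesConverges_psi hd (δ := min δ (min ε₁ 1)) (lt_min hδ hδ') hder
    hf'.continuousOn (C := C) (C' := C') (fun t => (hg t).trans ?_) fun t => ?_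
  · gcongr
    exact min_le_left δ _
  · have := hC' t
    rw [zero_mul, neg_zero, Real.exp_zero, one_mul] at this
    refine this.trans (mul_le_mul_of_nonneg_left (Real.exp_le_exp.2 (neg_le_neg ?_)) hC'0)
    exact mul_le_mul_of_nonneg_right (min_le_right _ _) (abs_nonneg _)

section Coefficients

variable {A : Type*} [MeasurableSpace A] {p : PMF A} {φ : Finset (List A) → ℝ}

lemma trieMean_reducedToll_eq_zero (p : PMF A) (hφ : φ ∅ = 0) :
    ∀ n < 2, trieMean p (reducedToll φ) n = 0 := by
  intro n hn
  interval_cases n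
  · rw [trieMean_zero, reducedToll_empty hφ]
  · rw [trieMean_one, reducedToll_bullet]

lemma trieMean_reducedToll_mul_eq_zero (p : PMF A) (hφ : φ ∅ = 0) (g : Finset (List A) → ℝ) :
    ∀ n < 2, trieMean p (reducedToll φ * g) n = 0 := by
  intro n hn
  interval_cases n
  · rw [trieMean_zero, Pi.mul_apply, reducedToll_empty hφ, zero_mul]
  · rw [trieMean_one, Pi.mul_apply, reducedToll_bullet, zero_mul]

lemma tendsto_meanOf_additive_div (hΦ : ∀ l, 0 < l → HasSecondMoment p (additive φ) l) :
    Tendsto (fun l => meanOf p (additive φ) l / l) (𝓝[>] 0) (𝓝 (φ (bullet A))) := by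
  have h := (entireSeq_trieMean hΦ).tendsto_div (by rw [trieMean_zero]; simp [additive])
  rw [trieMean_one, additive_bullet] at h
  refine h.congr' ?_
  filter_upwards [self_mem_nhdsWithin] with l hl
  rw [meanOf_eq hl (hΦ l hl)]

lemma tendsto_covNumOf_additive_div (hΦ : ∀ l, 0 < l → HasSecondMoment p (additive φ) l) :
    Tendsto (fun l => covNumOf p (additive φ) l / l) (𝓝[>] 0) (𝓝 (φ (bullet A))) := by
  have h := ((entireSeq_trieMean hΦ).diff.continuous.tendsto 0).mono_left
      (nhdsWithin_le_nhds (s := Set.Ioi 0))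
  rw [poissonTransform_zero, zero_add, trieMean_zero, trieMean_one, additive_bullet] at h
  have e : additive φ ∅ = 0 := by simp [additive]
  rw [e, sub_zero] at h
  refine h.congr' ?_
  filter_upwards [self_mem_nhdsWithin] with l hl
  have : l ≠ 0 := ne_of_gt hl
  rw [covNumOf_eq hΦ hl]
  field_simp

lemma tendsto_varOf_additive_div [Fintype A] [DiscreteMeasurableSpace A]
    (hΦ : ∀ l, 0 < l → HasSecondMoment p (additive φ) l) :
    Tendsto (fun l => varOf p (additive φ) l / l) (𝓝[>] 0) (𝓝 (φ (bullet A) ^ 2)) := by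
  have h0 : trieMean p (additive φ) 0 = 0 := by rw [trieMean_zero]; simp [additive]
  have h := (entireSeq_trieMean_mul hΦ hΦ).tendsto_div (by rw [trieMean_zero]; simp [additive])
  have h' := (entireSeq_trieMean hΦ).tendsto_div h0
  have h3 : Tendsto (poissonTransform (trieMean p (additive φ))) (𝓝[>] 0) (𝓝 0) := by
    have := ((entireSeq_trieMean hΦ).continuous.tendsto 0).mono_left
      (nhdsWithin_le_nhds (s := Set.Ioi 0))
    rwa [poissonTransform_zero, h0] at this
  have h4 := h.sub (h'.mul h3)
  rw [trieMean_one, Pi.mul_apply, additive_bullet, mul_zero, sub_zero] at h4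
  rw [sq]
  refine h4.congr' ?_
  filter_upwards [self_mem_nhdsWithin] with l hl
  rw [varOf_eq hl (hΦ l hl)]
  ring

lemma entireSeq_trieMean_reducedToll [Fintype A] [DiscreteMeasurableSpace A]
    (h2 : ∀ l, 0 < l → HasSecondMoment p φ l) :
    EntireSeq (trieMean p (reducedToll φ)) :=
  entireSeq_trieMean fun l hl => (h2 l hl).reducedToll

end Coefficients

section Asymptotics

variable {A : Type*} [Fintype A] [Nontrivial A] [MeasurableSpace A] [DiscreteMeasurableSpace A]
  {p : PMF A} {φ : Finset (List A) → ℝ} {C δ ε l : ℝ}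

lemma fE_eq (hp : ∀ a, p a ≠ 0) (h2 : ∀ l, 0 < l → HasSecondMoment p φ l) (hl : 0 < l) :
    fE p φ l = poissonTransform (trieMean p (reducedToll φ)) l := by
  rw [← meanOf_reducedToll hp hl (h2 l hl), meanOf_eq hl (h2 l hl).reducedToll]

lemma hasDerivAt_fE (hp : ∀ a, p a ≠ 0) (h2 : ∀ l, 0 < l → HasSecondMoment p φ l) (hl : 0 < l) :
    HasDerivAt (fE p φ) (poissonTransform (fun n => trieMean p (reducedToll φ) (n + 1) -
      trieMean p (reducedToll φ) n) l) l := by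
  refine ((entireSeq_trieMean_reducedToll h2).hasDerivAt l).congr_of_eventuallyEq ?_
  filter_upwards [Ioi_mem_nhds hl] with x hx using fE_eq hp h2 hx

lemma continuousOn_fE (hp : ∀ a, p a ≠ 0) (h2 : ∀ l, 0 < l → HasSecondMoment p φ l) :
    ContinuousOn (fE p φ) (Set.Ioi 0) :=
  fun _ hx => (hasDerivAt_fE hp h2 hx).continuousAt.continuousWithinAt

lemma exists_tollDecay (hp : ∀ a, p a ≠ 0) (hφ : φ ∅ = 0) (hε : 0 < ε)
    (h2 : ∀ l, 0 < l → HasSecondMoment p φ l)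
    (hE : meanOf p φ =O[atTop] fun l : ℝ => l ^ (1 - ε))
    (hV : varOf p φ =O[atTop] fun l : ℝ => l ^ (1 - ε)) :
    ∃ C δ, TollDecay p φ C δ := by
  have he := isBigO_mul_exp_neg ε
  have hone : (fun l : ℝ => l * Real.exp (-l)) =O[atTop] fun _ => (1 : ℝ) := by
    refine IsBigO.of_bound 1 ?_
    filter_upwards [eventually_gt_atTop 0] with l hl
    rw [Real.norm_of_nonneg (by positivity), norm_one, mul_one]
    exact mul_exp_neg_le l
  have ha := entireSeq_trieMean_reducedToll h2
  have hr : ∀ l, 0 < l → HasSecondMoment p (reducedToll φ) l := fun l hl => (h2 l hl).reducedToll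
  have haa := entireSeq_trieMean_mul hr hr
  obtain ⟨C₁, hC₁, h1⟩ := exists_le_mul_exp_log (continuousOn_fE hp h2) (ε := ε) (by
    obtain ⟨C, hC⟩ := ha.exists_le_pow 2 (trieMean_reducedToll_eq_zero p hφ)
    exact ⟨C, fun x hx hx1 => by rw [fE_eq hp h2 hx]; exact hC x hx hx1⟩) (by
    refine (hE.sub (he.const_mul_left (φ (bullet A)))).congr_left fun l => ?_
    rw [fE]; ring)
  obtain ⟨C₂, hC₂, h3⟩ := exists_le_mul_exp_log (h := varOf p (reducedToll φ)) (ε := ε) (by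
    refine ContinuousOn.congr (f := fun l => poissonTransform (trieMean p (reducedToll φ *
      reducedToll φ)) l - poissonTransform (trieMean p (reducedToll φ)) l ^ 2)
      (haa.continuous.sub (ha.continuous.pow 2)).continuousOn fun l hl => ?_
    exact varOf_eq hl (hr l hl)) (by
    obtain ⟨C, hC⟩ := haa.exists_le_pow 2 (trieMean_reducedToll_mul_eq_zero p hφ _)
    refine ⟨C, fun x hx hx1 => ?_⟩
    rw [abs_of_nonneg (varOf_nonneg _ _ _), varOf_eq hx (hr x hx)]
    have := (le_abs_self _).trans (hC x hx hx1)
    nlinarith [sq_nonneg (poissonTransform (trieMean p (reducedToll φ)) x)]) (by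
    have e1 : (fun l => (l * Real.exp (-l)) * (φ (bullet A))) =O[atTop]
        fun l : ℝ => l ^ (1 - ε) := by
      simpa [mul_comm] using he.const_mul_left (φ (bullet A))
    have e2 : (fun l => meanOf p φ l * (l * Real.exp (-l))) =O[atTop]
        fun l : ℝ => l ^ (1 - ε) := by
      simpa using hE.mul hone
    have e3 : (fun l => (l * Real.exp (-l)) * (l * Real.exp (-l))) =O[atTop]
        fun l : ℝ => l ^ (1 - ε) := by
      simpa using he.mul hone
    have e4 := (hV.sub ((e1.sub e2).const_mul_left (2 * φ (bullet A)))).add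
      ((he.sub e3).const_mul_left (φ (bullet A) ^ 2))
    refine e4.congr' ?_ EventuallyEq.rfl
    filter_upwards [eventually_gt_atTop 0] with l hl
    rw [varOf_reducedToll hp hl (h2 l hl)]
    ring)
  set δ := min ε 1
  have hδ : 0 < δ := lt_min hε one_pos
  refine ⟨max C₁ √C₂, δ / 2, by positivity, le_max_of_le_left hC₁, fun l hl => ?_, fun l hl => ?_⟩
  · refine (h1 l hl).trans ?_
    gcongr
    · exact le_max_left _ _
    · linarith
  · have h4 := h3 l hl
    rw [abs_of_nonneg (varOf_nonneg _ _ _)] at h4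
    calc √(varOf p (reducedToll φ) l) ≤ √(l * (C₂ * Real.exp (-(δ * |Real.log l|)))) :=
          Real.sqrt_le_sqrt h4
      _ = √l * (√C₂ * Real.exp (-(δ / 2 * |Real.log l|))) := by
          rw [Real.sqrt_mul hl.le, Real.sqrt_mul hC₂, ← Real.exp_half]
          congr 3
          ring
      _ ≤ _ := by
          gcongr
          exact le_max_right _ _

lemma abs_fC_le (hp : ∀ a, p a ≠ 0) (h2 : ∀ l, 0 < l → HasSecondMoment p φ l)
    (hd : TollDecay p φ C δ) (hl : 0 < l) :
    |fC p φ l| ≤ l * (C * Real.exp (-(δ * |Real.log l|))) := by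
  rw [← covNumOf_reducedToll hp hl (h2 l hl)]
  refine (abs_covNumOf_le hl (h2 l hl).reducedToll).trans ?_
  refine (mul_le_mul_of_nonneg_right (hd.sqrt_var l hl) (Real.sqrt_nonneg _)).trans_eq ?_
  rw [mul_right_comm, Real.mul_self_sqrt hl.le]

lemma exists_abs_fV_le (hp : ∀ a, p a ≠ 0) (hφ : φ ∅ = 0)
    (h2 : ∀ l, 0 < l → HasSecondMoment p φ l) (hd : TollDecay p φ C δ) :
    ∃ C', ∀ l, 0 < l → |fV p φ l| ≤ l * (C' * Real.exp (-(δ * |Real.log l|))) := by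
  obtain ⟨M, hM0, hM⟩ := exists_sqrt_varOf_additive_le hp hφ h2 hd
  refine ⟨2 * C * M + C ^ 2, fun l hl => ?_⟩
  set u := Real.exp (-(δ * |Real.log l|)) with hu
  have hu0 : 0 ≤ u := (Real.exp_pos _).le
  have hu1 : u ≤ 1 := exp_neg_mul_abs_le_one hd.pos _
  have hC := hd.nonneg
  have hΦ := hasSecondMoment_additive hp hφ h2 hd hl
  have hs := hd.sqrt_var l hl
  have hv : varOf p (reducedToll φ) l ≤ l * (C ^ 2 * u) := by
    rw [Real.sqrt_le_left (by positivity), mul_pow, Real.sq_sqrt hl.le, mul_pow] at hs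
    refine hs.trans (mul_le_mul_of_nonneg_left (mul_le_mul_of_nonneg_left ?_ (sq_nonneg _)) hl.le)
    rw [← hu]
    nlinarith
  have hc : |covOf p (reducedToll φ) (additive φ) l| ≤ l * (C * M * u) := by
    refine (abs_covOf_le (h2 l hl).reducedToll hΦ).trans ((mul_le_mul hs (hM l hl)
      (Real.sqrt_nonneg _) (by positivity)).trans_eq ?_)
    rw [mul_mul_mul_comm, Real.mul_self_sqrt hl.le]
    ring
  rw [fV_eq hp hl (h2 l hl) hΦ]
  have h0 := varOf_nonneg p (reducedToll φ) l
  rw [abs_le] at hc ⊢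
  constructor <;> nlinarith

/-! #### Derivatives -/

lemma fC_eq (hp : ∀ a, p a ≠ 0) (h2 : ∀ l, 0 < l → HasSecondMoment p φ l) (hl : 0 < l) :
    fC p φ l = l * poissonTransform (fun n => trieMean p (reducedToll φ) (n + 1) -
      trieMean p (reducedToll φ) n) l := by
  rw [← covNumOf_reducedToll hp hl (h2 l hl), covNumOf_eq (fun l hl => (h2 l hl).reducedToll) hl]

lemma exists_hasDerivAt_fC (hp : ∀ a, p a ≠ 0) (hφ : φ ∅ = 0)
    (h2 : ∀ l, 0 < l → HasSecondMoment p φ l) :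
    ∃ f' : ℝ → ℝ, Continuous f' ∧ (∀ l, 0 < l → HasDerivAt (fC p φ) (f' l) l) ∧
      ∃ K, ∀ l, 0 < l → l ≤ 1 → |f' l| ≤ K * l := by
  have ha := entireSeq_trieMean_reducedToll h2
  have h0 := trieMean_reducedToll_eq_zero p hφ
  refine ⟨_, ha.diff.continuous.add (continuous_id.mul ha.diff.diff.continuous), fun l hl => ?_, ?_⟩
  · have h := (hasDerivAt_id l).mul (ha.diff.hasDerivAt l)
    rw [one_mul] at h
    refine h.congr_of_eventuallyEq ?_
    filter_upwards [Ioi_mem_nhds hl] with x hx using fC_eq hp h2 hx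
  · obtain ⟨K₁, hK₁⟩ := ha.diff.exists_le_pow 1 (by
      intro n hn
      obtain rfl : n = 0 := by omega
      rw [h0 0 (by norm_num), h0 1 (by norm_num), sub_zero])
    obtain ⟨K₂, hK₂⟩ := ha.diff.diff.exists_le_pow 0 (by simp)
    refine ⟨K₁ + K₂, fun l hl hl1 => ?_⟩
    have h3 := hK₁ l hl hl1
    have h4 := hK₂ l hl hl1
    rw [pow_one] at h3
    rw [pow_zero, mul_one] at h4
    refine (abs_add_le _ _).trans ?_
    rw [Pi.mul_apply, abs_mul, id, abs_of_pos hl]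
    nlinarith

lemma exists_hasDerivAt_fV (hp : ∀ a, p a ≠ 0) (hφ : φ ∅ = 0)
    (h2 : ∀ l, 0 < l → HasSecondMoment p φ l)
    (hΦ : ∀ l, 0 < l → HasSecondMoment p (additive φ) l) :
    ∃ f' : ℝ → ℝ, Continuous f' ∧ (∀ l, 0 < l → HasDerivAt (fV p φ) (f' l) l) ∧
      ∃ K, ∀ l, 0 < l → l ≤ 1 → |f' l| ≤ K * l := by
  have hr : ∀ l, 0 < l → HasSecondMoment p (reducedToll φ) l := fun l hl => (h2 l hl).reducedToll
  have ha := entireSeq_trieMean hr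
  have hb := entireSeq_trieMean_mul hr hΦ
  have hP := entireSeq_trieMean hΦ
  have hQ := entireSeq_trieMean_mul hr hr
  set a := trieMean p (reducedToll φ)
  set b := trieMean p (reducedToll φ * additive φ)
  set P := trieMean p (additive φ)
  set Q := trieMean p (reducedToll φ * reducedToll φ)
  have ha0 : ∀ n < 2, a n = 0 := trieMean_reducedToll_eq_zero p hφ
  have hb0 : ∀ n < 2, b n = 0 := trieMean_reducedToll_mul_eq_zero p hφ _
  have hQ0 : ∀ n < 2, Q n = 0 := trieMean_reducedToll_mul_eq_zero p hφ _
  have hdiff : ∀ {c : ℕ → ℝ}, EntireSeq c → (∀ n < 2, c n = 0) →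
      ∃ K, ∀ x, 0 < x → x ≤ 1 → |poissonTransform (fun n => c (n + 1) - c n) x| ≤ K * x := by
    intro c hc h0
    obtain ⟨K, hK⟩ := hc.diff.exists_le_pow 1 (by
      intro n hn
      obtain rfl : n = 0 := by omega
      rw [h0 0 (by norm_num), h0 1 (by norm_num), sub_zero])
    exact ⟨K, by simpa using hK⟩
  have hbd : ∀ {c : ℕ → ℝ}, EntireSeq c → ∃ K, ∀ x, 0 < x → x ≤ 1 → |poissonTransform c x| ≤ K := by
    intro c hc
    obtain ⟨K, hK⟩ := hc.exists_le_pow 0 (by simp)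
    exact ⟨K, by simpa using hK⟩
  refine ⟨fun x => 2 * (poissonTransform (fun n => b (n + 1) - b n) x -
      (poissonTransform (fun n => a (n + 1) - a n) x * poissonTransform P x +
        poissonTransform a x * poissonTransform (fun n => P (n + 1) - P n) x)) -
      (poissonTransform (fun n => Q (n + 1) - Q n) x -
        (poissonTransform (fun n => a (n + 1) - a n) x * poissonTransform a x +
          poissonTransform a x * poissonTransform (fun n => a (n + 1) - a n) x)), ?_,
    fun l hl => ?_, ?_⟩
  · have := ha.continuous
    have := ha.diff.continuous
    have := hb.diff.continuous
    have := hP.continuous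
    have := hP.diff.continuous
    have := hQ.diff.continuous
    fun_prop
  · have h := (((hb.hasDerivAt l).sub ((ha.hasDerivAt l).mul (hP.hasDerivAt l))).const_mul 2).sub
      ((hQ.hasDerivAt l).sub ((ha.hasDerivAt l).mul (ha.hasDerivAt l)))
    refine h.congr_of_eventuallyEq ?_
    filter_upwards [Ioi_mem_nhds hl] with x hx
    rw [fV_eq hp hx (h2 x hx) (hΦ x hx), covOf_eq hx (hr x hx) (hΦ x hx), varOf_eq hx (hr x hx), sq]
    rfl
  · obtain ⟨K₁, hK₁⟩ := hdiff hb hb0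
    obtain ⟨K₂, hK₂⟩ := hdiff ha ha0
    obtain ⟨K₃, hK₃⟩ := hdiff hQ hQ0
    obtain ⟨K₄, hK₄⟩ := ha.exists_le_pow 1 fun n hn => ha0 n (by omega)
    obtain ⟨K₅, hK₅⟩ := hbd hP
    obtain ⟨K₆, hK₆⟩ := hbd hP.diff
    obtain ⟨K₇, hK₇⟩ := hbd ha
    refine ⟨2 * (K₁ + (K₂ * K₅ + K₄ * K₆)) + (K₃ + (K₂ * K₇ + K₇ * K₂)), fun l hl hl1 => ?_⟩
    have e1 := hK₁ l hl hl1
    have e2 := hK₂ l hl hl1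
    have e3 := hK₃ l hl hl1
    have e4 := hK₄ l hl hl1
    have e5 := hK₅ l hl hl1
    have e6 := hK₆ l hl hl1
    have e7 := hK₇ l hl hl1
    rw [pow_one] at e4
    have m1 := mul_le_mul e2 e5 (abs_nonneg _) ((abs_nonneg _).trans e2)
    have m2 := mul_le_mul e4 e6 (abs_nonneg _) ((abs_nonneg _).trans e4)
    have m3 := mul_le_mul e2 e7 (abs_nonneg _) ((abs_nonneg _).trans e2)
    rw [← abs_mul] at m1 m2 m3
    refine (abs_sub _ _).trans ?_
    rw [abs_mul, abs_two]
    have s1 := abs_sub (poissonTransform (fun n => b (n + 1) - b n) l)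
      (poissonTransform (fun n => a (n + 1) - a n) l * poissonTransform P l +
        poissonTransform a l * poissonTransform (fun n => P (n + 1) - P n) l)
    have s2 := abs_add_le (poissonTransform (fun n => a (n + 1) - a n) l * poissonTransform P l)
      (poissonTransform a l * poissonTransform (fun n => P (n + 1) - P n) l)
    have s3 := abs_sub (poissonTransform (fun n => Q (n + 1) - Q n) l)
      (poissonTransform (fun n => a (n + 1) - a n) l * poissonTransform a l +
          poissonTransform a l * poissonTransform (fun n => a (n + 1) - a n) l)
    have s4 := abs_add_le (poissonTransform (fun n => a (n + 1) - a n) l * poissonTransform a l)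
      (poissonTransform a l * poissonTransform (fun n => a (n + 1) - a n) l)
    rw [mul_comm (poissonTransform a l) (poissonTransform (fun n => a (n + 1) - a n) l)] at s3 s4 ⊢
    linarith

lemma fourierSeriesConverges_fE (hp : ∀ a, p a ≠ 0) (h2 : ∀ l, 0 < l → HasSecondMoment p φ l)
    (hd : TollDecay p φ C δ) (hper : 0 < period p) :
    FourierSeriesConverges (period p) (fE p φ) (psi (period p) (fE p φ)) := by
  refine fourierSeriesConverges_psi hper hd.pos (fun x hx => hasDerivAt_fE hp h2 hx)
    (entireSeq_trieMean_reducedToll h2).diff.continuous.continuousOn (abs_logForm_le hd.mean)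
    (C' := C) fun t => ?_
  have h := abs_fC_le hp h2 hd (Real.exp_pos t)
  rw [fC_eq hp h2 (Real.exp_pos t), abs_mul, abs_of_pos (Real.exp_pos t), Real.log_exp] at h
  exact le_of_mul_le_mul_left h (Real.exp_pos t)

/-! #### Limits -/

lemma meanOf_additive (hp : ∀ a, p a ≠ 0) (hφ : φ ∅ = 0)
    (h2 : ∀ l, 0 < l → HasSecondMoment p φ l)
    (hΦ : ∀ l, 0 < l → HasSecondMoment p (additive φ) l) (hl : 0 < l) :
    meanOf p (additive φ) l = fE p φ l + ∑ a, meanOf p (additive φ) (l * (p a).toReal) := by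
  have := meanOf_additiveBelow_succ hp hφ (k := ⊤) (by simp) h2 (by rwa [additiveBelow_top]) hl
  rwa [top_add, additiveBelow_top] at this

lemma covNumOf_additive (hp : ∀ a, p a ≠ 0) (hφ : φ ∅ = 0)
    (h2 : ∀ l, 0 < l → HasSecondMoment p φ l)
    (hΦ : ∀ l, 0 < l → HasSecondMoment p (additive φ) l) (hl : 0 < l) :
    covNumOf p (additive φ) l = fC p φ l + ∑ a, covNumOf p (additive φ) (l * (p a).toReal) := by
  have hP := entireSeq_trieMean hΦ
  have hcomp : ∀ a, HasDerivAt
      (fun x => poissonTransform (trieMean p (additive φ)) (x * (p a).toReal)) _ l := fun a =>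
    HasDerivAt.comp (h₂ := poissonTransform (trieMean p (additive φ)))
      (h := fun x => x * (p a).toReal) l (hP.hasDerivAt (l * (p a).toReal))
      (hasDerivAt_mul_const (p a).toReal)
  have hder : HasDerivAt (fun x => fE p φ x +
      ∑ a, poissonTransform (trieMean p (additive φ)) (x * (p a).toReal)) _ l :=
    (hasDerivAt_fE hp h2 hl).add (HasDerivAt.fun_sum fun a _ => hcomp a)
  have heq : poissonTransform (trieMean p (additive φ)) =ᶠ[𝓝 l] fun x => fE p φ x +
      ∑ a, poissonTransform (trieMean p (additive φ)) (x * (p a).toReal) := by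
    filter_upwards [Ioi_mem_nhds hl] with x hx
    have := meanOf_additive hp hφ h2 hΦ hx
    rw [meanOf_eq hx (hΦ x hx)] at this
    rw [this]
    congr 1
    exact Finset.sum_congr rfl fun a _ =>
      meanOf_eq (mul_toReal_pos hp hx a) (hΦ _ (mul_toReal_pos hp hx a))
  have h := (hP.hasDerivAt l).unique (hder.congr_of_eventuallyEq heq)
  rw [covNumOf_eq hΦ hl, fC_eq hp h2 hl, h, mul_add, Finset.mul_sum]
  congr 1
  refine Finset.sum_congr rfl fun a _ => ?_
  rw [covNumOf_eq hΦ (mul_toReal_pos hp hl a)]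
  ring

end Asymptotics
end RandomTrie

namespace RandomTrie
open Filter Topology MeasureTheory ProbabilityTheory Asymptotics

/-! ### Non-negative toll functions -/

section Positivity

lemma psi_nonneg {d : ℝ} (hd : 0 ≤ d) {f : ℝ → ℝ} (hf : ∀ x, 0 < x → 0 ≤ f x) (t : ℝ) :
    0 ≤ psi d f t := by
  have h : ∀ t, 0 ≤ logForm f t := fun t =>
    mul_nonneg (Real.exp_pos _).le (hf _ (Real.exp_pos t))
  rcases hd.eq_or_lt with rfl | hd
  · simp only [psi, if_true]
    exact integral_nonneg h
  · rw [psi_of_pos hd, latticeSum]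
    exact tsum_nonneg fun k => mul_nonneg hd.le (h _)

lemma exists_pos_le_psi {d δ C : ℝ} (hd : 0 ≤ d) (hδ : 0 < δ) {f : ℝ → ℝ}
    (hc : ContinuousOn f (Set.Ioi 0)) (hg : ∀ t, |logForm f t| ≤ C * Real.exp (-(δ * |t|)))
    (hf : ∀ x, 0 < x → 0 < f x) : ∃ c, 0 < c ∧ ∀ t, c ≤ psi d f t := by
  have h : ∀ t, 0 < logForm f t := fun t => mul_pos (Real.exp_pos _) (hf _ (Real.exp_pos t))
  have hψ := isPsi_psi hd hδ hc hg
  rcases hd.eq_or_lt with rfl | hd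
  · refine ⟨∫ t, logForm f t, ?_, fun t => by simp [psi]⟩
    rw [integral_pos_iff_support_of_nonneg (fun t => (h t).le)
      (integrable_of_exp_decay hδ (continuous_logForm hc) hg)]
    have : Function.support (logForm f) = Set.univ := by
      ext t; simp [(h t).ne']
    simp [this]
  · have hpos : ∀ t, 0 < psi d f t := fun t => by
      have h1 := hψ.latticeSum hd t
      have h2 : ∀ k : ℤ, 0 < d * (Real.exp (k * d - t) * f (Real.exp (t - k * d))) := fun k =>
        mul_pos hd (mul_pos (Real.exp_pos _) (hf _ (Real.exp_pos _)))
      rw [← h1.tsum_eq]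
      exact h1.summable.tsum_pos (fun k => (h2 k).le) 0 (h2 0)
    obtain ⟨t₀, _, ht₀⟩ := isCompact_Icc.exists_isMinOn (Set.nonempty_Icc.2 hd.le)
      hψ.continuous.continuousOn
    refine ⟨psi d f t₀, hpos t₀, fun t => ?_⟩
    obtain ⟨s, hs, hst⟩ := (hψ.periodic hd).exists_mem_Ico₀ hd t
    rw [hst]
    exact ht₀ (Set.Ico_subset_Icc_self hs)

variable {A : Type*}

lemma countOn_congr_of_agree {Ξ Ξ' : ℕ → ℕ → A} {S : Finset ℕ} {h : ℕ}
    (hag : ∀ k ∈ S, ∀ i < h, Ξ k i = Ξ' k i) {α : List A} (hα : α.length ≤ h) :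
    countOn Ξ S α = countOn Ξ' S α := by
  classical
  rw [countOn, countOn]
  congr 1
  refine Finset.filter_congr fun k hk => forall_congr' fun i => forall_congr' fun hi => ?_
  rw [hag k hk i (by omega)]

lemma SeparatedAt.congr {Ξ Ξ' : ℕ → ℕ → A} {S : Finset ℕ} {h : ℕ} (hs : SeparatedAt Ξ S h)
    (hag : ∀ k ∈ S, ∀ i < h, Ξ k i = Ξ' k i) : SeparatedAt Ξ' S h :=
  fun j hj k hk hjk => hs j hj k hk fun i hi => by
    rw [hag j hj i hi, hag k hk i hi, hjk i hi]

lemma SeparatedAt.nodesOn_subset {Ξ Ξ' : ℕ → ℕ → A} {S : Finset ℕ} {h : ℕ}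
    (hs : SeparatedAt Ξ S h) (hag : ∀ k ∈ S, ∀ i < h, Ξ k i = Ξ' k i) :
    nodesOn Ξ S ⊆ nodesOn Ξ' S := by
  intro α hα
  have hlen := hs.length_le hα
  simp only [nodesOn, Set.mem_ofPred_eq] at hα ⊢
  rwa [← countOn_congr_of_agree hag hlen,
    ← countOn_congr_of_agree hag (α := α.dropLast) (by rw [List.length_dropLast]; omega)]

/-- Strings that are separated by their prefixes of length `h` may be changed beyond these. -/
lemma SeparatedAt.trieOn_eq {Ξ Ξ' : ℕ → ℕ → A} {S : Finset ℕ} {h : ℕ}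
    (hs : SeparatedAt Ξ S h) (hag : ∀ k ∈ S, ∀ i < h, Ξ k i = Ξ' k i) :
    trieOn Ξ S = trieOn Ξ' S := by
  have : nodesOn Ξ S = nodesOn Ξ' S := (hs.nodesOn_subset hag).antisymm
    ((hs.congr hag).nodesOn_subset fun k hk i hi => (hag k hk i hi).symm)
  ext α
  rw [mem_trieOn, mem_trieOn, this]

lemma isTrie_bullet [Nonempty A] : IsTrie (bullet A) := by
  refine ⟨1, fun _ _ => Classical.arbitrary A, ?_, ?_⟩
  · intro j hj k hk _
    rw [Set.mem_Iio] at hj hk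
    omega
  · rw [trie_eq_trieOn, trieOn_of_card_eq_one _ (by simp)]

variable [MeasurableSpace A] [DiscreteMeasurableSpace A] {p : PMF A}

lemma stringsLaw_box_ne_zero (hp : ∀ a, p a ≠ 0) (Ξ : ℕ → ℕ → A) (n h : ℕ) :
    stringsLaw p {Ξ' | ∀ k ∈ Finset.range n, ∀ i < h, Ξ k i = Ξ' k i} ≠ 0 := by
  have e : {Ξ' : ℕ → ℕ → A | ∀ k ∈ Finset.range n, ∀ i < h, Ξ k i = Ξ' k i} =
      Set.pi (Finset.range n) fun k => Set.pi (Finset.range h) fun i => {Ξ k i} := by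
    ext Ξ'
    simp [Set.mem_pi, eq_comm]
  rw [e, stringsLaw, Measure.infinitePi_pi _ fun k _ =>
    MeasurableSet.pi (Finset.countable_toSet _) fun i _ => MeasurableSet.of_discrete]
  refine Finset.prod_ne_zero_iff.2 fun k _ => ?_
  rw [Measure.infinitePi_pi _ fun i _ => MeasurableSet.of_discrete]
  refine Finset.prod_ne_zero_iff.2 fun i _ => ?_
  rw [PMF.toMeasure_apply_singleton _ _ MeasurableSet.of_discrete]
  exact hp _

/-- Every trie is a value of the random trie with positive probability. -/
lemma model_randomTrie_eq_ne_zero (hp : ∀ a, p a ≠ 0) {T : Finset (List A)} (hT : IsTrie T) {l : ℝ}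
    (hl : 0 < l) : model p l {ω | randomTrie ω = T} ≠ 0 := by
  obtain ⟨n, Ξ, hΞ, rfl⟩ := hT
  obtain ⟨h, hs⟩ := exists_separatedAt (Ξ := Ξ) (S := Finset.range n) (by simpa using hΞ)
  have hsub : {n} ×ˢ {Ξ' | ∀ k ∈ Finset.range n, ∀ i < h, Ξ k i = Ξ' k i} ⊆
      {ω | randomTrie ω = trie Ξ n} := by
    rintro ⟨m, Ξ'⟩ ⟨hm, hΞ'⟩
    rw [Set.mem_singleton_iff] at hm
    subst hm
    exact (hs.trieOn_eq hΞ').symm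
  refine fun h0 => mul_ne_zero ?_ (stringsLaw_box_ne_zero hp Ξ n h)
    (((Measure.prod_prod _ _).symm.trans_le (measure_mono hsub)).trans_eq h0 |>.antisymm bot_le)
  have hpos := poissonMeasure_real_singleton_pos n (Real.toNNReal_pos.2 hl)
  exact fun h1 => by simp [measureReal_def, h1] at hpos

variable [Fintype A] [Nontrivial A] {φ : Finset (List A) → ℝ} {l : ℝ}

lemma ae_reducedToll_nonneg (hp : ∀ a, p a ≠ 0) (hφ : φ ∅ = 0) (hnn : ∀ T, IsTrie T → 0 ≤ φ T)
    (l : ℝ) : 0 ≤ᵐ[model p l] fun ω => reducedToll φ (randomTrie ω) := by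
  filter_upwards [ae_injective hp l] with ω hω
  have h1 : reducedToll φ (randomTrie ω) = _ := reducedToll_trieOn hφ hω.injOn
  have h2 := hnn (randomTrie ω) ⟨ω.1, ω.2, hω.injOn, rfl⟩
  rw [Pi.zero_apply, h1]
  split_ifs
  · exact h2
  · exact le_rfl

lemma fE_nonneg (hp : ∀ a, p a ≠ 0) (hφ : φ ∅ = 0) (h2 : ∀ l, 0 < l → HasSecondMoment p φ l)
    (hnn : ∀ T, IsTrie T → 0 ≤ φ T) (hl : 0 < l) : 0 ≤ fE p φ l := by
  rw [← meanOf_reducedToll hp hl (h2 l hl)]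
  exact integral_nonneg_of_ae (ae_reducedToll_nonneg hp hφ hnn l)

lemma fE_pos (hp : ∀ a, p a ≠ 0) (hφ : φ ∅ = 0) (h2 : ∀ l, 0 < l → HasSecondMoment p φ l)
    (hnn : ∀ T, IsTrie T → 0 ≤ φ T) {T : Finset (List A)} (hT : IsTrie T) (hTφ : 0 < φ T)
    (hTb : T ≠ bullet A) (hl : 0 < l) : 0 < fE p φ l := by
  rw [← meanOf_reducedToll hp hl (h2 l hl), meanOf,
    integral_pos_iff_support_of_nonneg_ae (ae_reducedToll_nonneg hp hφ hnn l)
      (h2 l hl).reducedToll.integrable]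
  refine (pos_iff_ne_zero.2 (model_randomTrie_eq_ne_zero hp hT hl)).trans_le
    (measure_mono fun ω hω => ?_)
  rw [Set.mem_ofPred_eq] at hω
  rw [Function.mem_support, hω, reducedToll, if_neg hTb, sub_zero]
  exact hTφ.ne'

lemma exists_pos_le_psi_fE (hp : ∀ a, p a ≠ 0) (hφ : φ ∅ = 0)
    (h2 : ∀ l, 0 < l → HasSecondMoment p φ l) {C δ : ℝ} (hd : TollDecay p φ C δ)
    (hnn : ∀ T, IsTrie T → 0 ≤ φ T) (hpos : ∃ T, IsTrie T ∧ 0 < φ T) :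
    ∃ c : ℝ, 0 < c ∧ ∀ t, c ≤ 1 / entropy p * psi (period p) (fE p φ) t + φ (bullet A) := by
  have hH := one_div_pos.2 (entropy_pos hp)
  have hχ := hnn _ isTrie_bullet
  obtain ⟨T, hT, hTφ⟩ := hpos
  by_cases hTb : T = bullet A
  · subst hTb
    refine ⟨φ (bullet A), hTφ, fun t => le_add_of_nonneg_left (mul_nonneg hH.le ?_)⟩
    exact psi_nonneg (period_nonneg hp) (fun x hx => fE_nonneg hp hφ h2 hnn hx) t
  · obtain ⟨c, hc, h⟩ := exists_pos_le_psi (period_nonneg hp) hd.pos (continuousOn_fE hp h2)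
      (abs_logForm_le hd.mean) fun x hx => fE_pos hp hφ h2 hnn hT hTφ hTb hx
    refine ⟨1 / entropy p * c, mul_pos hH hc, fun t => ?_⟩
    have := mul_le_mul_of_nonneg_left (h t) hH.le
    linarith

lemma isTheta_of_tendsto_div_sub {F u : ℝ → ℝ} {c M : ℝ} (hc : 0 < c) (hcu : ∀ l, c ≤ u l)
    (huM : ∀ l, u l ≤ M) (h : Tendsto (fun l => F l / l - u l) atTop (𝓝 0)) :
    F =Θ[atTop] fun l : ℝ => l := by
  have h1 : ∀ᶠ l in atTop, |F l / l - u l| < c / 2 := by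
    have := (Metric.tendsto_nhds.1 h) (c / 2) (by positivity)
    simpa [Real.dist_eq] using this
  constructor
  · refine IsBigO.of_bound (M + c / 2) ?_
    filter_upwards [h1, eventually_gt_atTop 0] with l hl hl0
    rw [abs_lt] at hl
    have e1 : 0 ≤ F l / l := by linarith [hcu l, hl.1]
    have e2 : F l / l ≤ M + c / 2 := by linarith [huM l, hl.2]
    rw [div_le_iff₀ hl0] at e2
    have e3 : 0 ≤ F l := by
      have := mul_nonneg e1 hl0.le
      rwa [div_mul_cancel₀ _ hl0.ne'] at this
    rwa [Real.norm_of_nonneg e3, Real.norm_of_nonneg hl0.le]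
  · refine IsBigO.of_bound (2 / c) ?_
    filter_upwards [h1, eventually_gt_atTop 0] with l hl hl0
    rw [abs_lt] at hl
    have e1 : c / 2 ≤ F l / l := by linarith [hcu l, hl.1]
    rw [le_div_iff₀ hl0] at e1
    rw [Real.norm_of_nonneg hl0.le, div_mul_eq_mul_div, le_div_iff₀ hc]
    have := le_abs_self (F l)
    rw [Real.norm_eq_abs]
    linarith

end Positivity

lemma tendsto_of_tendsto_div_sub_psi {d H χ : ℝ} (hd : d = 0) {f F : ℝ → ℝ}
    (h : Tendsto (fun l => F l / l - (χ + 1 / H * psi d f (Real.log l))) atTop (𝓝 0)) :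
    Tendsto (fun l => F l / l) atTop (𝓝 (χ + 1 / H * ∫ x in Set.Ioi (0 : ℝ), f x / x ^ 2)) := by
  subst hd
  simp only [psi, if_true, integral_logForm] at h
  have h1 := h.add_const (χ + 1 / H * ∫ x in Set.Ioi (0 : ℝ), f x / x ^ 2)
  rw [zero_add] at h1
  exact h1.congr fun l => sub_add_cancel _ _

end RandomTrie

open RandomTrie Filter Topology Asymptotics in
/-- Mean, variance and covariance with the number of strings, for an additive functional of a
random trie in the Poisson model. Only the values of `φ` on tries matter. -/
theorem mainTheorem2 {A : Type*} [Fintype A] [Nontrivial A]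
    [MeasurableSpace A] [DiscreteMeasurableSpace A]
    (p : PMF A) (hp : ∀ a, p a ≠ 0)
    (φ : Finset (List A) → ℝ) (hφ : φ ∅ = 0)
    (ε : ℝ) (hε : 0 < ε)
    (hfin : ∀ᶠ l in atTop, HasSecondMoment p φ l)
    (hE : meanOf p φ =O[atTop] fun l : ℝ => l ^ (1 - ε))
    (hV : varOf p φ =O[atTop] fun l : ℝ => l ^ (1 - ε)) :
    -- all the moments are finite
    (∀ l : ℝ, 0 < l → HasSecondMoment p φ l ∧ HasSecondMoment p (additive φ) l) ∧
    -- (i) the limits in the non-periodic case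
    (period p = 0 →
      (Tendsto (fun l => meanOf p (additive φ) l / l) atTop
          (𝓝 (φ (bullet A) + 1 / entropy p * ∫ x in Set.Ioi (0 : ℝ), fE p φ x / x ^ 2)) ∧
        mellinR (fE p φ) (-1) = ((∫ x in Set.Ioi (0 : ℝ), fE p φ x / x ^ 2 : ℝ) : ℂ)) ∧
      (Tendsto (fun l => varOf p (additive φ) l / l) atTop
          (𝓝 (φ (bullet A) ^ 2 + 1 / entropy p * ∫ x in Set.Ioi (0 : ℝ), fV p φ x / x ^ 2)) ∧
        mellinR (fV p φ) (-1) = ((∫ x in Set.Ioi (0 : ℝ), fV p φ x / x ^ 2 : ℝ) : ℂ)) ∧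
      (Tendsto (fun l => covNumOf p (additive φ) l / l) atTop
          (𝓝 (φ (bullet A) + 1 / entropy p * ∫ x in Set.Ioi (0 : ℝ), fC p φ x / x ^ 2)) ∧
        mellinR (fC p φ) (-1) = ((∫ x in Set.Ioi (0 : ℝ), fC p φ x / x ^ 2 : ℝ) : ℂ))) ∧
    -- (ii) the general case
    ∃ ψE ψV ψC : ℝ → ℝ,
      IsPsi (period p) (fE p φ) ψE ∧
      IsPsi (period p) (fV p φ) ψV ∧
      IsPsi (period p) (fC p φ) ψC ∧
      Tendsto (fun l => meanOf p (additive φ) l / l -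
        (φ (bullet A) + 1 / entropy p * ψE (Real.log l))) atTop (𝓝 0) ∧
      Tendsto (fun l => varOf p (additive φ) l / l -
        (φ (bullet A) ^ 2 + 1 / entropy p * ψV (Real.log l))) atTop (𝓝 0) ∧
      Tendsto (fun l => covNumOf p (additive φ) l / l -
        (φ (bullet A) + 1 / entropy p * ψC (Real.log l))) atTop (𝓝 0) ∧
      (0 < period p →
        FourierSeriesConverges (period p) (fE p φ) ψE ∧
        ((∃ ε₁ : ℝ, 0 < ε₁ ∧ deriv (fV p φ) =O[atTop] fun l : ℝ => l ^ (-ε₁)) →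
          FourierSeriesConverges (period p) (fV p φ) ψV) ∧
        ((∃ ε₁ : ℝ, 0 < ε₁ ∧ deriv (fC p φ) =O[atTop] fun l : ℝ => l ^ (-ε₁)) →
          FourierSeriesConverges (period p) (fC p φ) ψC)) ∧
      -- (iii) linear growth for non-negative toll functions
      ((∀ T, IsTrie T → 0 ≤ φ T) → (∃ T, IsTrie T ∧ 0 < φ T) →
        (∃ c : ℝ, 0 < c ∧ ∀ t, c ≤ 1 / entropy p * ψE t + φ (bullet A)) ∧
        meanOf p (additive φ) =Θ[atTop] fun l : ℝ => l) := by
  have h2 : ∀ l, 0 < l → HasSecondMoment p φ l := fun l hl => hasSecondMoment_of_eventually hfin hl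
  obtain ⟨C, δ, hd⟩ := exists_tollDecay hp hφ hε h2 hE hV
  have hΦ : ∀ l, 0 < l → HasSecondMoment p (additive φ) l := fun l hl =>
    hasSecondMoment_additive hp hφ h2 hd hl
  obtain ⟨fV', hVc, hVd, hV0⟩ := exists_hasDerivAt_fV hp hφ h2 hΦ
  obtain ⟨fC', hCc, hCd, hC0⟩ := exists_hasDerivAt_fC hp hφ h2
  obtain ⟨CV, hfV⟩ := exists_abs_fV_le hp hφ h2 hd
  have hfC : ∀ l, 0 < l → |fC p φ l| ≤ l * (C * Real.exp (-(δ * |Real.log l|))) := fun l hl =>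
    abs_fC_le hp h2 hd hl
  have hEcont := continuousOn_fE hp h2
  have hVcont : ContinuousOn (fV p φ) (Set.Ioi 0) := fun x hx =>
    (hVd x hx).continuousAt.continuousWithinAt
  have hCcont : ContinuousOn (fC p φ) (Set.Ioi 0) := fun x hx =>
    (hCd x hx).continuousAt.continuousWithinAt
  have hper := period_nonneg hp
  have limE := tendsto_div_sub_add_psi hp hd.pos hEcont hd.mean
    (fun l hl => meanOf_additive hp hφ h2 hΦ hl) (tendsto_meanOf_additive_div hΦ)
  have limV := tendsto_div_sub_add_psi hp hd.pos hVcont hfV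
    (fun l hl => varOf_additive hp hφ h2 hΦ hl) (tendsto_varOf_additive_div hΦ)
  have limC := tendsto_div_sub_add_psi hp hd.pos hCcont hfC
    (fun l hl => covNumOf_additive hp hφ h2 hΦ hl) (tendsto_covNumOf_additive_div hΦ)
  have hψE := isPsi_psi hper hd.pos hEcont (abs_logForm_le hd.mean)
  refine ⟨fun l hl => ⟨h2 l hl, hΦ l hl⟩, fun h0 => ?_, _, _, _, hψE,
    isPsi_psi hper hd.pos hVcont (abs_logForm_le hfV),
    isPsi_psi hper hd.pos hCcont (abs_logForm_le hfC), limE, limV, limC, fun hpos => ⟨?_, ?_, ?_⟩,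
    fun hnn hex => ?_⟩
  · exact ⟨⟨tendsto_of_tendsto_div_sub_psi h0 limE, mellinR_neg_one _⟩,
      ⟨tendsto_of_tendsto_div_sub_psi h0 limV, mellinR_neg_one _⟩,
      ⟨tendsto_of_tendsto_div_sub_psi h0 limC, mellinR_neg_one _⟩⟩
  · exact fourierSeriesConverges_fE hp h2 hd hpos
  · rintro ⟨ε₁, hε₁, hO⟩
    exact fourierSeriesConverges_of_deriv hpos hd.pos (abs_logForm_le hfV) hVc hVd hV0 hε₁ hO
  · rintro ⟨ε₁, hε₁, hO⟩
    exact fourierSeriesConverges_of_deriv hpos hd.pos (abs_logForm_le hfC) hCc hCd hC0 hε₁ hO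
  · obtain ⟨c, hc, hcψ⟩ := exists_pos_le_psi_fE hp hφ h2 hd hnn hex
    refine ⟨⟨c, hc, hcψ⟩, ?_⟩
    obtain ⟨M, hM⟩ := hψE.bounded
    refine isTheta_of_tendsto_div_sub hc (M := φ (bullet A) + 1 / entropy p * M)
      (fun l => (hcψ (Real.log l)).trans_eq (add_comm _ _)) (fun l => ?_) limE
    have := mul_le_mul_of_nonneg_left ((le_abs_self _).trans (hM (Real.log l)))
      (one_div_pos.2 (entropy_pos hp)).le
    linarith
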